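/- There is a deterministic algorithm for metric $k$-median with the following guarantee. Given a weighted metric space $(V,w,d)$ of size $n$, with weights $w:V\to\mathbb R_{\ge 0}$, and an integer $1\le k\le n$, it outputs a nonempty set $S\subseteq V$ of at most $k$ centers such that $$\mathrm{cost}(S)\;\le\; O\bigl(1+\log(n/k)\bigr)\cdot \mathrm{OPT}_k(V),$$ where $\mathrm{cost}(S)=\sum_{x\in V}w(x)\min_{y\in S}d(x,y)$ and $\mathrm{OPT}_k(V)=\min_{T\subseteq V,\ |T|=k}\mathrm{cost}(T)$, and it runs in time $\tilde O(nk)$, that is, in time at most $C\,nk\,(1+\log n+\log\Delta)^{c}$ for absolute constants $C,c$. Here $\Delta$ is the aspect ratio of the space, the ratio of the maximum distance to the minimum nonzero distance ($\log\Delta:=0$ if $n=1$). The algorithm is a single finite program for a random access machine which is given $n$ and $k$, has words of $O(\log n)$ bits with wrap-around arithmetic, and has registers for real numbers; it reads a weight or queries a distance in unit time, and it performs each word operation, each exact arithmetic operation on real numbers and each comparison in unit time, with no rounding of reals to integers. -/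

import Mathlib

open scoped NNReal

namespace KMedian

/-! ### The metric `k`-median problem -/

section Problem

variable {V : Type*} [Fintype V] [MetricSpace V]

/-- The cost of a (nonempty) set `S` of centers: the sum of `w x * d (x, S)` over all points `x`,
where `d (x, S)` is the distance of `x` to a nearest center. -/
noncomputable def cost (w : V → ℝ≥0) (S : Finset V) : ℝ :=
  ∑ x : V, (w x : ℝ) * Metric.infDist x (S : Set V)

/-- The optimum: the least cost of a set of exactly `k` centers (for `1 ≤ k ≤ |V|` the
infimum is over a nonempty finite family). -/
noncomputable def opt (w : V → ℝ≥0) (k : ℕ) : ℝ :=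
  ⨅ T : {T : Finset V // T.card = k}, cost w T.1

/-- The aspect ratio: the maximum distance divided by the minimum nonzero distance.
(A one-point space has no nonzero distance; the value is then `0 / 0 = 0`, with logarithm `0`.) -/
noncomputable def aspectRatio (V : Type*) [MetricSpace V] : ℝ :=
  Metric.diam (Set.univ : Set V) / Set.infsep (Set.univ : Set V)

end Problem

/-! ### The machine model

A random access machine with two kinds of storage: words, which are natural numbers of
`O(log n)` bits and can be used as addresses, and real numbers.  Each kind of storage consists
of variables and of arrays, all of them named by numerals that are fixed in the (finite) program
text.  Words have wrap-around arithmetic; real numbers have exact field arithmetic and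
comparisons, but there is no rounding or any other way of turning a real number into a word,
and the only literals are natural numbers.  The input weights and distances are read by random
access.  Every operation, read, query, test and assignment costs one unit of time. -/

/-- Expressions with values in words. -/
inductive WExp where
  | lit (c : ℕ)
  | var (x : ℕ)
  | get (a : ℕ) (i : WExp)
  | add (e f : WExp)
  | sub (e f : WExp)
  | mul (e f : WExp)
  | div (e f : WExp)

/-- Expressions with values in real numbers. `weight i` reads the weight of point `i`,
`dist i j` queries the distance between the points `i` and `j`. -/
inductive RExp where
  | lit (c : ℕ)
  | var (x : ℕ)
  | get (a : ℕ) (i : WExp)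
  | ofWord (e : WExp)
  | weight (i : WExp)
  | dist (i j : WExp)
  | add (e f : RExp)
  | sub (e f : RExp)
  | mul (e f : RExp)
  | div (e f : RExp)

/-- Tests. -/
inductive Test where
  | wordLe (e f : WExp)
  | realLe (e f : RExp)
  | not (b : Test)
  | and (b c : Test)

/-- Programs. `setW x e` and `setR x e` assign to a variable, `putW a i e` and `putR a i e`
assign to the cell `i` of the array `a`. -/
inductive Prog where
  | skip
  | setW (x : ℕ) (e : WExp)
  | setR (x : ℕ) (e : RExp)
  | putW (a : ℕ) (i e : WExp)
  | putR (a : ℕ) (i : WExp) (e : RExp)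
  | seq (p q : Prog)
  | ite (b : Test) (p q : Prog)
  | while (b : Test) (p : Prog)

/-- The contents of the storage: word variables and arrays, real variables and arrays. -/
structure State where
  wvar : ℕ → ℕ
  warr : ℕ → ℕ → ℕ
  rvar : ℕ → ℝ
  rarr : ℕ → ℕ → ℝ

/-- What a program has access to besides its storage: the number `modulus` of different words
of the machine, and the read-only input weights and distances. -/
structure Env where
  modulus : ℕ
  weight : ℕ → ℝ
  dist : ℕ → ℕ → ℝ

/-- The number of operations in an expression. -/
def WExp.time : WExp → ℕ
  | lit _ => 1
  | var _ => 1
  | get _ i => i.time + 1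
  | add e f => e.time + f.time + 1
  | sub e f => e.time + f.time + 1
  | mul e f => e.time + f.time + 1
  | div e f => e.time + f.time + 1

/-- The number of operations in an expression. -/
def RExp.time : RExp → ℕ
  | lit _ => 1
  | var _ => 1
  | get _ i => i.time + 1
  | ofWord e => e.time + 1
  | weight i => i.time + 1
  | dist i j => i.time + j.time + 1
  | add e f => e.time + f.time + 1
  | sub e f => e.time + f.time + 1
  | mul e f => e.time + f.time + 1
  | div e f => e.time + f.time + 1

/-- The number of operations in a test. -/
def Test.time : Test → ℕ
  | wordLe e f => e.time + f.time + 1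
  | realLe e f => e.time + f.time + 1
  | not b => b.time + 1
  | and b c => b.time + c.time + 1

/-- The value of a word expression. Results wrap around at the modulus; subtraction stops at `0`,
and division is integer division (with value `0` when dividing by `0`). -/
def WExp.eval (E : Env) (s : State) : WExp → ℕ
  | lit c => c % E.modulus
  | var x => s.wvar x
  | get a i => s.warr a (i.eval E s)
  | add e f => (e.eval E s + f.eval E s) % E.modulus
  | sub e f => e.eval E s - f.eval E s
  | mul e f => (e.eval E s * f.eval E s) % E.modulus
  | div e f => e.eval E s / f.eval E s

/-- The value of a real expression (with value `0` when dividing by `0`). -/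
noncomputable def RExp.eval (E : Env) (s : State) : RExp → ℝ
  | lit c => c
  | var x => s.rvar x
  | get a i => s.rarr a (i.eval E s)
  | ofWord e => (e.eval E s : ℝ)
  | weight i => E.weight (i.eval E s)
  | dist i j => E.dist (i.eval E s) (j.eval E s)
  | add e f => e.eval E s + f.eval E s
  | sub e f => e.eval E s - f.eval E s
  | mul e f => e.eval E s * f.eval E s
  | div e f => e.eval E s / f.eval E s

/-- The outcome of a test. -/
def Test.eval (E : Env) (s : State) : Test → Prop
  | wordLe e f => e.eval E s ≤ f.eval E s
  | realLe e f => e.eval E s ≤ f.eval E s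
  | not b => ¬ b.eval E s
  | and b c => b.eval E s ∧ c.eval E s

/-- `Exec E p s t s'`: started in the state `s`, the program `p` terminates after exactly `t` units
of time, in the state `s'`. -/
inductive Exec (E : Env) : Prog → State → ℕ → State → Prop
  | skip (s : State) : Exec E .skip s 1 s
  | setW (x : ℕ) (e : WExp) (s : State) :
      Exec E (.setW x e) s (e.time + 1)
        { s with wvar := Function.update s.wvar x (e.eval E s) }
  | setR (x : ℕ) (e : RExp) (s : State) :
      Exec E (.setR x e) s (e.time + 1)
        { s with rvar := Function.update s.rvar x (e.eval E s) }
  | putW (a : ℕ) (i e : WExp) (s : State) :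
      Exec E (.putW a i e) s (i.time + e.time + 1)
        { s with warr :=
            Function.update s.warr a (Function.update (s.warr a) (i.eval E s) (e.eval E s)) }
  | putR (a : ℕ) (i : WExp) (e : RExp) (s : State) :
      Exec E (.putR a i e) s (i.time + e.time + 1)
        { s with rarr :=
            Function.update s.rarr a (Function.update (s.rarr a) (i.eval E s) (e.eval E s)) }
  | seq {p q : Prog} {s s₁ s₂ : State} {t₁ t₂ : ℕ} (hp : Exec E p s t₁ s₁)
      (hq : Exec E q s₁ t₂ s₂) : Exec E (.seq p q) s (t₁ + t₂) s₂
  | iteTrue {b : Test} {p q : Prog} {s s₁ : State} {t : ℕ} (hb : b.eval E s)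
      (hp : Exec E p s t s₁) : Exec E (.ite b p q) s (b.time + t + 1) s₁
  | iteFalse {b : Test} {p q : Prog} {s s₁ : State} {t : ℕ} (hb : ¬ b.eval E s)
      (hq : Exec E q s t s₁) : Exec E (.ite b p q) s (b.time + t + 1) s₁
  | whileTrue {b : Test} {p : Prog} {s s₁ s₂ : State} {t₁ t₂ : ℕ} (hb : b.eval E s)
      (hp : Exec E p s t₁ s₁) (hw : Exec E (.while b p) s₁ t₂ s₂) :
      Exec E (.while b p) s (b.time + t₁ + t₂ + 1) s₂
  | whileFalse {b : Test} {p : Prog} {s : State} (hb : ¬ b.eval E s) :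
      Exec E (.while b p) s (b.time + 1) s

/-- The machine is deterministic: the running time and the final state of a program are determined
by the input and the initial state. -/
theorem Exec.deterministic {E : Env} {p : Prog} {s s₁ s₂ : State} {t₁ t₂ : ℕ}
    (h₁ : Exec E p s t₁ s₁) (h₂ : Exec E p s t₂ s₂) : t₁ = t₂ ∧ s₁ = s₂ := by
  induction h₁ generalizing t₂ s₂ with
  | skip | setW | setR | putW | putR => cases h₂; exact ⟨rfl, rfl⟩
  | seq _ _ ih ih' =>
    cases h₂ with
    | seq hp hq =>
      obtain ⟨rfl, rfl⟩ := ih hp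
      obtain ⟨rfl, rfl⟩ := ih' hq
      exact ⟨rfl, rfl⟩
  | iteTrue hb _ ih =>
    cases h₂ with
    | iteTrue _ hp => obtain ⟨rfl, rfl⟩ := ih hp; exact ⟨rfl, rfl⟩
    | iteFalse hb' _ => exact absurd hb hb'
  | iteFalse hb _ ih =>
    cases h₂ with
    | iteTrue hb' _ => exact absurd hb' hb
    | iteFalse _ hp => obtain ⟨rfl, rfl⟩ := ih hp; exact ⟨rfl, rfl⟩
  | whileTrue hb _ _ ih ih' =>
    cases h₂ with
    | whileTrue _ hp hw =>
      obtain ⟨rfl, rfl⟩ := ih hp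
      obtain ⟨rfl, rfl⟩ := ih' hw
      exact ⟨rfl, rfl⟩
    | whileFalse hb' => exact absurd hb hb'
  | whileFalse hb =>
    cases h₂ with
    | whileTrue hb' _ _ => exact absurd hb' hb
    | whileFalse _ => exact ⟨rfl, rfl⟩

/-! ### Algorithms for `k`-median -/

section Algorithm

variable {V : Type*} [MetricSpace V] {n : ℕ}

/-- The environment that presents to a program the weighted metric space `(V, w, d)`, whose points
are numbered `0, …, n - 1` by `e`. The words have `b` times as many bits as the binary
representation of `n`. (Reading a weight or a distance of a nonexistent point gives `0`.) -/
noncomputable def env (b : ℕ) (e : V ≃ Fin n) (w : V → ℝ≥0) : Env where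
  modulus := 2 ^ (b * Nat.size n)
  weight i := if hi : i < n then (w (e.symm ⟨i, hi⟩) : ℝ) else 0
  dist i j :=
    if h : i < n ∧ j < n then Dist.dist (e.symm ⟨i, h.1⟩) (e.symm ⟨j, h.2⟩) else 0

/-- The initial state: word variables `0` and `1` hold `n` and `k`, all the rest is zero. -/
def initial (n k : ℕ) : State where
  wvar x := if x = 0 then n else if x = 1 then k else 0
  warr _ _ := 0
  rvar _ := 0
  rarr _ _ := 0

/-- The state `s` presents the set `S` of points as output: word variable `0` holds `|S|`,
and the first `|S|` cells of word array `0` list the numbers of the points of `S`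
(hence without repetition). -/
def Outputs (e : V ≃ Fin n) (s : State) (S : Finset V) : Prop :=
  s.wvar 0 = S.card ∧
    (Finset.range S.card).image (s.warr 0) = S.image (fun x => (e x : ℕ))

/-- On the weighted metric space `(V, w, d)`, with points numbered by `e`, and the parameter `k`,
the program `P` (on a machine with word length `b` times the length of `n`) halts after exactly `t`
units of time with output `S`. -/
def Computes (P : Prog) (b : ℕ) (e : V ≃ Fin n) (w : V → ℝ≥0) (k t : ℕ) (S : Finset V) : Prop :=
  ∃ s : State, Exec (env b e w) P (initial n k) t s ∧ Outputs e s S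

end Algorithm

end KMedian

namespace KMedian

/-! The algorithm has two phases. The logarithm in the approximation factor comes entirely from the
first; the second is a constant-factor approximation on the few points that the first leaves over.

Phase one is reverse greedy. Begin with every point as a center and delete centers. If more than `2
k` centers `X` serve a set `P`, and `T` is any set of at most `k` points, then more than `k`
elements of `X` are not nearest in `X` to any point of `T`. Moving the clients of all of these to
their second nearest centers costs at most `2 cost(T)` in total (`sum_gain_le`). At most `k / 2`
centers are the nearest or second nearest center of more than `4 |P| / k` points, so by averaging
some deletion costs at most `4 cost(T) / k` and affects only `O(|P| / k)` clients
(`exists_cheap_removal`). Passing from at most `4 k` to at most `2 k` centers therefore costs at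
most `8 cost(T)` and takes time `O(k |P|)`. This is done in blocks of consecutive points whose
length doubles from `k` upwards; merging two blocks brings the number of centers to at most `4 k`
again. On one level the blocks partition the points and all are compared with the same `T`, so a
level adds `8 cost(T)` and takes time `O(n k)`. After about `log (n / k)` levels at most `2 k`
candidates `X` are left, of cost `O(log (n / k))` times the optimum (`run_reduceAll`). Projecting an
optimal solution to `X` loses only `2 cost(T) + cost(X)` (`exists_projection`).

Phase two is a greedy algorithm in the style of Mettu and Plaxton, with centers from `X` but cost
over all points. The value of the ball of radius `r` at `x` is `∑ w v * max (r - d x v) 0`. Each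
round takes the ball of greatest value among the current radii, passes repeatedly to the best child
of a quarter of the radius, opens the point at the end of this chain, and reduces all radii in
proportion to the distance to it. Disjoint balls that respect the distance to `T` have total value
at most `cost(T)` (`sum_ballValue_le`). One such ball is taken from each chain so that the values of
the current balls of `T` are charged to them (`IsGreedy.exists_balls`, `sum_le_sum_of_charging`).
Since a point of `X` is within 128 times its radius of an open center, the factor 257 results
(`IsGreedy.costOn_le`).

For the running time, the `O(log Δ)` relevant radii `rmax / 4 ^ l` at the candidates have their
values tabulated. If there are more than `n` such radii, their indices may not fit into a word, but
then computing a value afresh in time `O(n)` is affordable. -/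

/-- `d` is a pseudometric on the natural numbers. -/
structure IsDist (d : ℕ → ℕ → ℝ) : Prop where
  self (x : ℕ) : d x x = 0
  symm (x y : ℕ) : d x y = d y x
  tri (x y z : ℕ) : d x z ≤ d x y + d y z

theorem IsDist.nonneg {d : ℕ → ℕ → ℝ} (hd : IsDist d) (x y : ℕ) : 0 ≤ d x y := by
  have h₁ := hd.tri x y x
  rw [hd.self, hd.symm y x] at h₁
  linarith

/-! ### Distances to sets and costs, for numbered points -/

/-- The distance of the point `v` to the finite set `S`. -/
noncomputable def minDist (d : ℕ → ℕ → ℝ) (v : ℕ) (S : Finset ℕ) : ℝ :=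
  if h : S.Nonempty then S.inf' h (d v) else 0

theorem minDist_le {d : ℕ → ℕ → ℝ} {v s : ℕ} {S : Finset ℕ} (hs : s ∈ S) :
    minDist d v S ≤ d v s := by
  rw [minDist, dif_pos ⟨s, hs⟩]
  exact Finset.inf'_le _ hs

theorem exists_minDist_eq {d : ℕ → ℕ → ℝ} {S : Finset ℕ} (hS : S.Nonempty) (v : ℕ) :
    ∃ s ∈ S, minDist d v S = d v s := by
  rw [minDist, dif_pos hS]
  exact Finset.exists_mem_eq_inf' hS _

theorem minDist_nonneg {d : ℕ → ℕ → ℝ} (hd : IsDist d) (v : ℕ) (S : Finset ℕ) :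
    0 ≤ minDist d v S := by
  rcases S.eq_empty_or_nonempty with rfl | hS
  · simp [minDist]
  · obtain ⟨s, -, hs⟩ := exists_minDist_eq (d := d) hS v
    rw [hs]
    exact hd.nonneg _ _

/-- Nonemptiness of the smaller set is essential, because the empty set has distance 0 by default.
-/
theorem minDist_anti {d : ℕ → ℕ → ℝ} {v : ℕ} {S S' : Finset ℕ} (hS : S.Nonempty) (h : S ⊆ S') :
    minDist d v S' ≤ minDist d v S := by
  obtain ⟨s, hs, e⟩ := exists_minDist_eq (d := d) hS v
  rw [e]
  exact minDist_le (h hs)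

/-- The cost of serving the points of `P` from the set `S`. -/
noncomputable def costOn (d : ℕ → ℕ → ℝ) (w : ℕ → ℝ) (P S : Finset ℕ) : ℝ :=
  ∑ v ∈ P, w v * minDist d v S

theorem costOn_nonneg {d : ℕ → ℕ → ℝ} {w : ℕ → ℝ} (hd : IsDist d) (hw : ∀ v, 0 ≤ w v)
    (P S : Finset ℕ) : 0 ≤ costOn d w P S :=
  Finset.sum_nonneg fun v _ => mul_nonneg (hw v) (minDist_nonneg hd v S)

/-! ### Removing a center -/

/-- `a` is a nearest and `b` a second nearest element of `X` to `v`. -/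
def Nearest (d : ℕ → ℕ → ℝ) (X : Finset ℕ) (v a b : ℕ) : Prop :=
  (a ∈ X ∧ ∀ x ∈ X, d v a ≤ d v x) ∧ b ∈ X ∧ b ≠ a ∧ ∀ x ∈ X, x ≠ a → d v b ≤ d v x

/-- The increase of the cost when `y` is removed from the centers and its points move to their
second nearest centers. -/
noncomputable def gain (d : ℕ → ℕ → ℝ) (w : ℕ → ℝ) (P : Finset ℕ) (c₁ c₂ : ℕ → ℕ) (y : ℕ) : ℝ :=
  ∑ v ∈ P, if c₁ v = y then w v * (d v (c₂ v) - d v (c₁ v)) else 0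

/-- The number of points (with multiplicity) with nearest or second nearest center `y`. -/
def load (P : Finset ℕ) (c₁ c₂ : ℕ → ℕ) (y : ℕ) : ℕ :=
  ∑ v ∈ P, ((if c₁ v = y then 1 else 0) + (if c₂ v = y then 1 else 0))

/-- After the removal, a point may still use `c₁` if this was not the removed center, and `c₂`
otherwise. The gain is the sum of the resulting increases. -/
theorem costOn_erase_le {d : ℕ → ℕ → ℝ} {w : ℕ → ℝ} (hw : ∀ v, 0 ≤ w v) {P X : Finset ℕ}
    {c₁ c₂ : ℕ → ℕ} (hc : ∀ v ∈ P, Nearest d X v (c₁ v) (c₂ v)) (y : ℕ) :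
    costOn d w P (X.erase y) ≤ costOn d w P X + gain d w P c₁ c₂ y := by
  rw [costOn, costOn, gain, ← Finset.sum_add_distrib]
  refine Finset.sum_le_sum fun v hv => ?_
  obtain ⟨⟨h₁, h₂⟩, h₃, h₄, h₅⟩ := hc v hv
  have hX : d v (c₁ v) ≤ minDist d v X := by
    obtain ⟨s, hs, e⟩ := exists_minDist_eq (d := d) ⟨_, h₁⟩ v
    rw [e]
    exact h₂ s hs
  split_ifs with h
  · have h₆ : minDist d v (X.erase y) ≤ d v (c₂ v) :=
      minDist_le (Finset.mem_erase.2 ⟨h ▸ h₄, h₃⟩)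
    rw [← mul_add]
    exact mul_le_mul_of_nonneg_left (by linarith) (hw v)
  · have h₆ : minDist d v (X.erase y) ≤ d v (c₁ v) :=
      minDist_le (Finset.mem_erase.2 ⟨h, h₁⟩)
    rw [add_zero]
    exact mul_le_mul_of_nonneg_left (by linarith) (hw v)

/-- Let `c₁ v` lie outside the image of `π`, and let `o` be the point of `T` nearest to `v`. Then `π
o` competes for being the second nearest center, so `d v (c₂ v) ≤ d v o + d o (π o) ≤ d v o + d o
(c₁ v) ≤ 2 * d v o + d v (c₁ v)`. Each `v` is counted for only one `y`. -/
theorem sum_gain_le {d : ℕ → ℕ → ℝ} {w : ℕ → ℝ} (hd : IsDist d) (hw : ∀ v, 0 ≤ w v)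
    {P X T : Finset ℕ} {c₁ c₂ : ℕ → ℕ} (hc : ∀ v ∈ P, Nearest d X v (c₁ v) (c₂ v))
    (hT : T.Nonempty) {π : ℕ → ℕ} (hπ : ∀ o, π o ∈ X ∧ ∀ x ∈ X, d o (π o) ≤ d o x) :
    ∑ y ∈ X \ T.image π, gain d w P c₁ c₂ y ≤ 2 * costOn d w P T := by
  unfold gain
  rw [Finset.sum_comm, costOn, Finset.mul_sum]
  refine Finset.sum_le_sum fun v hv => ?_
  rw [Finset.sum_ite_eq]
  have h0 := mul_nonneg (hw v) (minDist_nonneg hd v T)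
  split_ifs with h
  · obtain ⟨o, ho, e⟩ := exists_minDist_eq (d := d) hT v
    have hne : π o ≠ c₁ v := by
      rintro h'
      exact (Finset.mem_sdiff.1 h).2 (Finset.mem_image.2 ⟨o, ho, h'⟩)
    obtain ⟨⟨h₁, h₂⟩, h₃, h₄, h₅⟩ := hc v hv
    have h₆ := h₅ _ (hπ o).1 hne
    have h₇ := hd.tri v o (π o)
    have h₈ := (hπ o).2 _ h₁
    have h₉ := hd.tri o v (c₁ v)
    rw [hd.symm o v] at h₉
    rw [e, mul_left_comm]
    exact mul_le_mul_of_nonneg_left (by linarith) (hw v)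
  · linarith

theorem sum_load_le (P X : Finset ℕ) (c₁ c₂ : ℕ → ℕ) :
    ∑ y ∈ X, load P c₁ c₂ y ≤ 2 * P.card := by
  unfold load
  rw [Finset.sum_comm, mul_comm, ← smul_eq_mul]
  refine Finset.sum_le_card_nsmul _ _ _ fun v _ => ?_
  rw [Finset.sum_add_distrib, Finset.sum_ite_eq, Finset.sum_ite_eq]
  split_ifs <;> omega

/-- Averaging over the centers that are neither nearest to a point of `T` nor heavily loaded. More
than `k / 2` of them exist, and their gains sum to at most `2 * costOn d w P T`. -/
theorem exists_cheap_removal {d : ℕ → ℕ → ℝ} {w : ℕ → ℝ} (hd : IsDist d) (hw : ∀ v, 0 ≤ w v)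
    {P X T : Finset ℕ} {c₁ c₂ : ℕ → ℕ} (hc : ∀ v ∈ P, Nearest d X v (c₁ v) (c₂ v))
    (hP : P.Nonempty) (hT : T.Nonempty) {k : ℕ} (hTk : T.card ≤ k) (hX : 2 * k < X.card) :
    ∃ y ∈ X, load P c₁ c₂ y * k ≤ 4 * P.card ∧
      gain d w P c₁ c₂ y * k ≤ 4 * costOn d w P T := by
  have hXne : X.Nonempty := Finset.card_pos.1 (by omega)
  have hk : 0 < k := lt_of_lt_of_le (Finset.card_pos.2 hT) hTk
  choose π hπX hπ using fun o => X.exists_min_image (d o) hXne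
  set G := X \ T.image π with hG
  have hGc : k < G.card := by
    have h₁ : _ ≤ G.card := Finset.le_card_sdiff (T.image π) X
    have h₂ : (T.image π).card ≤ T.card := Finset.card_image_le
    omega
  -- The heavily loaded centers. Loads sum to at most `2 |P|` and each of these exceeds `4 |P| / k`,
  -- so there are at most `k / 2`.
  set H := X.filter (fun y => ¬ load P c₁ c₂ y * k ≤ 4 * P.card) with hH
  have hHc : 2 * H.card ≤ k := by
    have h₁ : H.card • (4 * P.card) ≤ ∑ y ∈ H, load P c₁ c₂ y * k :=
      Finset.card_nsmul_le_sum _ _ _ fun y hy => by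
        have := (Finset.mem_filter.1 hy).2
        omega
    have h₂ : ∑ y ∈ H, load P c₁ c₂ y ≤ 2 * P.card := sum_load_le P H c₁ c₂
    rw [← Finset.sum_mul, smul_eq_mul] at h₁
    have h₃ := Finset.card_pos.2 hP
    have h₄ : (2 * P.card) * (2 * H.card) ≤ (2 * P.card) * k := by nlinarith
    exact Nat.le_of_mul_le_mul_left h₄ (by omega)
  have hGH : k < 2 * (G \ H).card := by
    have := Finset.le_card_sdiff H G
    omega
  have hgain : ∀ y, 0 ≤ gain d w P c₁ c₂ y := fun y => Finset.sum_nonneg fun v hv => by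
    obtain ⟨⟨h₁, h₂⟩, h₃, h₄, h₅⟩ := hc v hv
    split_ifs
    · exact mul_nonneg (hw v) (sub_nonneg.2 (h₂ _ h₃))
    · exact le_rfl
  have hsum : ∑ y ∈ G \ H, gain d w P c₁ c₂ y ≤ 2 * costOn d w P T :=
    (Finset.sum_le_sum_of_subset_of_nonneg Finset.sdiff_subset fun y _ _ => hgain y).trans
      (sum_gain_le hd hw hc hT fun o => ⟨hπX o, hπ o⟩)
  have hc0 := costOn_nonneg hd hw P T
  obtain ⟨y, hy, hle⟩ := Finset.exists_le_of_sum_le (s := G \ H)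
    (f := fun y => gain d w P c₁ c₂ y * k) (g := fun _ => 4 * costOn d w P T)
    (Finset.card_pos.1 (by omega)) (by
      rw [← Finset.sum_mul, Finset.sum_const, nsmul_eq_mul]
      have h₁ : (k : ℝ) ≤ 2 * ((G \ H).card : ℝ) := by exact_mod_cast hGH.le
      have h₂ : (0 : ℝ) ≤ k := Nat.cast_nonneg k
      nlinarith)
  obtain ⟨hyG, hyH⟩ := Finset.mem_sdiff.1 hy
  have hyX := (Finset.mem_sdiff.1 hyG).1
  refine ⟨y, hyX, ?_, hle⟩
  by_contra h
  exact hyH (Finset.mem_filter.2 ⟨hyX, h⟩)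

/-! ### The value of a ball -/

/-- The value of the ball of radius `r` around `x`. -/
noncomputable def ballValue (d : ℕ → ℕ → ℝ) (w : ℕ → ℝ) (P : Finset ℕ) (x : ℕ) (r : ℝ) : ℝ :=
  ∑ v ∈ P, w v * max (r - d x v) 0

theorem ballValue_nonneg {d : ℕ → ℕ → ℝ} {w : ℕ → ℝ} (hw : ∀ v, 0 ≤ w v) (P : Finset ℕ) (x : ℕ)
    (r : ℝ) : 0 ≤ ballValue d w P x r :=
  Finset.sum_nonneg fun v _ => mul_nonneg (hw v) (le_max_right _ _)

theorem ballValue_mono {d : ℕ → ℕ → ℝ} {w : ℕ → ℝ} (hw : ∀ v, 0 ≤ w v) (P : Finset ℕ) (x : ℕ)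
    {r r' : ℝ} (h : r ≤ r') : ballValue d w P x r ≤ ballValue d w P x r' :=
  Finset.sum_le_sum fun v _ => mul_le_mul_of_nonneg_left
    (max_le_max (by linarith) le_rfl) (hw v)

theorem ballValue_of_nonpos {d : ℕ → ℕ → ℝ} (hd : IsDist d) {w : ℕ → ℝ} (P : Finset ℕ) (x : ℕ)
    {r : ℝ} (h : r ≤ 0) : ballValue d w P x r = 0 :=
  Finset.sum_eq_zero fun v _ => by
    rw [max_eq_right (by linarith [hd.nonneg x v]), mul_zero]

/-- A point `v` in the ball `i` satisfies `r i - d (c i) v ≤ d (c i) x - d (c i) v ≤ d v x` for all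
`x ∈ T`, and by disjointness no other ball contributes at `v`. -/
theorem sum_ballValue_le {d : ℕ → ℕ → ℝ} {w : ℕ → ℝ} (hd : IsDist d) (hw : ∀ v, 0 ≤ w v)
    {P T I : Finset ℕ} (hT : T.Nonempty) {c : ℕ → ℕ} {r : ℕ → ℝ}
    (hcov : ∀ i ∈ I, ∀ x ∈ T, r i ≤ d (c i) x)
    (hdisj : ∀ i ∈ I, ∀ j ∈ I, i < j → ∀ v, d (c i) v < r i → d (c j) v < r j → False) :
    ∑ i ∈ I, ballValue d w P (c i) (r i) ≤ costOn d w P T := by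
  unfold ballValue costOn
  rw [Finset.sum_comm]
  refine Finset.sum_le_sum fun v _ => ?_
  rw [← Finset.mul_sum]
  refine mul_le_mul_of_nonneg_left ?_ (hw v)
  by_cases h : ∃ i ∈ I, d (c i) v < r i
  · obtain ⟨i, hi, hlt⟩ := h
    rw [Finset.sum_eq_single_of_mem i hi]
    · obtain ⟨x, hx, e⟩ := exists_minDist_eq (d := d) hT v
      rw [e, max_eq_left (by linarith)]
      linarith [hcov i hi x hx, hd.tri (c i) v x]
    · intro j hj hne
      refine max_eq_right (not_lt.1 fun hlt' => ?_)
      rcases lt_or_gt_of_ne hne with h' | h'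
      · exact hdisj j hj i hi h' v (by linarith) hlt
      · exact hdisj i hi j hj h' v hlt (by linarith)
  · push Not at h
    rw [Finset.sum_eq_zero fun i hi => max_eq_right (by linarith [h i hi])]
    exact minDist_nonneg hd v T

/-! ### Charging -/

/-- Indices of the second kind pay for distinct elements of `T`, because an element is not `near`
any index after the one it is charged to. As `T` is no larger than `I`, the remaining elements are
at most as many as the indices of the first kind, and each of those can pay for any element. -/
theorem sum_le_sum_of_charging {T I : Finset ℕ} (hTI : T.card ≤ I.card) {f g : ℕ → ℝ}
    (hf : ∀ x, 0 ≤ f x) (hg : ∀ i, 0 ≤ g i) {near : ℕ → ℕ → Prop}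
    (h : ∀ i ∈ I, (∀ x ∈ T, f x ≤ g i) ∨
      ∃ x ∈ T, f x ≤ g i ∧ near x i ∧ ∀ j ∈ I, i < j → ¬ near x j) :
    ∑ x ∈ T, f x ≤ ∑ i ∈ I, g i := by
  classical
  set U := I.filter (fun i => ∀ x ∈ T, f x ≤ g i) with hU
  have hS : ∀ i ∈ I \ U, ∃ x ∈ T, f x ≤ g i ∧ near x i ∧ ∀ j ∈ I, i < j → ¬ near x j := by
    intro i hi
    obtain ⟨hi, hiU⟩ := Finset.mem_sdiff.1 hi
    exact (h i hi).resolve_left fun h' => hiU (Finset.mem_filter.2 ⟨hi, h'⟩)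
  choose! q hqT hqle hqn hqinj using hS
  have hinj : Set.InjOn q (I \ U : Finset ℕ) := by
    intro i hi j hj e
    by_contra hne
    rcases lt_or_gt_of_ne hne with h' | h'
    · exact hqinj i hi j (Finset.mem_sdiff.1 hj).1 h' (e ▸ hqn j hj)
    · exact hqinj j hj i (Finset.mem_sdiff.1 hi).1 h' (e ▸ hqn i hi)
  set Q := (I \ U).image q with hQ
  have hQT : Q ⊆ T := Finset.image_subset_iff.2 hqT
  have hUI : U ⊆ I := Finset.filter_subset _ _
  have hcard : (T \ Q).card ≤ U.card := by
    have h₁ : Q.card = (I \ U).card := Finset.card_image_of_injOn hinj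
    rw [Finset.card_sdiff_of_subset hQT, h₁, Finset.card_sdiff_of_subset hUI]
    have := Finset.card_le_card hUI
    omega
  rw [← Finset.sum_sdiff hQT, ← Finset.sum_sdiff hUI, add_comm]
  refine add_le_add ?_ ?_
  · rw [hQ, Finset.sum_image hinj]
    exact Finset.sum_le_sum hqle
  · rcases (T \ Q).eq_empty_or_nonempty with he | hne
    · rw [he, Finset.sum_empty]
      exact Finset.sum_nonneg fun i _ => hg i
    · obtain ⟨x, hx, hmax⟩ := (T \ Q).exists_max_image f hne
      calc ∑ y ∈ T \ Q, f y ≤ (T \ Q).card • f x := Finset.sum_le_card_nsmul _ _ _ hmax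
        _ ≤ U.card • f x := nsmul_le_nsmul_left (hf x) hcard
        _ ≤ ∑ i ∈ U, g i := Finset.card_nsmul_le_sum _ _ _ fun i hi =>
            (Finset.mem_filter.1 hi).2 x (Finset.mem_sdiff.1 hx).1

/-! ### Chains of balls -/

/-- A sequence of balls `(c j, r / 4 ^ j)` for `j ≤ J`, where each ball is a best child
of the previous one and the last one contains no other point of `X`. -/
structure IsChain (d : ℕ → ℕ → ℝ) (w : ℕ → ℝ) (P X : Finset ℕ) (c : ℕ → ℕ) (r : ℝ) (J : ℕ) :
    Prop where
  pos : 0 < r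
  mem : ∀ j ≤ J, c j ∈ X
  near : ∀ j < J, d (c j) (c (j + 1)) ≤ 3 * (r / 4 ^ j)
  best : ∀ j < J, ∀ y ∈ X, d (c j) y ≤ 3 * (r / 4 ^ j) →
    ballValue d w P y (r / 4 ^ (j + 1)) ≤ ballValue d w P (c (j + 1)) (r / 4 ^ (j + 1))
  last : ∀ y ∈ X, d (c J) y ≤ 3 * (r / 4 ^ J) → y = c J

/-- Each step is at most `3 ρ = 4 ρ - 4 (ρ / 4)`, where `ρ` is the radius before the step, so the
bounds telescope. -/
theorem IsChain.dist_le {d : ℕ → ℕ → ℝ} {w : ℕ → ℝ} (hd : IsDist d) {P X : Finset ℕ} {c : ℕ → ℕ}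
    {r : ℝ} {J : ℕ} (h : IsChain d w P X c r J) {i j : ℕ} (hij : i ≤ j) (hj : j ≤ J) :
    d (c i) (c j) ≤ 4 * (r / 4 ^ i) - 4 * (r / 4 ^ j) := by
  induction j, hij using Nat.le_induction with
  | base => rw [hd.self]; linarith
  | succ j hij ih =>
    have h₁ := ih (by omega)
    have h₂ := h.near j (by omega)
    have h₃ := hd.tri (c i) (c j) (c (j + 1))
    have h₄ : r / 4 ^ (j + 1) = r / 4 ^ j / 4 := by rw [pow_succ, div_div]
    rw [h₄]
    linarith

/-- Centers `z 0, …, z (m - 1)` have been chosen as the ends of chains of balls; `rad x` is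
the current radius of the point `x`, which is less than its distance to these centers by
a constant factor. -/
def IsGreedy (d : ℕ → ℕ → ℝ) (w : ℕ → ℝ) (P X : Finset ℕ) (z : ℕ → ℕ) (rad : ℕ → ℝ) (m : ℕ) :
    Prop :=
  ∀ i < m, (∀ x ∈ X, 32 * rad x ≤ d x (z i)) ∧
    ∃ (c : ℕ → ℕ) (r : ℝ) (J : ℕ), IsChain d w P X c r J ∧ z i = c J ∧
      (∀ x ∈ X, ballValue d w P x (rad x) ≤ ballValue d w P (c 0) r) ∧
      ∀ i' < i, 32 * r ≤ d (c 0) (z i')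

/-- Selects from chain `i` the ball used to pay for `T`: the first one that neither has a point of
`T` within its radius nor is about to swallow a later head of much smaller radius. Its predecessor
fails this condition, and the reason for the failure names a ball whose value the selected one
dominates, by the choice of the best child. -/
theorem IsGreedy.exists_balls {d : ℕ → ℕ → ℝ} {w : ℕ → ℝ} (hd : IsDist d) (hw : ∀ v, 0 ≤ w v)
    {P X T : Finset ℕ} {z : ℕ → ℕ} {rad : ℕ → ℝ} {m : ℕ} {c : ℕ → ℕ → ℕ} {r : ℕ → ℝ} {J : ℕ → ℕ}
    (hTX : T ⊆ X) (hz : ∀ i < m, ∀ x ∈ X, 32 * rad x ≤ d x (z i))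
    (hc : ∀ i < m, IsChain d w P X (c i) (r i) (J i)) (hzc : ∀ i < m, z i = c i (J i))
    (hval : ∀ i < m, ∀ x ∈ X, ballValue d w P x (rad x) ≤ ballValue d w P (c i 0) (r i))
    (hsep : ∀ i < m, ∀ i' < i, 32 * r i ≤ d (c i 0) (z i')) {i : ℕ} (hi : i < m) :
    ∃ j ≤ J i, ∃ ρ : ℝ, (∀ x ∈ T, ρ ≤ d (c i j) x) ∧ ρ ≤ r i / 4 ^ j ∧
      (∀ i' < m, i < i' → ∀ v, d (c i j) v < ρ → d (c i' 0) v < 4 * r i' → False) ∧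
      ((∀ x ∈ T, ballValue d w P x (rad x) ≤ ballValue d w P (c i j) ρ) ∨
        ∃ x ∈ T, ballValue d w P x (rad x) ≤ ballValue d w P (c i j) ρ ∧
          d x (c i 0) ≤ 4 * r i ∧ ∀ i' < m, i < i' → ¬ d x (c i' 0) ≤ 4 * r i') := by
  classical
  have hC := hc i hi
  have hrj : ∀ j, 0 < r i / 4 ^ j := fun j => div_pos hC.pos (by positivity)
  have hsucc : ∀ j, r i / 4 ^ (j + 1) = r i / 4 ^ j / 4 := fun j => by rw [pow_succ, div_div]
  -- If the center itself is in `T`, the ball of radius 0 suffices: `z i` is at distance 0 from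
  -- itself, so its current radius is at most 0 and nothing has to be paid.
  by_cases hT : z i ∈ T
  · refine ⟨J i, le_rfl, 0, fun x _ => hd.nonneg _ _, (hrj _).le,
      fun i' _ _ v hv _ => absurd hv (not_lt.2 (hd.nonneg _ _)), Or.inr ⟨z i, hT, ?_, ?_, ?_⟩⟩
    · rw [ballValue_of_nonpos hd]
      · exact ballValue_nonneg hw _ _ _
      · have := hz i hi (z i) (hTX hT)
        rw [hd.self] at this
        linarith
    · have h₁ := hC.dist_le hd (Nat.zero_le (J i)) le_rfl
      rw [hd.symm, hzc i hi]
      have := hrj (J i)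
      simp only [pow_zero, div_one] at h₁
      linarith
    · intro i' hi' hlt h
      have h₁ := hsep i' hi' i hlt
      rw [hd.symm] at h₁
      linarith [(hc i' hi').pos]
  set bad : ℕ → Prop := fun j => (∃ x ∈ T, d (c i j) x ≤ r i / 4 ^ j) ∨
    ∃ i' < m, i < i' ∧ d (c i j) (c i' 0) ≤ 3 * (r i / 4 ^ j) ∧ r i' ≤ r i / 4 ^ j / 4 with hbad
  -- The last ball has no other point of `X` within three times its radius, and later heads are
  -- separated from `z i` by a positive distance.
  have hend : ¬ bad (J i) := by
    rintro (⟨x, hx, h⟩ | ⟨i', hi', hlt, h, -⟩)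
    · have := hC.last x (hTX hx) (by linarith [hrj (J i)])
      exact hT (by rw [hzc i hi, ← this]; exact hx)
    · have := hC.last _ ((hc i' hi').mem 0 (Nat.zero_le _)) h
      have h₁ := hsep i' hi' i hlt
      rw [this, hzc i hi, hd.self] at h₁
      linarith [(hc i' hi').pos]
  have hex : ∃ j, ¬ bad j := ⟨_, hend⟩
  obtain ⟨j, hj, hmin⟩ : ∃ j, ¬ bad j ∧ ∀ j' < j, bad j' :=
    ⟨Nat.find hex, Nat.find_spec hex, fun j' h => not_not.1 (Nat.find_min hex h)⟩
  have hjJ : j ≤ J i := by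
    by_contra h
    exact hend (hmin _ (by omega))
  simp only [hbad, not_or, not_exists, not_and, not_le] at hj
  refine ⟨j, hjJ, r i / 4 ^ j, fun x hx => (hj.1 x hx).le, le_rfl, ?_, ?_⟩
  · intro i' hi' hlt v h₁ h₂
    have h₃ := hsep i' hi' i hlt
    have h₄ := hC.dist_le hd hjJ le_rfl
    rw [← hzc i hi] at h₄
    have h₅ := hd.tri (c i j) v (c i' 0)
    rw [hd.symm v] at h₅
    have h₆ := hd.tri (c i' 0) (c i j) (z i)
    rw [hd.symm (c i' 0) (c i j)] at h₆
    have h₇ := hrj (J i)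
    have h₈ := hrj j
    have h₉ := (hc i' hi').pos
    -- Write `ρ` for the radius of the selected ball. Separation gives `32 r' ≤ 5 ρ + 4 r'`, hence
    -- `r' ≤ 5 ρ / 28 < ρ / 4`, and the head is within `ρ + 4 r' ≤ 3 ρ`. So the ball would have been
    -- bad.
    have := hj.2 i' hi' hlt (by linarith)
    linarith
  · rcases Nat.eq_zero_or_pos j with rfl | hpos
    · left
      intro x hx
      simpa using hval i hi x (hTX hx)
    obtain ⟨p, rfl⟩ : ∃ p, j = p + 1 := ⟨j - 1, by omega⟩
    have hp := hmin p (by omega)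
    -- If the predecessor is bad because of a later head, that head was a possible child, so its
    -- ball is dominated by the selected one. The later head in turn dominates every current ball.
    by_cases hfar : ∃ i' < m, i < i' ∧ d (c i p) (c i' 0) ≤ 3 * (r i / 4 ^ p) ∧
        r i' ≤ r i / 4 ^ p / 4
    · left
      obtain ⟨i', hi', hlt, h₁, h₂⟩ := hfar
      intro x hx
      refine (hval i' hi' x (hTX hx)).trans ((ballValue_mono hw P (c i' 0) ?_).trans
        (hC.best p (by omega) _ ((hc i' hi').mem 0 (Nat.zero_le _)) h₁))
      rwa [hsucc]
    · right
      obtain ⟨x, hx, hxp⟩ := hp.resolve_right hfar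
      simp only [not_exists, not_and, not_le] at hfar
      have h₄ := hC.dist_le hd (show p ≤ J i by omega) le_rfl
      rw [← hzc i hi] at h₄
      have h₅ := hrj (J i)
      have h₆ := hrj p
      have h₇ := hd.tri x (c i p) (z i)
      rw [hd.symm x (c i p)] at h₇
      refine ⟨x, hx, ?_, ?_, ?_⟩
      · refine (ballValue_mono hw P x ?_).trans (hC.best p (by omega) x (hTX hx) (by linarith))
        rw [hsucc]
        -- The distance from `x` to `z i` is at most five times the radius of the predecessor, and
        -- `5 / 32 ≤ 1 / 4`.
        linarith [hz i hi x (hTX hx)]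
      · have h₈ := hC.dist_le hd (Nat.zero_le p) (by omega)
        have h₉ := hd.tri (c i 0) (c i p) x
        rw [hd.symm]
        simp only [pow_zero, div_one] at h₈
        linarith
      · intro i' hi' hlt h
        have h₁ := hsep i' hi' i hlt
        have h₂ := hd.tri (c i' 0) x (z i)
        rw [hd.symm (c i' 0) x] at h₂
        have h₃ := hd.tri (c i p) x (c i' 0)
        -- As for disjointness: being near `x` would make the later radius at most `5 / 28` of that
        -- of the predecessor and put the head within three times it, the case already excluded.
        have := hfar i' hi' hlt (by linarith)
        linarith

/-- Charging bounds the left side by the values of the selected balls, and disjointness bounds these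
by the cost. For disjointness, every ball of a chain with head radius `r` lies within distance `4 r`
of its head. -/
theorem IsGreedy.sum_ballValue_le {d : ℕ → ℕ → ℝ} {w : ℕ → ℝ} (hd : IsDist d)
    (hw : ∀ v, 0 ≤ w v) {P X T : Finset ℕ} {z : ℕ → ℕ} {rad : ℕ → ℝ} {m : ℕ}
    (h : IsGreedy d w P X z rad m) (hTX : T ⊆ X) (hT : T.Nonempty) (hTm : T.card ≤ m) :
    ∑ x ∈ T, ballValue d w P x (rad x) ≤ costOn d w P T := by
  unfold IsGreedy at h
  choose! hz c r J hc hzc hval hsep using h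
  have hb := fun i (hi : i < m) => IsGreedy.exists_balls hd hw hTX hz hc hzc hval hsep hi
  choose! j hjJ ρ hcov hρ hdisj hch using hb
  refine (sum_le_sum_of_charging (I := Finset.range m) (by simpa using hTm)
    (f := fun x => ballValue d w P x (rad x))
    (g := fun i => ballValue d w P (c i (j i)) (ρ i)) (near := fun x i => d x (c i 0) ≤ 4 * r i)
    (fun x => ballValue_nonneg hw _ _ _) (fun i => ballValue_nonneg hw _ _ _) ?_).trans
    (KMedian.sum_ballValue_le hd hw hT (c := fun i => c i (j i)) ?_ ?_)
  · intro i hi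
    simpa using hch i (Finset.mem_range.1 hi)
  · intro i hi
    exact hcov i (Finset.mem_range.1 hi)
  · intro i hi i' hi' hlt v h₁ h₂
    simp only [Finset.mem_range] at hi hi'
    refine hdisj i hi i' hi' hlt v h₁ ?_
    have h₃ := (hc i' hi').dist_le hd (Nat.zero_le (j i')) (hjJ i' hi')
    have h₄ := hρ i' hi'
    have h₅ := hd.tri (c i' 0) (c i' (j i')) v
    have h₆ : 0 < r i' / 4 ^ (j i') := div_pos (hc i' hi').pos (by positivity)
    simp only [pow_zero, div_one] at h₃
    linarith

/-- Let `x ∈ T` be nearest to `v`, at distance `δ`. Some center is within `δ + 128 * rad x ≤ 129 δ +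
128 * max (rad x - δ) 0` of `v`. Summed over `v`, the last term is bounded by ball values, which
gives `129 + 128 = 257`. -/
theorem IsGreedy.costOn_le {d : ℕ → ℕ → ℝ} {w : ℕ → ℝ} (hd : IsDist d)
    (hw : ∀ v, 0 ≤ w v) {P X T : Finset ℕ} {z : ℕ → ℕ} {rad : ℕ → ℝ} {m : ℕ}
    (h : IsGreedy d w P X z rad m) (hTX : T ⊆ X) (hT : T.Nonempty) (hTm : T.card ≤ m)
    (hrad : ∀ x ∈ X, ∃ i < m, d x (z i) ≤ 128 * rad x) :
    costOn d w P ((Finset.range m).image z) ≤ 257 * costOn d w P T := by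
  have h₁ := h.sum_ballValue_le hd hw hTX hT hTm
  suffices costOn d w P ((Finset.range m).image z) ≤
      129 * costOn d w P T + 128 * ∑ x ∈ T, ballValue d w P x (rad x) by linarith
  unfold ballValue costOn
  rw [Finset.sum_comm, Finset.mul_sum, Finset.mul_sum, ← Finset.sum_add_distrib]
  refine Finset.sum_le_sum fun v _ => ?_
  rw [← Finset.mul_sum]
  obtain ⟨x, hx, e⟩ := exists_minDist_eq (d := d) hT v
  obtain ⟨i, hi, hle⟩ := hrad x (hTX hx)
  have h₂ : minDist d v ((Finset.range m).image z) ≤ d v (z i) :=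
    minDist_le (Finset.mem_image_of_mem _ (Finset.mem_range.2 hi))
  have h₃ := hd.tri v x (z i)
  have h₄ : max (rad x - d x v) 0 ≤ ∑ y ∈ T, max (rad y - d y v) 0 :=
    Finset.single_le_sum (f := fun y => max (rad y - d y v) 0)
      (fun y _ => le_max_right _ _) hx
  have h₅ := le_max_left (rad x - d x v) 0
  rw [hd.symm x v] at h₅ h₄
  have h₆ : minDist d v ((Finset.range m).image z) ≤
      129 * minDist d v T + 128 * ∑ y ∈ T, max (rad y - d y v) 0 := by
    rw [e]
    linarith
  have := mul_le_mul_of_nonneg_left h₆ (hw v)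
  linarith

/-- Replace each `o ∈ T` by its nearest candidate `π o`. If `x` is the candidate nearest to `v`,
then `d v (π o) ≤ d v o + d o x ≤ 2 * d v o + d v x`. -/
theorem exists_projection {d : ℕ → ℕ → ℝ} {w : ℕ → ℝ} (hd : IsDist d)
    (hw : ∀ v, 0 ≤ w v) {P X T : Finset ℕ} (hX : X.Nonempty) (hT : T.Nonempty) :
    ∃ T' ⊆ X, T'.Nonempty ∧ T'.card ≤ T.card ∧
      costOn d w P T' ≤ 2 * costOn d w P T + costOn d w P X := by
  choose π hπX hπ using fun o => X.exists_min_image (d o) hX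
  refine ⟨T.image π, Finset.image_subset_iff.2 fun o _ => hπX o, hT.image π,
    Finset.card_image_le, ?_⟩
  unfold costOn
  rw [Finset.mul_sum, ← Finset.sum_add_distrib]
  refine Finset.sum_le_sum fun v _ => ?_
  obtain ⟨o, ho, e⟩ := exists_minDist_eq (d := d) hT v
  obtain ⟨x, hx, e'⟩ := exists_minDist_eq (d := d) hX v
  have h₁ : minDist d v (T.image π) ≤ d v (π o) := minDist_le (Finset.mem_image_of_mem _ ho)
  have h₂ := hd.tri v o (π o)
  have h₃ := hπ o x hx
  have h₄ := hd.tri o v x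
  rw [hd.symm o v] at h₄
  have h₅ : minDist d v (T.image π) ≤ 2 * minDist d v T + minDist d v X := by
    rw [e, e']
    linarith
  have := mul_le_mul_of_nonneg_left h₅ (hw v)
  linarith

/-! ### Reasoning about programs -/

/-- Started in the state `s`, the program `p` terminates, and its running time and final state
satisfy `Q`. -/
def Run (E : Env) (p : Prog) (s : State) (Q : ℕ → State → Prop) : Prop :=
  ∃ t s', Exec E p s t s' ∧ Q t s'

section Rules

variable {E : Env} {s : State} {Q : ℕ → State → Prop}

theorem Run.mono {p : Prog} {Q' : ℕ → State → Prop} (h : Run E p s Q)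
    (hQ : ∀ t s', Q t s' → Q' t s') : Run E p s Q' :=
  let ⟨t, s', he, hq⟩ := h
  ⟨t, s', he, hQ t s' hq⟩

theorem run_skip : Run E .skip s Q ↔ Q 1 s :=
  ⟨fun ⟨_, _, he, hq⟩ => by cases he; exact hq, fun h => ⟨_, _, .skip s, h⟩⟩

theorem run_setW {x : ℕ} {e : WExp} : Run E (.setW x e) s Q ↔
    Q (e.time + 1) { s with wvar := Function.update s.wvar x (e.eval E s) } :=
  ⟨fun ⟨_, _, he, hq⟩ => by cases he; exact hq, fun h => ⟨_, _, .setW x e s, h⟩⟩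

theorem run_setR {x : ℕ} {e : RExp} : Run E (.setR x e) s Q ↔
    Q (e.time + 1) { s with rvar := Function.update s.rvar x (e.eval E s) } :=
  ⟨fun ⟨_, _, he, hq⟩ => by cases he; exact hq, fun h => ⟨_, _, .setR x e s, h⟩⟩

theorem run_putW {a : ℕ} {i e : WExp} : Run E (.putW a i e) s Q ↔
    Q (i.time + e.time + 1) { s with
      warr := Function.update s.warr a (Function.update (s.warr a) (i.eval E s) (e.eval E s)) } :=
  ⟨fun ⟨_, _, he, hq⟩ => by cases he; exact hq, fun h => ⟨_, _, .putW a i e s, h⟩⟩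

theorem run_putR {a : ℕ} {i : WExp} {e : RExp} : Run E (.putR a i e) s Q ↔
    Q (i.time + e.time + 1) { s with
      rarr := Function.update s.rarr a (Function.update (s.rarr a) (i.eval E s) (e.eval E s)) } :=
  ⟨fun ⟨_, _, he, hq⟩ => by cases he; exact hq, fun h => ⟨_, _, .putR a i e s, h⟩⟩

theorem run_seq {p q : Prog} : Run E (.seq p q) s Q ↔
    Run E p s fun t₁ s₁ => Run E q s₁ fun t₂ s₂ => Q (t₁ + t₂) s₂ :=
  ⟨fun ⟨_, _, he, hq⟩ => by cases he with | seq h₁ h₂ => exact ⟨_, _, h₁, _, _, h₂, hq⟩,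
    fun ⟨_, _, h₁, _, _, h₂, hq⟩ => ⟨_, _, .seq h₁ h₂, hq⟩⟩

theorem run_ite {b : Test} {p q : Prog} : Run E (.ite b p q) s Q ↔
    (b.eval E s → Run E p s fun t s' => Q (b.time + t + 1) s') ∧
    (¬ b.eval E s → Run E q s fun t s' => Q (b.time + t + 1) s') := by
  by_cases hb : b.eval E s
  · simp only [hb, true_imp_iff, not_true, false_imp_iff, and_true]
    exact ⟨fun ⟨_, _, he, hq⟩ => by
      cases he with
      | iteTrue _ h => exact ⟨_, _, h, hq⟩
      | iteFalse h => exact absurd hb h,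
      fun ⟨_, _, h, hq⟩ => ⟨_, _, .iteTrue hb h, hq⟩⟩
  · simp only [hb, not_false_iff, true_imp_iff, false_imp_iff, true_and]
    exact ⟨fun ⟨_, _, he, hq⟩ => by
      cases he with
      | iteTrue h => exact absurd h hb
      | iteFalse _ h => exact ⟨_, _, h, hq⟩,
      fun ⟨_, _, h, hq⟩ => ⟨_, _, .iteFalse hb h, hq⟩⟩

theorem Run.seq {p q : Prog} {Q₁ : ℕ → State → Prop} (h : Run E p s Q₁)
    (hq : ∀ t₁ s₁, Q₁ t₁ s₁ → Run E q s₁ fun t₂ s₂ => Q (t₁ + t₂) s₂) :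
    Run E (.seq p q) s Q :=
  run_seq.2 (h.mono hq)

/-- The invariant `I T s` includes a bound `T` on the remaining time. -/
theorem Run.while {b : Test} {p : Prog} {Q : State → Prop} (I : ℕ → State → Prop)
    (h : ∀ T s, I T s →
      (b.eval E s ∧ Run E p s fun t s' => ∃ T', I T' s' ∧ b.time + t + 1 + T' ≤ T) ∨
      (¬ b.eval E s ∧ b.time + 1 ≤ T ∧ Q s)) (T : ℕ) (s : State) (hs : I T s) :
    Run E (.while b p) s fun t s' => t ≤ T ∧ Q s' := by
  induction T using Nat.strong_induction_on generalizing s with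
  | _ T ih =>
    rcases h T s hs with ⟨hb, t, s', he, T', hI, hT⟩ | ⟨hb, hT, hq⟩
    · obtain ⟨t', s'', he', ht', hq⟩ := ih T' (by omega) s' hI
      exact ⟨_, _, .whileTrue hb he he', by omega, hq⟩
    · exact ⟨_, _, .whileFalse hb, hT, hq⟩

end Rules

/-! ### Storage that a program leaves unchanged -/

/-- The word variables that a program may change. -/
def Prog.wvars : Prog → List ℕ
  | setW x _ => [x]
  | seq p q => p.wvars ++ q.wvars
  | ite _ p q => p.wvars ++ q.wvars
  | .while _ p => p.wvars
  | _ => []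

/-- The real variables that a program may change. -/
def Prog.rvars : Prog → List ℕ
  | setR x _ => [x]
  | seq p q => p.rvars ++ q.rvars
  | ite _ p q => p.rvars ++ q.rvars
  | .while _ p => p.rvars
  | _ => []

/-- The word arrays that a program may change. -/
def Prog.warrs : Prog → List ℕ
  | putW a _ _ => [a]
  | seq p q => p.warrs ++ q.warrs
  | ite _ p q => p.warrs ++ q.warrs
  | .while _ p => p.warrs
  | _ => []

/-- The real arrays that a program may change. -/
def Prog.rarrs : Prog → List ℕ
  | putR a _ _ => [a]
  | seq p q => p.rarrs ++ q.rarrs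
  | ite _ p q => p.rarrs ++ q.rarrs
  | .while _ p => p.rarrs
  | _ => []

/-- The states `s` and `s'` differ at most in what `p` may change. -/
structure Frame (p : Prog) (s s' : State) : Prop where
  wvar (x : ℕ) (hx : x ∉ p.wvars) : s'.wvar x = s.wvar x
  rvar (x : ℕ) (hx : x ∉ p.rvars) : s'.rvar x = s.rvar x
  warr (a : ℕ) (ha : a ∉ p.warrs) : s'.warr a = s.warr a
  rarr (a : ℕ) (ha : a ∉ p.rarrs) : s'.rarr a = s.rarr a

/-- The lists of changeable variables and arrays are computed from the program text, so for concrete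
programs the side conditions of `Frame` are settled by `decide`. -/
theorem Exec.frame {E : Env} {p : Prog} {s s' : State} {t : ℕ} (h : Exec E p s t s') :
    Frame p s s' := by
  induction h with
  | skip => constructor <;> intros <;> rfl
  | setW | setR | putW | putR =>
    constructor <;> intro x hx <;>
      simp_all [Prog.wvars, Prog.rvars, Prog.warrs, Prog.rarrs, Function.update_of_ne]
  | seq _ _ h₁ h₂ =>
    constructor <;> intro x hx <;>
      simp only [Prog.wvars, Prog.rvars, Prog.warrs, Prog.rarrs, List.mem_append, not_or] at hx
    · rw [h₂.wvar x hx.2, h₁.wvar x hx.1]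
    · rw [h₂.rvar x hx.2, h₁.rvar x hx.1]
    · rw [h₂.warr x hx.2, h₁.warr x hx.1]
    · rw [h₂.rarr x hx.2, h₁.rarr x hx.1]
  | iteTrue _ _ h =>
    constructor <;> intro x hx <;>
      simp only [Prog.wvars, Prog.rvars, Prog.warrs, Prog.rarrs, List.mem_append, not_or] at hx
    · exact h.wvar x hx.1
    · exact h.rvar x hx.1
    · exact h.warr x hx.1
    · exact h.rarr x hx.1
  | iteFalse _ _ h =>
    constructor <;> intro x hx <;>
      simp only [Prog.wvars, Prog.rvars, Prog.warrs, Prog.rarrs, List.mem_append, not_or] at hx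
    · exact h.wvar x hx.2
    · exact h.rvar x hx.2
    · exact h.warr x hx.2
    · exact h.rarr x hx.2
  | whileTrue _ _ _ h₁ h₂ =>
    constructor <;> intro x hx
    · rw [h₂.wvar x hx, h₁.wvar x hx]
    · rw [h₂.rvar x hx, h₁.rvar x hx]
    · rw [h₂.warr x hx, h₁.warr x hx]
    · rw [h₂.rarr x hx, h₁.rarr x hx]
  | whileFalse => constructor <;> intros <;> rfl

theorem Run.frame {E : Env} {p : Prog} {s : State} {Q : ℕ → State → Prop} (h : Run E p s Q) :
    Run E p s fun t s' => Q t s' ∧ Frame p s s' :=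
  let ⟨t, s', he, hq⟩ := h
  ⟨t, s', he, hq, he.frame⟩

/-! ### Loops -/

/-- Strict comparison of words. -/
abbrev Test.wordLt (e f : WExp) : Test := .not (.wordLe f e)

/-- Strict comparison of real numbers. -/
abbrev Test.realLt (e f : RExp) : Test := .not (.realLe f e)

/-- Equality of words. -/
abbrev Test.wordEq (e f : WExp) : Test := .and (.wordLe e f) (.wordLe f e)

/-- A loop in which the word variable `x` is increased up to `hi`. -/
def forTo (x : ℕ) (hi : WExp) (p : Prog) : Prog :=
  .while (.wordLt (.var x) hi) (.seq p (.setW x (.add (.var x) (.lit 1))))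

/-- The bound `m < E.modulus` keeps the counter from wrapping. Test, increment and loop overhead add
`hi.time + 8` per round, and the final failing test takes `hi.time + 4`. The cost `c i` may depend
on the round, so that expensive rounds can be charged individually. -/
theorem run_forTo {E : Env} {x : ℕ} {hi : WExp} {p : Prog} {m : ℕ} (hm : m < E.modulus)
    (I : ℕ → State → Prop) (c : ℕ → ℕ) (hhi : ∀ i ≤ m, ∀ s, I i s → hi.eval E s = m)
    (hp : ∀ i < m, ∀ s, s.wvar x = i → I i s → Run E p s fun t s' => t ≤ c i ∧ s'.wvar x = i ∧
      I (i + 1) { s' with wvar := Function.update s'.wvar x (i + 1) })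
    {i₀ : ℕ} (hi₀ : i₀ ≤ m) {s : State} (hs : s.wvar x = i₀) (hI : I i₀ s) :
    Run E (forTo x hi p) s fun t s' =>
      t ≤ ∑ i ∈ Finset.Ico i₀ m, (c i + (hi.time + 8)) + hi.time + 4 ∧ s'.wvar x = m ∧ I m s' := by
  refine Run.while (fun T s => ∃ i ≤ m, s.wvar x = i ∧ I i s ∧
    T = ∑ i ∈ Finset.Ico i m, (c i + (hi.time + 8)) + hi.time + 4) ?_ _ s
    ⟨i₀, hi₀, hs, hI, rfl⟩
  rintro T s ⟨i, him, hx, hI, rfl⟩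
  have hev := hhi i him s hI
  rcases him.lt_or_eq with hlt | rfl
  · left
    refine ⟨by simp [Test.eval, WExp.eval, hev, hx, hlt], run_seq.2 ((hp i hlt s hx hI).mono ?_)⟩
    rintro t s' ⟨ht, hx', hI'⟩
    refine run_setW.2 ⟨_, ⟨i + 1, hlt, ?_, ?_, rfl⟩, ?_⟩
    · simp [WExp.eval, hx', Nat.mod_eq_of_lt (show 1 < E.modulus by omega),
        Nat.mod_eq_of_lt (show i + 1 < E.modulus by omega)]
    · simpa [WExp.eval, hx', Nat.mod_eq_of_lt (show 1 < E.modulus by omega),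
        Nat.mod_eq_of_lt (show i + 1 < E.modulus by omega)] using hI'
    · rw [Finset.sum_eq_sum_Ico_succ_bot hlt]
      simp only [Test.time, WExp.time]
      omega
  · right
    refine ⟨by simp [Test.eval, WExp.eval, hev, hx], ?_, hx, hI⟩
    simp only [Test.time, WExp.time]
    omega

theorem run_forTo_const {E : Env} {x : ℕ} {hi : WExp} {p : Prog} {m : ℕ} (hm : m < E.modulus)
    (I : ℕ → State → Prop) (c : ℕ) (hhi : ∀ i ≤ m, ∀ s, I i s → hi.eval E s = m)
    (hp : ∀ i < m, ∀ s, s.wvar x = i → I i s → Run E p s fun t s' => t ≤ c ∧ s'.wvar x = i ∧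
      I (i + 1) { s' with wvar := Function.update s'.wvar x (i + 1) })
    {i₀ : ℕ} (hi₀ : i₀ ≤ m) {s : State} (hs : s.wvar x = i₀) (hI : I i₀ s) :
    Run E (forTo x hi p) s fun t s' =>
      t ≤ (m - i₀) * (c + (hi.time + 8)) + hi.time + 4 ∧ s'.wvar x = m ∧ I m s' := by
  refine (run_forTo hm I (fun _ => c) hhi hp hi₀ hs hI).mono ?_
  rintro t s' ⟨ht, h⟩
  refine ⟨?_, h⟩
  simpa using ht

/-! ### Minimum over a range -/

/-- The states `s` and `s'` differ at most in scratch variables. -/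
structure Same (s s' : State) : Prop where
  wvar (x : ℕ) (hx : x ∉ [20, 21, 22, 23]) : s'.wvar x = s.wvar x
  rvar (x : ℕ) (hx : x ∉ [10, 11, 12]) : s'.rvar x = s.rvar x
  warr : s'.warr = s.warr
  rarr : s'.rarr = s.rarr

theorem Same.refl (s : State) : Same s s := ⟨fun _ _ => rfl, fun _ _ => rfl, rfl, rfl⟩

theorem Same.trans {s s' s'' : State} (h : Same s s') (h' : Same s' s'') : Same s s'' :=
  ⟨fun x hx => (h'.wvar x hx).trans (h.wvar x hx), fun x hx => (h'.rvar x hx).trans (h.rvar x hx),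
    h'.warr.trans h.warr, h'.rarr.trans h.rarr⟩

theorem Same.setWvar {s s' : State} (h : Same s s') {x : ℕ} (hx : x ∈ [20, 21, 22, 23]) (v : ℕ) :
    Same s { s' with wvar := Function.update s'.wvar x v } :=
  ⟨fun y hy => by
    have : y ≠ x := by rintro rfl; exact hy hx
    simp only [Function.update_of_ne this, h.wvar y hy], h.rvar, h.warr, h.rarr⟩

theorem Same.setRvar {s s' : State} (h : Same s s') {x : ℕ} (hx : x ∈ [10, 11, 12]) (v : ℝ) :
    Same s { s' with rvar := Function.update s'.rvar x v } :=
  ⟨h.wvar, fun y hy => by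
    have : y ≠ x := by rintro rfl; exact hy hx
    simp only [Function.update_of_ne this, h.rvar y hy], h.warr, h.rarr⟩

/-- Find the `j < hi` that passes the test `b` and has the least value of `e`, which is evaluated
after running `p`. In these, `j` is word variable `20`; the result is put in word variable `21`. -/
def argmin (hi : WExp) (b : Test) (p : Prog) (e : RExp) : Prog :=
  .seq (.setW 22 (.lit 0)) (.seq (.setW 20 (.lit 0)) (forTo 20 hi
    (.ite b
      (.seq p (.ite (.not (.and (.wordLe (.lit 1) (.var 22)) (.realLe (.var 10) e)))
        (.seq (.setR 10 e) (.seq (.setW 21 (.var 20)) (.setW 22 (.lit 1)))) .skip))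
      .skip)))

/-- Word variable `22` is a flag for whether some index has passed the test, which replaces an
infinite initial value. If none passes, nothing is claimed about the result. -/
theorem run_argmin {E : Env} {hi : WExp} {b : Test} {p : Prog} {e : RExp} {s : State} {m c : ℕ}
    (hM : 1 < E.modulus) (hm : m < E.modulus) {B : ℕ → Prop} {F : ℕ → ℝ}
    (hhi : ∀ s', Same s s' → hi.eval E s' = m)
    (hb : ∀ j < m, ∀ s', Same s s' → s'.wvar 20 = j → (b.eval E s' ↔ B j))
    (hp : ∀ j < m, B j → ∀ s', Same s s' → s'.wvar 20 = j → Run E p s' fun t s'' => t ≤ c ∧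
      Same s' s'' ∧ s''.wvar 20 = j ∧ s''.wvar 21 = s'.wvar 21 ∧ s''.wvar 22 = s'.wvar 22 ∧
      s''.rvar 10 = s'.rvar 10 ∧ e.eval E s'' = F j) :
    Run E (argmin hi b p e) s fun t s' =>
      t ≤ m * (c + b.time + 2 * e.time + hi.time + 30) + hi.time + 10 ∧ Same s s' ∧
      ((∃ j < m, B j) → s'.wvar 21 < m ∧ B (s'.wvar 21) ∧
        ∀ j < m, B j → F (s'.wvar 21) ≤ F j) := by
  have h1 : 1 % E.modulus = 1 := Nat.mod_eq_of_lt hM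
  simp only [argmin, run_seq, run_setW]
  refine (run_forTo_const hm (fun i s' => Same s s' ∧
    ((s'.wvar 22 = 0 ∧ ∀ j < i, ¬ B j) ∨ (s'.wvar 22 = 1 ∧ s'.wvar 21 < i ∧ B (s'.wvar 21) ∧
      s'.rvar 10 = F (s'.wvar 21) ∧ ∀ j < i, B j → F (s'.wvar 21) ≤ F j)))
    (c + b.time + 2 * e.time + 20) ?_ ?_ (Nat.zero_le m) ?_ ?_).mono ?_
  · rintro i - s' ⟨h, -⟩
    exact hhi s' h
  · rintro i hi' s' hx ⟨hS, hI⟩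
    have hb' := hb i hi' s' hS hx
    refine run_ite.2 ⟨fun hB => run_seq.2 ((hp i hi' (hb'.1 hB) s' hS hx).mono ?_), fun hB => ?_⟩
    · rintro t s'' ⟨ht, hS', h20, h21, h22, h10, he⟩
      have hSS := hS.trans hS'
      rw [← h21, ← h22, ← h10] at hI
      rw [hb'] at hB
      simp only [run_ite, run_seq, run_setW, run_setR, run_skip, Test.eval, WExp.eval, RExp.eval,
        Test.time, WExp.time, RExp.time, h1]
      refine ⟨fun h => ⟨by omega, by simpa using h20, ?_⟩, fun h => ⟨by omega, h20, ?_⟩⟩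
      · refine ⟨(((hSS.setRvar (by decide) _).setWvar (by decide) _).setWvar (by decide) _).setWvar
          (by decide) _, Or.inr ?_⟩
        simp only [Function.update_self, Function.update_of_ne, ne_eq, Nat.reduceEqDiff,
          not_false_eq_true, h20, he]
        refine ⟨trivial, by omega, hB, trivial, fun j hj hBj => ?_⟩
        rcases Nat.lt_succ_iff_lt_or_eq.1 hj with hj | rfl
        · rcases hI with hI | hI
          · exact absurd hBj (hI.2 j hj)
          · rw [he, hI.1, hI.2.2.2.1] at h
            have h := not_le.1 fun h' => h ⟨le_rfl, h'⟩
            exact h.le.trans (hI.2.2.2.2 j hj hBj)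
        · exact le_rfl
      · refine ⟨hSS.setWvar (by decide) _, ?_⟩
        simp only [Function.update_of_ne, ne_eq, Nat.reduceEqDiff, not_false_eq_true]
        rw [not_not, he] at h
        rcases hI with hI | hI
        · omega
        · refine Or.inr ⟨hI.1, by omega, hI.2.2.1, hI.2.2.2.1, fun j hj hBj => ?_⟩
          rcases Nat.lt_succ_iff_lt_or_eq.1 hj with hj | rfl
          · exact hI.2.2.2.2 j hj hBj
          · rw [← hI.2.2.2.1]
            exact h.2
    · rw [hb'] at hB
      refine run_skip.2 ⟨by omega, hx, hS.setWvar (by decide) _, ?_⟩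
      simp only [Function.update_of_ne, ne_eq, Nat.reduceEqDiff, not_false_eq_true]
      rcases hI with hI | hI
      · refine Or.inl ⟨hI.1, fun j hj => ?_⟩
        rcases Nat.lt_succ_iff_lt_or_eq.1 hj with hj | rfl
        · exact hI.2 j hj
        · exact hB
      · refine Or.inr ⟨hI.1, by omega, hI.2.2.1, hI.2.2.2.1, fun j hj hBj => ?_⟩
        rcases Nat.lt_succ_iff_lt_or_eq.1 hj with hj | rfl
        · exact hI.2.2.2.2 j hj hBj
        · exact absurd hBj hB
  · simp [WExp.eval]
  · refine ⟨((Same.refl s).setWvar (by decide) _).setWvar (by decide) _, Or.inl ⟨?_, ?_⟩⟩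
    · simp [WExp.eval]
    · simp
  · rintro t s' ⟨ht, -, hS, hI⟩
    simp only [WExp.time]
    refine ⟨?_, hS, ?_⟩
    · have : c + b.time + 2 * e.time + 20 + (hi.time + 8) ≤
        c + b.time + 2 * e.time + hi.time + 30 := by omega
      have := Nat.mul_le_mul_left (m - 0) this
      simp only [Nat.sub_zero] at this ht
      omega
    · rintro ⟨j, hj, hB⟩
      rcases hI with hI | hI
      · exact absurd hB (hI.2 j hj)
      · exact ⟨hI.2.1, hI.2.2.1, hI.2.2.2.2⟩

/-! ### Sets as arrays -/

/-- The first `r` cells of `f` list the elements of `A`, without repetition. -/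
def Lists (f : ℕ → ℕ) (r : ℕ) (A : Finset ℕ) : Prop :=
  (Finset.range r).image f = A ∧ A.card = r

section Lists

variable {f : ℕ → ℕ} {r : ℕ} {A : Finset ℕ}

theorem Lists.mem (h : Lists f r A) {i : ℕ} (hi : i < r) : f i ∈ A :=
  h.1 ▸ Finset.mem_image_of_mem f (Finset.mem_range.2 hi)

theorem Lists.exists_eq (h : Lists f r A) {x : ℕ} (hx : x ∈ A) : ∃ i < r, f i = x := by
  rw [← h.1] at hx
  simpa using hx

theorem Lists.inj (h : Lists f r A) {i j : ℕ} (hi : i < r) (hj : j < r) (e : f i = f j) :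
    i = j := by
  have h' : ((Finset.range r).image f).card = (Finset.range r).card := by
    rw [h.1, h.2, Finset.card_range]
  exact Finset.card_image_iff.1 h' (by simpa using hi) (by simpa using hj) e

theorem lists_zero (f : ℕ → ℕ) : Lists f 0 ∅ := by simp [Lists]

theorem Lists.insert (h : Lists f r A) {a : ℕ} (ha : a ∉ A) :
    Lists (Function.update f r a) (r + 1) (insert a A) := by
  constructor
  · rw [Finset.range_add_one, Finset.image_insert, Function.update_self, ← h.1]
    congr 1
    refine Finset.image_congr fun i hi => Function.update_of_ne ?_ _ _
    simp only [Finset.coe_range, Set.mem_Iio] at hi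
    omega
  · rw [Finset.card_insert_of_notMem ha, h.2]

/-- Deletion in constant time: the last entry moves into the hole. For `j = r` the write falls
outside the shortened list. -/
theorem Lists.erase (h : Lists f (r + 1) A) {j : ℕ} (hj : j < r + 1) :
    Lists (Function.update f j (f r)) r (A.erase (f j)) := by
  have hc : (A.erase (f j)).card = r := by
    rw [Finset.card_erase_of_mem (h.mem hj), h.2]
    rfl
  refine ⟨?_, hc⟩
  ext x
  simp only [Finset.mem_image, Finset.mem_range, Finset.mem_erase]
  constructor
  · rintro ⟨i, hi, rfl⟩
    rcases eq_or_ne i j with rfl | hne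
    · rw [Function.update_self]
      exact ⟨fun e => by have := h.inj (by omega) hj e; omega, h.mem (by omega)⟩
    · rw [Function.update_of_ne hne]
      exact ⟨fun e => hne (h.inj (by omega) hj e), h.mem (by omega)⟩
  · rintro ⟨hne, hx⟩
    obtain ⟨i, hi, rfl⟩ := h.exists_eq hx
    rcases Nat.lt_succ_iff_lt_or_eq.1 hi with hi | rfl
    · exact ⟨i, hi, Function.update_of_ne (fun e => hne (by rw [e])) _ _⟩
    · refine ⟨j, ?_, Function.update_self _ _ _⟩
      have : j ≠ i := fun e => hne (by rw [e])
      omega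

end Lists

/-! ### The input -/

/-- The environment `E` presents an instance of the `k`-median problem on the points
`0, …, n - 1`. -/
structure Instance (E : Env) (n k : ℕ) (d : ℕ → ℕ → ℝ) (w : ℕ → ℝ) : Prop where
  one_le : 1 ≤ k
  le : k ≤ n
  modulus : 128 * (n + 1) ^ 2 ≤ E.modulus
  dist : ∀ i < n, ∀ j < n, E.dist i j = d i j
  weight : ∀ i < n, E.weight i = w i
  isDist : IsDist d
  nonneg : ∀ i, 0 ≤ w i

/-- Counters and loads are linear in `n`. The quadratic size of the modulus is needed for table
addresses and for products with `k`. -/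
theorem Instance.lt_modulus {E : Env} {n k : ℕ} {d : ℕ → ℕ → ℝ} {w : ℕ → ℝ}
    (h : Instance E n k d w) {i : ℕ} (hi : i < 128 * (n + 1)) : i < E.modulus := by
  have := h.modulus
  nlinarith

theorem Instance.mod_eq {E : Env} {n k : ℕ} {d : ℕ → ℕ → ℝ} {w : ℕ → ℝ}
    (h : Instance E n k d w) {i : ℕ} (hi : i < 128 * (n + 1)) : i % E.modulus = i :=
  Nat.mod_eq_of_lt (h.lt_modulus hi)

/-! ### Reverse greedy -/

/-- The points of the block `[a, b)` that are not marked by `f`. -/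
def alive (f : ℕ → ℕ) (a b : ℕ) : Finset ℕ := (Finset.Ico a b).filter fun i => f i = 0

/-- List the unmarked points between word variables `3` and `4` in word array `2`. -/
def gather : Prog :=
  .seq (.setW 5 (.lit 0)) (.seq (.setW 6 (.var 3)) (forTo 6 (.var 4)
    (.ite (.wordLe (.get 1 (.var 6)) (.lit 0))
      (.seq (.putW 2 (.var 5) (.var 6)) (.setW 5 (.add (.var 5) (.lit 1)))) .skip)))

/-- Find the two elements of the list in word array `2` that are nearest to the point in word
variable `6`. -/
def scan : Prog :=
  .seq (argmin (.var 5) (.wordLe (.lit 0) (.lit 0)) .skip (.dist (.var 6) (.get 2 (.var 20))))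
    (.seq (.putW 3 (.var 6) (.get 2 (.var 21)))
    (.seq (argmin (.var 5) (.not (.wordEq (.get 2 (.var 20)) (.get 3 (.var 6)))) .skip
      (.dist (.var 6) (.get 2 (.var 20))))
    (.putW 4 (.var 6) (.get 2 (.var 21)))))

/-- Compute the gain and the load of the centers between word variables `3` and `4`. -/
def tally : Prog :=
  .seq (.setW 6 (.var 3)) (.seq (forTo 6 (.var 4)
    (.seq (.putW 5 (.var 6) (.lit 0)) (.putR 0 (.var 6) (.lit 0))))
    (.seq (.setW 6 (.var 3)) (forTo 6 (.var 4)
      (.seq (.putR 0 (.get 3 (.var 6)) (.add (.get 0 (.get 3 (.var 6))) (.mul (.weight (.var 6))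
        (.sub (.dist (.var 6) (.get 4 (.var 6))) (.dist (.var 6) (.get 3 (.var 6)))))))
      (.seq (.putW 5 (.get 3 (.var 6)) (.add (.get 5 (.get 3 (.var 6))) (.lit 1)))
        (.putW 5 (.get 4 (.var 6)) (.add (.get 5 (.get 4 (.var 6))) (.lit 1))))))))

section

variable {E : Env} {n k : ℕ} {d : ℕ → ℕ → ℝ} {w : ℕ → ℝ} {s : State}

theorem gain_Ico_succ {a i : ℕ} (h : a ≤ i) (c₁ c₂ : ℕ → ℕ) (y : ℕ) :
    gain d w (Finset.Ico a (i + 1)) c₁ c₂ y = gain d w (Finset.Ico a i) c₁ c₂ y +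
      if c₁ i = y then w i * (d i (c₂ i) - d i (c₁ i)) else 0 :=
  Finset.sum_Ico_succ_top h _

theorem load_Ico_succ {a i : ℕ} (h : a ≤ i) (c₁ c₂ : ℕ → ℕ) (y : ℕ) :
    load (Finset.Ico a (i + 1)) c₁ c₂ y = load (Finset.Ico a i) c₁ c₂ y +
      ((if c₁ i = y then 1 else 0) + (if c₂ i = y then 1 else 0)) :=
  Finset.sum_Ico_succ_top h _

theorem run_gather (hE : Instance E n k d w) {a b : ℕ} (ha : s.wvar 3 = a) (hb : s.wvar 4 = b)
    (hab : a ≤ b) (hbn : b ≤ n) :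
    Run E gather s fun t s' => t ≤ 30 * (b - a) + 30 ∧
      Lists (s'.warr 2) (s'.wvar 5) (alive (s.warr 1) a b) := by
  simp only [gather, run_seq, run_setW]
  refine (run_forTo_const (hE.lt_modulus (by omega : b < _)) (fun i s' => s'.wvar 4 = b ∧
    s'.warr 1 = s.warr 1 ∧ s'.wvar 5 ≤ i ∧ Lists (s'.warr 2) (s'.wvar 5) (alive (s.warr 1) a i) ∧
      a ≤ i) 13 ?_ ?_ hab ?_ ?_).mono ?_
  · rintro i - s' ⟨h, -⟩
    exact h
  · rintro i hi s' hx ⟨h4, h1, h5, hL, hai⟩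
    have e1 : 1 % E.modulus = 1 := hE.mod_eq (by omega)
    have e2 : (s'.wvar 5 + 1) % E.modulus = s'.wvar 5 + 1 := hE.mod_eq (by omega)
    have hal : alive (s.warr 1) a (i + 1) = if s.warr 1 i = 0 then
        insert i (alive (s.warr 1) a i) else alive (s.warr 1) a i := by
      rw [alive, ← Finset.insert_Ico_right_eq_Ico_add_one hai, Finset.filter_insert]
      rfl
    have hni : i ∉ alive (s.warr 1) a i := by simp [alive]
    simp only [run_ite, run_seq, run_putW, run_setW, run_skip, Test.eval, WExp.eval, hx, h1,
      Nat.zero_mod, Nat.le_zero]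
    refine ⟨fun h => ⟨by simp [Test.time, WExp.time], by simpa using hx, ?_⟩,
      fun h => ⟨by simp [Test.time, WExp.time], trivial, ?_⟩⟩
    · simp only [ne_eq, Nat.reduceEqDiff, not_false_eq_true, Function.update_of_ne, h4, h1,
        Function.update_self, e1, e2, true_and]
      rw [hal, if_pos h]
      exact ⟨by omega, hL.insert hni, by omega⟩
    · simp only [ne_eq, Nat.reduceEqDiff, not_false_eq_true, Function.update_of_ne, h4,
        true_and]
      rw [hal, if_neg h]
      exact ⟨by omega, hL, by omega⟩
  · simp [WExp.eval, ha]
  · simp only [WExp.eval, Nat.zero_mod, ne_eq, Nat.reduceEqDiff, not_false_eq_true,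
      Function.update_of_ne, Function.update_self, hb, true_and]
    refine ⟨by omega, ?_, le_rfl⟩
    rw [alive, Finset.Ico_self]
    exact lists_zero _
  · rintro t s' ⟨ht, -, -, -, -, h, -⟩
    refine ⟨?_, h⟩
    simp only [WExp.time] at ht ⊢
    omega

theorem run_scan (hE : Instance E n k d w) {r v : ℕ} {X : Finset ℕ} (hr : s.wvar 5 = r)
    (hX : Lists (s.warr 2) r X) (hXn : ∀ x ∈ X, x < n) (hr2 : 2 ≤ r) (hv : s.wvar 6 = v)
    (hvn : v < n) :
    Run E scan s fun t s' => t ≤ 100 * r + 50 ∧ ∃ a b, Nearest d X v a b ∧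
      s'.warr 3 = Function.update (s.warr 3) v a ∧ s'.warr 4 = Function.update (s.warr 4) v b := by
  have hrn : r ≤ n := by
    rw [← hX.2]
    simpa using Finset.card_le_card (show X ⊆ Finset.range n from
      fun x hx => Finset.mem_range.2 (hXn x hx))
  have hM : 1 < E.modulus := hE.lt_modulus (by omega)
  have hrM : r < E.modulus := hE.lt_modulus (by omega)
  have hdist : ∀ s' : State, Same s s' → ∀ j < r, s'.wvar 20 = j →
      E.dist (s'.wvar 6) (s.warr 2 (s'.wvar 20)) = d v (s.warr 2 j) := by
    rintro s' hS j hj rfl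
    rw [hS.wvar 6 (by decide), hv]
    exact hE.dist _ hvn _ (hXn _ (hX.mem hj))
  refine Run.seq (run_argmin hM hrM (B := fun _ => True) (F := fun j => d v (s.warr 2 j)) (c := 1)
    ?_ ?_ ?_) ?_
  · intro s' hS
    exact (hS.wvar 5 (by decide)).trans hr
  · simp [Test.eval]
  · rintro j hj - s' hS hx
    refine run_skip.2 ⟨le_rfl, Same.refl _, hx, rfl, rfl, rfl, ?_⟩
    simp only [RExp.eval, WExp.eval, hS.warr]
    exact hdist s' hS j hj hx
  rintro t₁ s₁ ⟨ht₁, hS, h₁⟩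
  obtain ⟨hlt, -, hmin⟩ := h₁ ⟨0, by omega, trivial⟩
  rw [run_seq, run_putW]
  set a := s.warr 2 (s₁.wvar 21) with ha
  have haX : a ∈ X := hX.mem hlt
  have h6 : s₁.wvar 6 = v := (hS.wvar 6 (by decide)).trans hv
  simp only [WExp.eval, h6, hS.warr, ← ha, WExp.time]
  refine Run.seq (run_argmin hM hrM (B := fun j => s.warr 2 j ≠ a)
    (F := fun j => d v (s.warr 2 j)) (c := 1) ?_ ?_ ?_) ?_
  · intro s' hS'
    simp only [WExp.eval]
    rw [hS'.wvar 5 (by decide), hS.wvar 5 (by decide), hr]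
  · rintro j hj s' hS' hx
    simp only [Test.eval, WExp.eval, hS'.warr, hx, hS'.wvar 6 (by decide), h6]
    simp only [ne_eq, Nat.reduceEqDiff, not_false_eq_true, Function.update_of_ne,
      Function.update_self]
    rw [← le_antisymm_iff]
  · rintro j hj - s' hS' hx
    refine run_skip.2 ⟨le_rfl, Same.refl _, hx, rfl, rfl, rfl, ?_⟩
    simp only [RExp.eval, WExp.eval, hS'.warr, hx, hS'.wvar 6 (by decide), h6]
    simp only [ne_eq, Nat.reduceEqDiff, not_false_eq_true, Function.update_of_ne]
    exact hE.dist _ hvn _ (hXn _ (hX.mem hj))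
  rintro t₂ s₂ ⟨ht₂, hS₂, h₂⟩
  -- A second nearest center exists because the list has at least two distinct entries.
  have hex : ∃ j < r, s.warr 2 j ≠ a := by
    by_contra h
    push Not at h
    have := hX.inj (i := 0) (j := 1) (by omega) (by omega)
      ((h 0 (by omega)).trans (h 1 (by omega)).symm)
    omega
  obtain ⟨hlt₂, hne, hmin₂⟩ := h₂ hex
  simp only [run_putW, WExp.eval, hS₂.warr, hS₂.wvar 6 (by decide), h6]
  refine ⟨?_, a, s.warr 2 (s₂.wvar 21), ⟨⟨haX, ?_⟩, hX.mem hlt₂, hne, ?_⟩, ?_, ?_⟩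
  · simp only [Test.time, WExp.time, RExp.time] at ht₁ ht₂ ⊢
    omega
  · intro x hx
    obtain ⟨j, hj, rfl⟩ := hX.exists_eq hx
    exact hmin j hj trivial
  · intro x hx hxa
    obtain ⟨j, hj, rfl⟩ := hX.exists_eq hx
    exact hmin₂ j hj hxa
  · simp
  · simp

theorem run_tally (hE : Instance E n k d w) {a b : ℕ} (ha : s.wvar 3 = a) (hb : s.wvar 4 = b)
    (hab : a ≤ b) (hbn : b ≤ n)
    (h₁ : ∀ v ∈ Finset.Ico a b, s.warr 3 v ∈ Finset.Ico a b)
    (h₂ : ∀ v ∈ Finset.Ico a b, s.warr 4 v ∈ Finset.Ico a b) :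
    Run E tally s fun t s' => t ≤ 80 * (b - a) + 40 ∧ ∀ y ∈ Finset.Ico a b,
      s'.rarr 0 y = gain d w (Finset.Ico a b) (s.warr 3) (s.warr 4) y ∧
      s'.warr 5 y = load (Finset.Ico a b) (s.warr 3) (s.warr 4) y := by
  have hbM : b < E.modulus := hE.lt_modulus (by omega)
  have e1 : 1 % E.modulus = 1 := hE.mod_eq (by omega)
  simp only [tally, run_seq, run_setW]
  refine (run_forTo_const hbM (fun i s' => s'.wvar 3 = a ∧ s'.wvar 4 = b ∧ s'.warr 3 = s.warr 3 ∧
    s'.warr 4 = s.warr 4 ∧ ∀ y ∈ Finset.Ico a i, s'.rarr 0 y = 0 ∧ s'.warr 5 y = 0)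
    6 ?_ ?_ hab ?_ ?_).mono ?_
  · rintro i - s' ⟨-, h, -⟩
    exact h
  · rintro i hi s' hx ⟨h3, h4, h3', h4', hz⟩
    simp only [run_seq, run_putW, run_putR, WExp.eval, RExp.eval, hx, WExp.time, RExp.time,
      Nat.zero_mod, Nat.cast_zero]
    refine ⟨by omega, trivial, ?_⟩
    simp only [ne_eq, Nat.reduceEqDiff, not_false_eq_true, Function.update_of_ne, h3, h4, h3', h4',
      Function.update_self, true_and]
    intro y hy
    rcases eq_or_ne y i with rfl | hne
    · simp
    · simp only [Function.update_of_ne hne]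
      refine hz y ?_
      simp only [Finset.mem_Ico] at hy ⊢
      omega
  · simp [WExp.eval, ha]
  · simp [ha, hb]
  rintro t₁ s₁ ⟨ht₁, -, h3, h4, h3', h4', hz⟩
  refine (run_forTo_const hbM (fun i s' => s'.wvar 4 = b ∧ s'.warr 3 = s.warr 3 ∧
    s'.warr 4 = s.warr 4 ∧ a ≤ i ∧ ∀ y ∈ Finset.Ico a b,
      s'.rarr 0 y = gain d w (Finset.Ico a i) (s.warr 3) (s.warr 4) y ∧
      s'.warr 5 y = load (Finset.Ico a i) (s.warr 3) (s.warr 4) y)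
    40 ?_ ?_ hab ?_ ?_).mono ?_
  · rintro i - s' ⟨h, -⟩
    exact h
  · rintro i hi s' hx ⟨h4, h3', h4', hai, hg⟩
    have hi' : i ∈ Finset.Ico a b := Finset.mem_Ico.2 ⟨hai, hi⟩
    have hc₁ := h₁ i hi'
    have hc₂ := h₂ i hi'
    have hc₁' := Finset.mem_Ico.1 hc₁
    have hc₂' := Finset.mem_Ico.1 hc₂
    have hw := hE.weight i (by omega)
    have hd₁ := hE.dist i (by omega) (s.warr 3 i) (by omega)
    have hd₂ := hE.dist i (by omega) (s.warr 4 i) (by omega)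
    -- Partial loads never exceed `2 n`, so the increments do not wrap around.
    have hload : ∀ y, load (Finset.Ico a i) (s.warr 3) (s.warr 4) y ≤ 2 * n := fun y => by
      have := sum_load_le (Finset.Ico a i) {y} (s.warr 3) (s.warr 4)
      simp only [Finset.sum_singleton, Nat.card_Ico] at this
      omega
    have em : ∀ y, (load (Finset.Ico a i) (s.warr 3) (s.warr 4) y + 1) % E.modulus =
        load (Finset.Ico a i) (s.warr 3) (s.warr 4) y + 1 := fun y =>
      hE.mod_eq (by have := hload y; omega)
    have em' : ∀ y, (load (Finset.Ico a i) (s.warr 3) (s.warr 4) y + 1 + 1) % E.modulus =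
        load (Finset.Ico a i) (s.warr 3) (s.warr 4) y + 1 + 1 := fun y =>
      hE.mod_eq (by have := hload y; omega)
    simp only [run_seq, run_putW, run_putR, WExp.eval, RExp.eval, hx, WExp.time, RExp.time, h3', h4',
      ne_eq, Nat.reduceEqDiff, not_false_eq_true, Function.update_of_ne, Function.update_self, hw,
      hd₁, hd₂, e1, h4, (hg _ hc₁).1, (hg _ hc₁).2, true_and]
    refine ⟨by omega, by omega, fun y hy => ⟨?_, ?_⟩⟩
    · rw [gain_Ico_succ hai]
      split_ifs with h
      · rw [h, Function.update_self]
      · rw [Function.update_of_ne (Ne.symm h), (hg y hy).1, add_zero]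
    · rw [load_Ico_succ hai, em]
      rcases eq_or_ne y (s.warr 4 i) with rfl | hne
      · rw [Function.update_self, if_pos rfl]
        rcases eq_or_ne (s.warr 4 i) (s.warr 3 i) with h | h
        · rw [h, Function.update_self, if_pos rfl, em']
        · rw [Function.update_of_ne h, if_neg (Ne.symm h), (hg _ hc₂).2, em, zero_add]
      · rw [Function.update_of_ne hne, if_neg (Ne.symm hne)]
        rcases eq_or_ne y (s.warr 3 i) with h | h
        · rw [h, Function.update_self, if_pos rfl]
        · rw [Function.update_of_ne h, if_neg (Ne.symm h), (hg _ hy).2]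
          rfl
  · simp [WExp.eval, h3]
  · simp only [ne_eq, Nat.reduceEqDiff, not_false_eq_true, Function.update_of_ne, h4, h3', h4',
      true_and]
    exact ⟨le_rfl, fun y hy => by simpa [gain, load] using hz y hy⟩
  · rintro t s' ⟨ht, -, -, -, -, -, h⟩
    refine ⟨?_, h⟩
    simp only [WExp.time] at ht ht₁ ⊢
    omega

end

/-- Update the two nearest centers of the points after the removal of the center in word
variable `7`. -/
def rescan : Prog :=
  .seq (.setW 6 (.var 3)) (forTo 6 (.var 4)
    (.ite (.and (.not (.wordEq (.get 3 (.var 6)) (.var 7)))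
      (.not (.wordEq (.get 4 (.var 6)) (.var 7)))) .skip scan))

/-- Remove a center: one of small load with least gain. -/
def removeCenter : Prog :=
  .seq tally (.seq (argmin (.var 5)
      (.wordLe (.mul (.get 5 (.get 2 (.var 20))) (.var 1)) (.mul (.lit 4) (.sub (.var 4) (.var 3))))
      .skip (.get 0 (.get 2 (.var 20))))
    (.seq (.seq (.setW 7 (.get 2 (.var 21))) (.seq (.putW 1 (.var 7) (.lit 1))
      (.seq (.setW 5 (.sub (.var 5) (.lit 1))) (.putW 2 (.var 21) (.get 2 (.var 5)))))) rescan))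

/-- Reduce the number of centers between word variables `3` and `4` to at most `2 k`. -/
def reduceBlock : Prog :=
  .seq gather (.ite (.wordLt (.mul (.lit 2) (.var 1)) (.var 5))
    (.seq (.setW 6 (.var 3)) (.seq (forTo 6 (.var 4) scan)
      (.while (.wordLt (.mul (.lit 2) (.var 1)) (.var 5)) removeCenter))) .skip)

/-- Only the points counted in the load of the removed center need a new scan. -/
theorem Nearest.erase {d : ℕ → ℕ → ℝ} {X : Finset ℕ} {v a b y : ℕ} (h : Nearest d X v a b)
    (ha : a ≠ y) (hb : b ≠ y) : Nearest d (X.erase y) v a b :=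
  ⟨⟨Finset.mem_erase.2 ⟨ha, h.1.1⟩, fun x hx => h.1.2 x (Finset.mem_of_mem_erase hx)⟩,
    Finset.mem_erase.2 ⟨hb, h.2.1⟩, h.2.2.1, fun x hx => h.2.2.2 x (Finset.mem_of_mem_erase hx)⟩

/-- The state while centers of the block `[a, b)` are removed; `X` is the set of centers left. -/
structure BlockState (n k : ℕ) (d : ℕ → ℕ → ℝ) (a b : ℕ) (X : Finset ℕ) (s : State) : Prop where
  n_eq : s.wvar 0 = n
  k_eq : s.wvar 1 = k
  a_eq : s.wvar 3 = a
  b_eq : s.wvar 4 = b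
  lists : Lists (s.warr 2) (s.wvar 5) X
  alive : X = alive (s.warr 1) a b
  nearest : ∀ v ∈ Finset.Ico a b, Nearest d X v (s.warr 3 v) (s.warr 4 v)

section

variable {E : Env} {n k : ℕ} {d : ℕ → ℕ → ℝ} {w : ℕ → ℝ} {s : State}

/-- A full scan is made at `v` only if the removed center was `c₁ v` or `c₂ v`. These scans are
charged to the load, the rest is linear in the block. -/
theorem run_rescan (hE : Instance E n k d w) {a b r y : ℕ} {X : Finset ℕ} (ha : s.wvar 3 = a)
    (hb : s.wvar 4 = b) (hab : a ≤ b) (hbn : b ≤ n) (hr : s.wvar 5 = r) (hr2 : 2 ≤ r)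
    (hy : s.wvar 7 = y) (hX : Lists (s.warr 2) r (X.erase y)) (hXn : ∀ x ∈ X, x < n)
    (hc : ∀ v ∈ Finset.Ico a b, Nearest d X v (s.warr 3 v) (s.warr 4 v)) :
    Run E rescan s fun t s' => t ≤ 32 * (b - a) + 10 +
        load (Finset.Ico a b) (s.warr 3) (s.warr 4) y * (100 * r + 50) ∧
      ∀ v ∈ Finset.Ico a b, Nearest d (X.erase y) v (s'.warr 3 v) (s'.warr 4 v) := by
  simp only [rescan, run_seq, run_setW]
  refine (run_forTo (hE.lt_modulus (by omega : b < _)) (fun i s' => s'.wvar 4 = b ∧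
    s'.wvar 5 = r ∧ s'.wvar 7 = y ∧ s'.warr 2 = s.warr 2 ∧ a ≤ i ∧
    (∀ v, i ≤ v → s'.warr 3 v = s.warr 3 v ∧ s'.warr 4 v = s.warr 4 v) ∧
    ∀ v ∈ Finset.Ico a i, Nearest d (X.erase y) v (s'.warr 3 v) (s'.warr 4 v))
    (fun v => 23 + ((if s.warr 3 v = y then 1 else 0) + (if s.warr 4 v = y then 1 else 0)) *
      (100 * r + 50)) ?_ ?_ hab ?_ ?_).mono ?_
  · rintro i - s' ⟨h, -⟩
    exact h
  · rintro i hi s' hx ⟨h4, h5, h7, h2, hai, hge, hlt⟩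
    have hi' : i ∈ Finset.Ico a b := Finset.mem_Ico.2 ⟨hai, hi⟩
    rw [run_ite, run_skip]
    simp only [Test.eval, WExp.eval, hx, h7, (hge i le_rfl).1, (hge i le_rfl).2,
      ← le_antisymm_iff, Test.time, WExp.time]
    constructor
    · rintro ⟨hn₁, hn₂⟩
      refine ⟨by omega, trivial, ?_⟩
      simp only [ne_eq, Nat.reduceEqDiff, not_false_eq_true, Function.update_of_ne, h4, h5, h7, h2,
        true_and]
      refine ⟨by omega, fun v hv => hge v (by omega), fun v hv => ?_⟩
      rcases eq_or_ne v i with rfl | hne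
      · rw [(hge v le_rfl).1, (hge v le_rfl).2]
        exact (hc v hi').erase hn₁ hn₂
      · refine hlt v ?_
        simp only [Finset.mem_Ico] at hv ⊢
        omega
    · intro hn
      refine (run_scan hE h5 (h2 ▸ hX) (fun x hx => hXn x (Finset.mem_of_mem_erase hx)) hr2 hx
        (by omega)).frame.mono ?_
      rintro t s'' ⟨⟨ht, p, q, hpq, h3', h4'⟩, hf⟩
      refine ⟨?_, (hf.wvar 6 (by decide)).trans hx, ?_⟩
      · have : 1 ≤ (if s.warr 3 i = y then 1 else 0) + (if s.warr 4 i = y then 1 else 0) := by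
          split_ifs <;> omega
        nlinarith
      · simp only [ne_eq, Nat.reduceEqDiff, not_false_eq_true, Function.update_of_ne,
          hf.wvar 4 (by decide), hf.wvar 5 (by decide), hf.wvar 7 (by decide),
          hf.warr 2 (by decide), h4, h5, h7, h2, true_and, h3', h4']
        refine ⟨by omega, fun v hv => ?_, fun v hv => ?_⟩
        · have : v ≠ i := by omega
          rw [Function.update_of_ne this, Function.update_of_ne this]
          exact hge v (by omega)
        · rcases eq_or_ne v i with rfl | hne
          · simpa using hpq
          · rw [Function.update_of_ne hne, Function.update_of_ne hne]
            refine hlt v ?_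
            simp only [Finset.mem_Ico] at hv ⊢
            omega
  · simp [WExp.eval, ha]
  · simp [hb, hr, hy]
  · rintro t s' ⟨ht, -, -, -, -, -, -, -, h⟩
    refine ⟨?_, h⟩
    simp only [Finset.sum_add_distrib, ← Finset.sum_mul] at ht
    rw [load, Finset.sum_add_distrib]
    simp only [WExp.time, Finset.sum_const, Nat.card_Ico, smul_eq_mul] at ht ⊢
    omega

/-- The center is chosen without knowledge of `T`: the least gain among light centers is at most the
gain of the one that `exists_cheap_removal` provides for any given `T`. Lightness makes the rescan
linear in the block length. -/
theorem run_removeCenter (hE : Instance E n k d w) {a b : ℕ} (hab : a < b) (hbn : b ≤ n)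
    {X : Finset ℕ} (hs : BlockState n k d a b X s) (hX : 2 * k < X.card) (hX' : X.card ≤ 4 * k) :
    Run E removeCenter s fun t s' => t ≤ 2200 * (b - a) ∧ ∃ y ∈ X,
      BlockState n k d a b (X.erase y) s' ∧
      (∀ i, i ∉ Finset.Ico a b → s'.warr 1 i = s.warr 1 i) ∧
      ∀ T : Finset ℕ, T.Nonempty → T.card ≤ k →
        costOn d w (Finset.Ico a b) (X.erase y) * k ≤
          costOn d w (Finset.Ico a b) X * k + 4 * costOn d w (Finset.Ico a b) T := by
  have hk := hE.one_le
  have hXI : X ⊆ Finset.Ico a b := by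
    rw [hs.alive]
    exact Finset.filter_subset _ _
  have hXn : ∀ x ∈ X, x < n := fun x hx => by
    have := Finset.mem_Ico.1 (hXI hx)
    omega
  have hXm : X.card ≤ b - a := by simpa using Finset.card_le_card hXI
  have hr : s.wvar 5 = X.card := hs.lists.2.symm
  have hL : Lists (s.warr 2) X.card X := hr ▸ hs.lists
  refine Run.seq (run_tally hE hs.a_eq hs.b_eq hab.le hbn
    (fun v hv => hXI (hs.nearest v hv).1.1) (fun v hv => hXI (hs.nearest v hv).2.1)).frame ?_
  rintro t₁ s₁ ⟨⟨ht₁, hg⟩, hf₁⟩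
  have hex := fun T (hT : T.Nonempty) hTk => exists_cheap_removal hE.isDist hE.nonneg hs.nearest
    ⟨a, Finset.mem_Ico.2 ⟨le_rfl, hab⟩⟩ (T := T) hT (k := k) hTk hX
  rw [Nat.card_Ico] at hex
  refine Run.seq (run_argmin (hE.lt_modulus (by omega))
    (hE.lt_modulus (show X.card < _ by omega))
    (B := fun j => load (Finset.Ico a b) (s.warr 3) (s.warr 4) (s.warr 2 j) * k ≤ 4 * (b - a))
    (F := fun j => gain d w (Finset.Ico a b) (s.warr 3) (s.warr 4) (s.warr 2 j)) (c := 1)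
    ?_ ?_ ?_) ?_
  · intro s' hS
    simp only [WExp.eval]
    rw [hS.wvar 5 (by decide), hf₁.wvar 5 (by decide), hr]
  · intro j hj s' hS hx
    have h4 : 4 % E.modulus = 4 := hE.mod_eq (by omega)
    simp only [Test.eval, WExp.eval, hS.warr, hx, hf₁.warr 2 (by decide), h4,
      hS.wvar 4 (by decide), hS.wvar 3 (by decide), hS.wvar 1 (by decide),
      hf₁.wvar 4 (by decide), hf₁.wvar 3 (by decide), hf₁.wvar 1 (by decide), hs.a_eq, hs.b_eq,
      hs.k_eq, (hg _ (hXI (hL.mem hj))).2]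
    rw [Nat.mod_eq_of_lt, hE.mod_eq (by omega : 4 * (b - a) < _)]
    have h₁ := sum_load_le (Finset.Ico a b) {s.warr 2 j} (s.warr 3) (s.warr 4)
    simp only [Finset.sum_singleton, Nat.card_Ico] at h₁
    -- The product of load and `k` is at most `2 n ^ 2` and hence does not wrap.
    have h₂ := hE.modulus
    have h₃ := hE.le
    have h₄ : load (Finset.Ico a b) (s.warr 3) (s.warr 4) (s.warr 2 j) * k ≤ (2 * n) * n :=
      Nat.mul_le_mul (by omega) h₃
    nlinarith
  · rintro j hj - s' hS hx
    refine run_skip.2 ⟨le_rfl, Same.refl _, hx, rfl, rfl, rfl, ?_⟩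
    simp only [RExp.eval, WExp.eval, hS.warr, hS.rarr, hx, hf₁.warr 2 (by decide),
      (hg _ (hXI (hL.mem hj))).1]
  rintro t₂ s₂ ⟨ht₂, hS₂, h₂⟩
  have hexj : ∀ T : Finset ℕ, T.Nonempty → T.card ≤ k → ∃ j < X.card,
      load (Finset.Ico a b) (s.warr 3) (s.warr 4) (s.warr 2 j) * k ≤ 4 * (b - a) ∧
      gain d w (Finset.Ico a b) (s.warr 3) (s.warr 4) (s.warr 2 j) * k ≤
        4 * costOn d w (Finset.Ico a b) T := by
    intro T hT hTk
    obtain ⟨y, hy, h⟩ := hex T hT hTk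
    obtain ⟨j, hj, rfl⟩ := hL.exists_eq hy
    exact ⟨j, hj, h⟩
  obtain ⟨hj, hload, hmin⟩ := h₂ (by
    -- Any admissible `T` will do, since only the existence of a light center is wanted here.
    obtain ⟨j, hj, h, -⟩ := hexj {0} (Finset.singleton_nonempty 0) (by simpa using hk)
    exact ⟨j, hj, h⟩)
  set j := s₂.wvar 21 with hj_def
  set y := s.warr 2 j with hy_def
  have hyX : y ∈ X := hL.mem hj
  have hyI := hXI hyX
  obtain ⟨r, hXr⟩ : ∃ r, X.card = r + 1 := ⟨X.card - 1, by omega⟩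
  have hw₁ : s₁.warr 2 = s.warr 2 := hf₁.warr 2 (by decide)
  have e5 : s₂.wvar 5 = X.card := by
    rw [hS₂.wvar 5 (by decide), hf₁.wvar 5 (by decide), hr]
  simp only [run_seq, run_setW, run_putW, WExp.eval, WExp.time, hS₂.warr]
  have hz : (1 : ℕ) % E.modulus = 1 := hE.mod_eq (by omega)
  rw [hXr] at hL hj
  have hLe := hL.erase hj
  refine (run_rescan hE (a := a) (b := b) (r := r) (y := y) (X := X) ?_ ?_ hab.le hbn ?_ (by omega)
    ?_ ?_ hXn ?_).frame.mono ?_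
  · simp [hS₂.wvar 3 (by decide), hf₁.wvar 3 (by decide), hs.a_eq]
  · simp [hS₂.wvar 4 (by decide), hf₁.wvar 4 (by decide), hs.b_eq]
  · simp [e5, hz, hXr]
  · simp [hw₁, hy_def, hj_def]
  · simpa [hw₁, hy_def, ← hj_def, e5, hz, hXr] using hLe
  · simpa [hf₁.warr 3 (by decide), hf₁.warr 4 (by decide)] using hs.nearest
  rintro t₃ s₃ ⟨⟨ht₃, hnear⟩, hf₃⟩
  have hw1 : s₃.warr 1 = Function.update (s.warr 1) y 1 := by
    rw [hf₃.warr 1 (by decide)]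
    simp [hw₁, hf₁.warr 1 (by decide), hz, hy_def, ← hj_def]
  have hw2 : s₃.warr 2 = Function.update (s.warr 2) j (s.warr 2 r) := by
    rw [hf₃.warr 2 (by decide)]
    simp [hw₁, hz, ← hj_def, e5, hXr]
  have hw5 : s₃.wvar 5 = r := by
    rw [hf₃.wvar 5 (by decide)]
    simp [e5, hz, hXr]
  refine ⟨?_, y, hyX, ⟨?_, ?_, ?_, ?_, ?_, ?_, hnear⟩, ?_, ?_⟩
  · have e3 : ∀ a ∈ [3, 4], s₁.warr a = s.warr a := by
      intro a ha
      refine hf₁.warr a ?_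
      simp only [List.mem_cons, List.not_mem_nil, or_false] at ha
      rcases ha with rfl | rfl <;> decide
    simp only [ne_eq, Nat.reduceEqDiff, not_false_eq_true, Function.update_of_ne,
      e3 3 (by simp), e3 4 (by simp)] at ht₃
    -- Since `r ≤ 4 k` and the load times `k` is at most `4 (b - a)`, scanning lists of length `r`
    -- costs `O(b - a)` altogether.
    have h₁ : load (Finset.Ico a b) (s.warr 3) (s.warr 4) y * r ≤ 16 * (b - a) := by
      have : r ≤ 4 * k := by omega
      calc _ ≤ load (Finset.Ico a b) (s.warr 3) (s.warr 4) y * (4 * k) :=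
            Nat.mul_le_mul_left _ this
        _ = 4 * (load (Finset.Ico a b) (s.warr 3) (s.warr 4) y * k) := by ring
        _ ≤ _ := by omega
    have h₂ : load (Finset.Ico a b) (s.warr 3) (s.warr 4) y ≤ 4 * (b - a) :=
      (Nat.le_mul_of_pos_right _ hk).trans hload
    have h₃ : load (Finset.Ico a b) (s.warr 3) (s.warr 4) y * (100 * r + 50) =
      100 * (load (Finset.Ico a b) (s.warr 3) (s.warr 4) y * r) +
        50 * load (Finset.Ico a b) (s.warr 3) (s.warr 4) y := by ring
    simp only [Test.time, WExp.time, RExp.time] at ht₂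
    omega
  · rw [hf₃.wvar 0 (by decide)]
    simp [hS₂.wvar 0 (by decide), hf₁.wvar 0 (by decide), hs.n_eq]
  · rw [hf₃.wvar 1 (by decide)]
    simp [hS₂.wvar 1 (by decide), hf₁.wvar 1 (by decide), hs.k_eq]
  · rw [hf₃.wvar 3 (by decide)]
    simp [hS₂.wvar 3 (by decide), hf₁.wvar 3 (by decide), hs.a_eq]
  · rw [hf₃.wvar 4 (by decide)]
    simp [hS₂.wvar 4 (by decide), hf₁.wvar 4 (by decide), hs.b_eq]
  · rw [hw2, hw5]
    exact hLe
  · rw [hw1, hs.alive]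
    ext i
    simp only [alive, Finset.mem_erase, Finset.mem_filter]
    rcases eq_or_ne i y with rfl | hne
    · simp
    · simp [hne]
  · intro i hi
    rw [hw1, Function.update_of_ne]
    rintro rfl
    exact hi hyI
  · intro T hT hTk
    obtain ⟨i, hi, hl, hle⟩ := hexj T hT hTk
    have h₁ := hmin i hi hl
    have h₂ := costOn_erase_le hE.nonneg hs.nearest y
    have h₃ : (0 : ℝ) ≤ k := Nat.cast_nonneg k
    nlinarith

/-- At most `4 k - 2 k` centers are removed, each adding at most `4 cost(T) / k`, which gives the
summand `8 cost(T)`. -/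
theorem run_reduceBlock (hE : Instance E n k d w) {a b : ℕ} (hab : a < b) (hbn : b ≤ n)
    (h0 : s.wvar 0 = n) (h1 : s.wvar 1 = k) (h3 : s.wvar 3 = a) (h4 : s.wvar 4 = b)
    {A : Finset ℕ} (hA : A = alive (s.warr 1) a b) (hne : A.Nonempty) (hA' : A.card ≤ 4 * k) :
    Run E reduceBlock s fun t s' => t ≤ 6000 * k * (b - a) ∧
      (∀ i, i ∉ Finset.Ico a b → s'.warr 1 i = s.warr 1 i) ∧
      (alive (s'.warr 1) a b).Nonempty ∧ (alive (s'.warr 1) a b).card ≤ 2 * k ∧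
      ∀ T : Finset ℕ, T.Nonempty → T.card ≤ k →
        costOn d w (Finset.Ico a b) (alive (s'.warr 1) a b) ≤
          costOn d w (Finset.Ico a b) A + 8 * costOn d w (Finset.Ico a b) T := by
  have hk := hE.one_le
  have hkn := hE.le
  have hkm : b - a ≤ k * (b - a) := Nat.le_mul_of_pos_left _ hk
  have hkm' : k ≤ k * (b - a) := Nat.le_mul_of_pos_right _ (by omega)
  have htime : 6000 * k * (b - a) = 6000 * (k * (b - a)) := by ring
  have hAI : A ⊆ Finset.Ico a b := by
    rw [hA]
    exact Finset.filter_subset _ _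
  have e2 : 2 % E.modulus = 2 := hE.mod_eq (by omega)
  have e2k : 2 * k % E.modulus = 2 * k := hE.mod_eq (by omega)
  refine Run.seq (run_gather hE h3 h4 hab.le hbn).frame ?_
  rintro t₁ s₁ ⟨⟨ht₁, hL⟩, hf₁⟩
  rw [← hA] at hL
  have h5 : s₁.wvar 5 = A.card := hL.2.symm
  have hw1 : s₁.warr 1 = s.warr 1 := hf₁.warr 1 (by decide)
  have h0' : s₁.wvar 0 = n := (hf₁.wvar 0 (by decide)).trans h0
  have h1' : s₁.wvar 1 = k := (hf₁.wvar 1 (by decide)).trans h1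
  have h3' : s₁.wvar 3 = a := (hf₁.wvar 3 (by decide)).trans h3
  have h4' : s₁.wvar 4 = b := (hf₁.wvar 4 (by decide)).trans h4
  rw [run_ite, run_skip]
  simp only [Test.eval, WExp.eval, h1', e2, e2k, not_le, not_lt, Test.time, WExp.time]
  constructor
  swap
  · intro hle
    refine ⟨by omega, fun i _ => by rw [hw1], ?_⟩
    rw [hw1, ← hA]
    refine ⟨hne, by omega, fun T _ _ => ?_⟩
    linarith [costOn_nonneg hE.isDist hE.nonneg (Finset.Ico a b) T]
  intro hlt
  rw [run_seq, run_setW, run_seq]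
  simp only [WExp.eval, h3', WExp.time]
  refine (run_forTo_const (hE.lt_modulus (by omega : b < _)) (fun i s' => s'.wvar 0 = n ∧
    s'.wvar 1 = k ∧ s'.wvar 3 = a ∧ s'.wvar 4 = b ∧ s'.warr 2 = s₁.warr 2 ∧
    s'.wvar 5 = s₁.wvar 5 ∧ s'.warr 1 = s.warr 1 ∧ a ≤ i ∧
    ∀ v ∈ Finset.Ico a i, Nearest d A v (s'.warr 3 v) (s'.warr 4 v)) (400 * k + 50)
    ?_ ?_ hab.le ?_ ?_).mono ?_
  · rintro i - s' ⟨-, -, -, h, -⟩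
    exact h
  · rintro i hi s' hx ⟨i0, i1, i3, i4, i2', i5, i1', hai, hnear⟩
    refine (run_scan hE i5 (i2' ▸ hL) (fun x hx => ?_) (by omega) hx
        (by omega)).frame.mono ?_
    · have := Finset.mem_Ico.1 (hAI hx)
      omega
    rintro t s'' ⟨⟨ht, p, q, hpq, j3, j4⟩, hf⟩
    refine ⟨by omega, (hf.wvar 6 (by decide)).trans hx, ?_⟩
    simp only [ne_eq, Nat.reduceEqDiff, not_false_eq_true, Function.update_of_ne, OfNat.zero_ne_ofNat,
      OfNat.one_ne_ofNat, hf.wvar 0 (by decide), hf.wvar 1 (by decide), hf.wvar 3 (by decide),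
      hf.wvar 4 (by decide), hf.wvar 5 (by decide), hf.warr 1 (by decide), hf.warr 2 (by decide),
      i0, i1, i3, i4, i5, i1', i2', true_and, j3, j4]
    refine ⟨by omega, fun v hv => ?_⟩
    rcases eq_or_ne v i with rfl | hne
    · simpa using hpq
    · rw [Function.update_of_ne hne, Function.update_of_ne hne]
      refine hnear v ?_
      simp only [Finset.mem_Ico] at hv ⊢
      omega
  · simp
  · simp [h0', h1', h3', h4', hw1]
  rintro t₂ s₂ ⟨ht₂, -, i0, i1, i3, i4, i2', i5, i1', -, hnear⟩
  -- The cost bound in the invariant is multiplied by `k`, so that each removal contributes exactly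
  -- one further `4 cost(T)`.
  refine (Run.while (fun T s' => ∃ X, BlockState n k d a b X s' ∧ 2 * k ≤ X.card ∧ X ⊆ A ∧
    (∀ i, i ∉ Finset.Ico a b → s'.warr 1 i = s.warr 1 i) ∧
    (∀ T : Finset ℕ, T.Nonempty → T.card ≤ k → costOn d w (Finset.Ico a b) X * k ≤
      costOn d w (Finset.Ico a b) A * k +
        ((A.card : ℝ) - X.card) * (4 * costOn d w (Finset.Ico a b) T)) ∧
    T = (X.card - 2 * k) * (2200 * (b - a) + 10) + 10)
    (Q := fun s' => (∀ i, i ∉ Finset.Ico a b → s'.warr 1 i = s.warr 1 i) ∧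
      (alive (s'.warr 1) a b).Nonempty ∧ (alive (s'.warr 1) a b).card ≤ 2 * k ∧
      ∀ T : Finset ℕ, T.Nonempty → T.card ≤ k →
        costOn d w (Finset.Ico a b) (alive (s'.warr 1) a b) ≤
          costOn d w (Finset.Ico a b) A + 8 * costOn d w (Finset.Ico a b) T) ?_
    _ s₂ ⟨A, ⟨i0, i1, i3, i4, by rwa [i2', i5], by rw [i1', hA], hnear⟩, by omega, subset_rfl,
      fun i _ => by rw [i1'], fun T _ _ => by simp, rfl⟩).mono ?_
  · rintro T s' ⟨X, hB, hX, hXA, hout, hcost, rfl⟩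
    have hr : s'.wvar 5 = X.card := hB.lists.2.symm
    simp only [Test.eval, WExp.eval, hB.k_eq, e2, e2k, not_le, not_lt, Test.time, WExp.time, hr]
    have hXc := Finset.card_le_card hXA
    rcases hX.lt_or_eq with h | h
    · left
      refine ⟨h, (run_removeCenter hE hab hbn hB h (by omega)).mono ?_⟩
      rintro t s'' ⟨ht, y, hy, hB', hout', hcost'⟩
      have hc : (X.erase y).card + 1 = X.card := Finset.card_erase_add_one hy
      refine ⟨_, ⟨X.erase y, hB', by omega, (Finset.erase_subset _ _).trans hXA,
        fun i hi => (hout' i hi).trans (hout i hi), fun T hT hTk => ?_, rfl⟩, ?_⟩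
      · have h₁ := hcost T hT hTk
        have h₂ := hcost' T hT hTk
        have h₃ : (X.card : ℝ) = (X.erase y).card + 1 := by exact_mod_cast hc.symm
        rw [h₃] at h₁
        linarith
      · obtain ⟨q, hq⟩ : ∃ q, X.card - 2 * k = q + 1 := ⟨X.card - 2 * k - 1, by omega⟩
        have hq' : (X.erase y).card - 2 * k = q := by omega
        rw [hq, hq', Nat.succ_mul q]
        omega
    · right
      refine ⟨by omega, by omega, hout, ?_⟩
      rw [← hB.alive]
      refine ⟨Finset.card_pos.1 (by omega), by omega, fun T hT hTk => ?_⟩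
      have h₁ := hcost T hT hTk
      have h₂ := costOn_nonneg hE.isDist hE.nonneg (Finset.Ico a b) T
      have h₃ : (A.card : ℝ) - X.card ≤ 2 * k := by
        rw [sub_le_iff_le_add, ← h]
        exact_mod_cast (by omega : A.card ≤ 2 * k + 2 * k)
      have h₄ : (0 : ℝ) < k := by exact_mod_cast hk
      have h₅ := mul_le_mul_of_nonneg_right h₃ (by linarith : 0 ≤ 4 * costOn d w (Finset.Ico a b) T)
      refine le_of_mul_le_mul_right ?_ h₄
      linarith
  · rintro t₃ s₃ ⟨ht₃, h⟩
    refine ⟨?_, h⟩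
    have h₁ : (A.card - 2 * k) * (2200 * (b - a) + 10) ≤ (2 * k) * (2200 * (b - a) + 10) :=
      Nat.mul_le_mul_right _ (by omega)
    have h₂ : (2 * k) * (2200 * (b - a) + 10) = 4400 * (k * (b - a)) + 20 * k := by ring
    have h₃ : (b - a) * (400 * k + 50 + ((WExp.var 4).time + 8)) =
        400 * (k * (b - a)) + 59 * (b - a) := by
      simp only [WExp.time]
      ring
    rw [h₃] at ht₂
    simp only [WExp.time] at ht₂
    omega

end

/-! ### Reverse greedy in blocks of doubling length -/

/-- Reduce the number of centers to at most `2 k` in all blocks of the length in word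
variable `2`. -/
def reduceBlocks : Prog :=
  .seq (.setW 3 (.lit 0)) (.while (.wordLt (.var 3) (.var 0))
    (.seq (.setW 4 (.add (.var 3) (.var 2)))
    (.seq (.ite (.wordLt (.var 0) (.var 4)) (.setW 4 (.var 0)) .skip)
    (.seq reduceBlock (.setW 3 (.var 4))))))

/-- Mark all but at most `2 k` points, by reducing the number of centers in blocks of
increasing lengths. -/
def reduceAll : Prog :=
  .seq (.setW 2 (.var 1)) (.while (.wordLt (.var 2) (.var 0))
    (.seq (.setW 2 (.mul (.lit 2) (.var 2))) reduceBlocks))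

/-- The unmarked points of the `q`-th block of length `B`. -/
def block (n : ℕ) (f : ℕ → ℕ) (B q : ℕ) : Finset ℕ := alive f (q * B) (min (q * B + B) n)

/-- The sum of the costs of all blocks of length `B`. -/
noncomputable def blockCost (d : ℕ → ℕ → ℝ) (w : ℕ → ℝ) (n : ℕ) (f : ℕ → ℕ) (B : ℕ) : ℝ :=
  ∑ v ∈ Finset.range n, w v * minDist d v (block n f B (v / B))

theorem mem_block {n : ℕ} {f : ℕ → ℕ} {B q i : ℕ} (hB : 0 < B) :
    i ∈ block n f B q ↔ i / B = q ∧ i < n ∧ f i = 0 := by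
  simp only [block, alive, Finset.mem_filter, Finset.mem_Ico, lt_min_iff,
    Nat.div_eq_iff hB, Nat.le_sub_one_iff_lt (show 0 < q * B + B by omega)]
  tauto

theorem block_two_mul {n : ℕ} {f : ℕ → ℕ} {B q : ℕ} (hB : 0 < B) :
    block n f (2 * B) q = block n f B (2 * q) ∪ block n f B (2 * q + 1) := by
  ext i
  rw [Finset.mem_union, mem_block hB, mem_block hB, mem_block (by omega), mul_comm 2 B,
    ← Nat.div_div_eq_div_mul]
  have : i / B / 2 = q ↔ i / B = 2 * q ∨ i / B = 2 * q + 1 := by omega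
  tauto

theorem block_eq_of_ne {n : ℕ} {f g : ℕ → ℕ} {B p q : ℕ} (hB : 0 < B) (hpq : q ≠ p)
    (h : ∀ i, i ∉ Finset.Ico (p * B) (min (p * B + B) n) → g i = f i) :
    block n g B q = block n f B q := by
  ext i
  rw [mem_block hB, mem_block hB]
  refine and_congr_right fun hi => and_congr_right fun _ => ?_
  rw [h i]
  rw [Finset.mem_Ico, lt_min_iff]
  rintro ⟨h₁, h₂, -⟩
  apply hpq
  rw [← hi, Nat.div_eq_iff hB]
  omega

/-- After merging, each point may use the centers of both halves. The halves must be nonempty, lest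
the default distance 0 make the old cost too small. -/
theorem blockCost_two_mul_le {d : ℕ → ℕ → ℝ} {w : ℕ → ℝ} (hw : ∀ v, 0 ≤ w v) {n : ℕ}
    {f : ℕ → ℕ} {B : ℕ} (hB : 0 < B) (hne : ∀ q, q * B < n → (block n f B q).Nonempty) :
    blockCost d w n f (2 * B) ≤ blockCost d w n f B := by
  refine Finset.sum_le_sum fun v hv => mul_le_mul_of_nonneg_left ?_ (hw v)
  refine minDist_anti (hne _ ((Nat.div_mul_le_self v B).trans_lt (Finset.mem_range.1 hv))) ?_
  intro i hi
  rw [mem_block hB] at hi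
  rw [mem_block (by omega), mul_comm 2 B, ← Nat.div_div_eq_div_mul, ← Nat.div_div_eq_div_mul, hi.1]
  exact ⟨rfl, hi.2⟩

/-- Points are served inside their own block, so changing the marks of one block affects only its
summands. -/
theorem blockCost_le_of_eq_off {d : ℕ → ℕ → ℝ} {w : ℕ → ℝ} {n : ℕ} {f g : ℕ → ℕ} {B p : ℕ}
    (hB : 0 < B) (h : ∀ i, i ∉ Finset.Ico (p * B) (min (p * B + B) n) → g i = f i) {c : ℝ}
    (hc : costOn d w (Finset.Ico (p * B) (min (p * B + B) n)) (block n g B p) ≤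
      costOn d w (Finset.Ico (p * B) (min (p * B + B) n)) (block n f B p) + c) :
    blockCost d w n g B ≤ blockCost d w n f B + c := by
  set I := Finset.Ico (p * B) (min (p * B + B) n) with hI
  have hIn : I ⊆ Finset.range n := fun i hi => by
    rw [hI, Finset.mem_Ico, lt_min_iff] at hi
    exact Finset.mem_range.2 hi.2.2
  have hdiv : ∀ v ∈ Finset.range n, v ∈ I ↔ v / B = p := fun v hv => by
    rw [hI, Finset.mem_Ico, lt_min_iff, Nat.div_eq_iff hB]
    have := Finset.mem_range.1 hv
    omega
  have key : ∀ f', ∑ v ∈ I, w v * minDist d v (block n f' B (v / B)) =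
      costOn d w I (block n f' B p) := fun f' => Finset.sum_congr rfl fun v hv => by
    rw [(hdiv v (hIn hv)).1 hv]
  unfold blockCost
  rw [← Finset.sum_sdiff hIn, ← Finset.sum_sdiff hIn, key, key]
  have : ∑ v ∈ Finset.range n \ I, w v * minDist d v (block n g B (v / B)) =
      ∑ v ∈ Finset.range n \ I, w v * minDist d v (block n f B (v / B)) :=
    Finset.sum_congr rfl fun v hv => by
      obtain ⟨h₁, h₂⟩ := Finset.mem_sdiff.1 hv
      rw [block_eq_of_ne hB (fun e => h₂ ((hdiv v h₁).2 e)) h]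
  linarith

/-- Every block of length `B` has at least one and at most `c` unmarked points. -/
structure GoodBlocks (n : ℕ) (f : ℕ → ℕ) (B c : ℕ) : Prop where
  nonempty (q : ℕ) (hq : q * B < n) : (block n f B q).Nonempty
  card (q : ℕ) : (block n f B q).card ≤ c

theorem GoodBlocks.two_mul {n : ℕ} {f : ℕ → ℕ} {B c : ℕ} (h : GoodBlocks n f B c) (hB : 0 < B) :
    GoodBlocks n f (2 * B) (2 * c) := by
  constructor
  · intro q hq
    rw [block_two_mul hB]
    exact (h.nonempty (2 * q) (by linarith)).mono Finset.subset_union_left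
  · intro q
    rw [block_two_mul hB]
    refine (Finset.card_union_le _ _).trans ?_
    have := h.card (2 * q)
    have := h.card (2 * q + 1)
    omega

section

variable {E : Env} {n k : ℕ} {d : ℕ → ℕ → ℝ} {w : ℕ → ℝ} {s : State}

/-- The comparison set `T` is the same for all blocks and need not lie in them, so the increases `8
cost(T)` on the blocks add up to `8 cost(T)` on the whole range. -/
theorem run_reduceBlocks (hE : Instance E n k d w) {B : ℕ} (hB : 0 < B) (hBn : B ≤ 2 * n)
    (h0 : s.wvar 0 = n) (h1 : s.wvar 1 = k) (h2 : s.wvar 2 = B)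
    (hG : GoodBlocks n (s.warr 1) B (4 * k)) :
    Run E reduceBlocks s fun t s' => t ≤ 6050 * (n * k) ∧ GoodBlocks n (s'.warr 1) B (2 * k) ∧
      ∀ T : Finset ℕ, T.Nonempty → T.card ≤ k → blockCost d w n (s'.warr 1) B ≤
        blockCost d w n (s.warr 1) B + 8 * costOn d w (Finset.range n) T := by
  have hk := hE.one_le
  have hkn := hE.le
  simp only [reduceBlocks, run_seq, run_setW, WExp.eval, Nat.zero_mod, WExp.time]
  refine (Run.while (fun T s' => ∃ j, s'.wvar 0 = n ∧ s'.wvar 1 = k ∧ s'.wvar 2 = B ∧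
    s'.wvar 3 = min (j * B) n ∧ GoodBlocks n (s'.warr 1) B (4 * k) ∧
    (∀ q < j, (block n (s'.warr 1) B q).card ≤ 2 * k) ∧
    (∀ T : Finset ℕ, T.Nonempty → T.card ≤ k → blockCost d w n (s'.warr 1) B ≤
        blockCost d w n (s.warr 1) B + 8 * costOn d w (Finset.range (min (j * B) n)) T) ∧
    T = (n - min (j * B) n) * (6030 * k) + 5)
    (Q := fun s' => GoodBlocks n (s'.warr 1) B (2 * k) ∧
      ∀ T : Finset ℕ, T.Nonempty → T.card ≤ k → blockCost d w n (s'.warr 1) B ≤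
        blockCost d w n (s.warr 1) B + 8 * costOn d w (Finset.range n) T) ?_
    (n * (6030 * k) + 5) _ ⟨0, ?_⟩).mono ?_
  · rintro _ s' ⟨j, i0, i1, i2', i3, hG, hlt, hcost, rfl⟩
    simp only [Test.eval, WExp.eval, i0, i3, not_le, Test.time, WExp.time]
    rcases lt_or_ge (j * B) n with h | h
    · left
      rw [min_eq_left h.le]
      refine ⟨h, ?_⟩
      set b := min (j * B + B) n with hb
      have hab : j * B < b := by omega
      -- The end of the block, before truncation at `n`, is less than `3 n`.
      have em : (j * B + B) % E.modulus = j * B + B := hE.mod_eq (by omega)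
      have hset : Run E (.ite (.wordLt (.var 0) (.var 4)) (.setW 4 (.var 0)) .skip)
          { s' with wvar := Function.update s'.wvar 4 (j * B + B) } fun t s'' => t ≤ 7 ∧
            s'' = { s' with wvar := Function.update s'.wvar 4 b } := by
        simp only [run_ite, run_setW, run_skip, Test.eval, WExp.eval, Test.time, WExp.time, i0,
          Function.update_self, ne_eq, OfNat.zero_ne_ofNat, not_false_eq_true,
          Function.update_of_ne, not_le, not_lt, Function.update_idem]
        refine ⟨fun h' => ⟨by omega, ?_⟩, fun h' => ⟨by omega, ?_⟩⟩
        · rw [hb, min_eq_right h'.le]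
        · rw [hb, min_eq_left h']
      rw [run_seq, run_setW]
      simp only [WExp.eval, i3, i2', min_eq_left h.le, em, WExp.time]
      refine Run.seq hset ?_
      rintro t₁ s₁ ⟨ht₁, rfl⟩
      refine Run.seq (run_reduceBlock (s := { s' with wvar := Function.update s'.wvar 4 b }) hE hab
        (min_le_right _ _) (A := block n (s'.warr 1) B j)
        (by simpa using i0) (by simpa using i1) (by simpa [h.le] using i3) (by simp) rfl
        (hG.nonempty j h) (hG.card j)).frame ?_
      rintro t₂ s₂ ⟨⟨ht₂, hoff, hne, hcard, hc⟩, hf⟩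
      dsimp only at hoff hc
      rw [run_setW]
      have i4 : s₂.wvar 4 = b := by
        rw [hf.wvar 4 (by decide)]
        simp
      have hb' : min ((j + 1) * B) n = b := by rw [hb, Nat.succ_mul]
      have hoff' := fun q (hq : q ≠ j) => block_eq_of_ne hB hq hoff
      have hj : block n (s₂.warr 1) B j = alive (s₂.warr 1) (j * B) b := rfl
      refine ⟨_, ⟨j + 1, ?_, ?_, ?_, ?_, ⟨fun q hq => ?_, fun q => ?_⟩, fun q hq => ?_,
        fun T hT hTk => ?_, rfl⟩, ?_⟩
      · simp [hf.wvar 0 (by decide), i0]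
      · simp [hf.wvar 1 (by decide), i1]
      · simp [hf.wvar 2 (by decide), i2']
      · simp [WExp.eval, i4, hb']
      · rcases eq_or_ne q j with rfl | hqj
        · exact hne
        · rw [hoff' q hqj]
          exact hG.nonempty q hq
      · rcases eq_or_ne q j with rfl | hqj
        · exact (hj ▸ hcard).trans (by omega)
        · rw [hoff' q hqj]
          exact hG.card q
      · rcases eq_or_ne q j with rfl | hqj
        · exact hcard
        · rw [hoff' q hqj]
          exact hlt q (by omega)
      · have h₁ := blockCost_le_of_eq_off hB hoff (hc T hT hTk)
        have h₂ := hcost T hT hTk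
        have h₃ : costOn d w (Finset.range b) T = costOn d w (Finset.range (j * B)) T +
            costOn d w (Finset.Ico (j * B) b) T := by
          unfold costOn
          rw [Finset.range_eq_Ico, Finset.range_eq_Ico,
            Finset.sum_Ico_consecutive _ (Nat.zero_le _) hab.le]
        rw [min_eq_left h.le] at h₂
        rw [hb', h₃]
        linarith
      · rw [hb']
        obtain ⟨m, hm⟩ : ∃ m, b = j * B + m := ⟨b - j * B, by omega⟩
        obtain ⟨m', hm'⟩ : ∃ m', n = b + m' := ⟨n - b, by omega⟩
        have e1 : b - j * B = m := by omega
        have e2 : n - b = m' := by omega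
        have e3 : n - j * B = m + m' := by omega
        have hmk : 1 ≤ m * k := Nat.mul_pos (by omega) hk
        have e4 : 6000 * k * m = 6000 * (m * k) := by ring
        have e5 : (m + m') * (6030 * k) = 6030 * (m * k) + m' * (6030 * k) := by ring
        rw [e1] at ht₂
        rw [e2, e3, e5]
        simp only [WExp.time]
        omega
    · right
      rw [min_eq_right h]
      refine ⟨by omega, by omega, ⟨hG.nonempty, fun q => ?_⟩, fun T hT hTk => ?_⟩
      · rcases lt_or_ge q j with hq | hq
        · exact hlt q hq
        · have : block n (s'.warr 1) B q = ∅ := by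
            rw [Finset.eq_empty_iff_forall_notMem]
            intro i hi
            rw [mem_block hB] at hi
            have h₁ := Nat.div_mul_le_self i B
            have h₂ := Nat.mul_le_mul_right B hq
            rw [hi.1] at h₁
            omega
          simp [this]
      · have := hcost T hT hTk
        rwa [min_eq_right h] at this
  · refine ⟨by simpa using h0, by simpa using h1, by simpa using h2, by simp, hG,
      fun q hq => absurd hq (Nat.not_lt_zero q), fun T hT hTk => ?_, by simp⟩
    simp [costOn]
  · rintro t s' ⟨ht, h⟩
    refine ⟨?_, h⟩
    have h₁ : n * (6030 * k) = 6030 * (n * k) := by ring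
    have h₂ : 1 ≤ n * k := Nat.mul_pos (by omega) hk
    omega

/-- At block length `k` every point is its own center, at cost 0. Each doubling adds at most `8
cost(T)`, and after at most `L` doublings one block contains everything. -/
theorem run_reduceAll (hE : Instance E n k d w) (h0 : s.wvar 0 = n) (h1 : s.wvar 1 = k)
    (hf : ∀ i, s.warr 1 i = 0) {L : ℕ} (hL : n ≤ 2 ^ L * k) :
    Run E reduceAll s fun t s' => t ≤ 6100 * (L + 1) * (n * k) ∧
      (alive (s'.warr 1) 0 n).Nonempty ∧ (alive (s'.warr 1) 0 n).card ≤ 2 * k ∧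
      ∀ T : Finset ℕ, T.Nonempty → T.card ≤ k →
        costOn d w (Finset.range n) (alive (s'.warr 1) 0 n) ≤
          8 * L * costOn d w (Finset.range n) T := by
  have hk := hE.one_le
  have hkn := hE.le
  simp only [reduceAll, run_seq, run_setW, WExp.eval, WExp.time, h1]
  refine (Run.while (fun T s' => ∃ l ≤ L, s'.wvar 0 = n ∧ s'.wvar 1 = k ∧
    s'.wvar 2 = 2 ^ l * k ∧ GoodBlocks n (s'.warr 1) (2 ^ l * k) (2 * k) ∧
    (∀ T : Finset ℕ, T.Nonempty → T.card ≤ k → blockCost d w n (s'.warr 1) (2 ^ l * k) ≤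
        8 * l * costOn d w (Finset.range n) T) ∧
    T = (L - l) * (6080 * (n * k)) + 5)
    (Q := fun s' => (alive (s'.warr 1) 0 n).Nonempty ∧ (alive (s'.warr 1) 0 n).card ≤ 2 * k ∧
      ∀ T : Finset ℕ, T.Nonempty → T.card ≤ k →
        costOn d w (Finset.range n) (alive (s'.warr 1) 0 n) ≤
          8 * L * costOn d w (Finset.range n) T) ?_
    (L * (6080 * (n * k)) + 5) _ ⟨0, Nat.zero_le L, ?_⟩).mono ?_
  · rintro _ s' ⟨l, hl, i0, i1, i2', hG, hcost, rfl⟩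
    simp only [Test.eval, WExp.eval, i0, i2', not_le, Test.time, WExp.time]
    rcases lt_or_ge (2 ^ l * k) n with h | h
    · left
      refine ⟨h, ?_⟩
      have hpos : 0 < 2 ^ l * k := Nat.mul_pos (by positivity) hk
      have e2 : 2 % E.modulus = 2 := hE.mod_eq (by omega)
      have em : 2 * (2 ^ l * k) % E.modulus = 2 * (2 ^ l * k) := hE.mod_eq (by omega)
      have hlL : l < L := by
        by_contra h'
        have : l = L := by omega
        rw [this] at h
        omega
      rw [run_seq, run_setW]
      simp only [WExp.eval, WExp.time, i2', e2, em]
      refine (run_reduceBlocks hE (B := 2 * (2 ^ l * k)) (by omega) (by omega) (by simpa using i0)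
        (by simpa using i1) (by simp) ?_).frame.mono ?_
      · have := hG.two_mul hpos
        rwa [← mul_assoc 2 2 k] at this
      rintro t s'' ⟨⟨ht, hG', hcost'⟩, hf'⟩
      have epow : 2 ^ (l + 1) * k = 2 * (2 ^ l * k) := by ring
      refine ⟨_, ⟨l + 1, hlL, ?_, ?_, ?_, by rwa [epow], fun T hT hTk => ?_, rfl⟩, ?_⟩
      · rw [hf'.wvar 0 (by decide)]
        simpa using i0
      · rw [hf'.wvar 1 (by decide)]
        simpa using i1
      · rw [hf'.wvar 2 (by decide), epow]
        simp
      · have h₁ := hcost' T hT hTk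
        have h₂ := blockCost_two_mul_le (d := d) hE.nonneg hpos hG.nonempty
        have h₃ := hcost T hT hTk
        rw [epow]
        push_cast
        linarith
      · obtain ⟨q, hq⟩ : ∃ q, L = l + 1 + q := ⟨L - (l + 1), by omega⟩
        have e3 : L - (l + 1) = q := by omega
        have e4 : L - l = q + 1 := by omega
        have hnk : 1 ≤ n * k := Nat.mul_pos (by omega) hk
        rw [e3, e4, Nat.succ_mul q]
        omega
    · right
      have hpos : 0 < 2 ^ l * k := Nat.mul_pos (by positivity) hk
      have hb : block n (s'.warr 1) (2 ^ l * k) 0 = alive (s'.warr 1) 0 n := by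
        rw [block, zero_mul, zero_add, min_eq_right h]
      refine ⟨by omega, by omega, ?_, ?_, fun T hT hTk => ?_⟩
      · rw [← hb]
        exact hG.nonempty 0 (by omega)
      · rw [← hb]
        exact hG.card 0
      · have h₁ : blockCost d w n (s'.warr 1) (2 ^ l * k) =
            costOn d w (Finset.range n) (alive (s'.warr 1) 0 n) := by
          refine Finset.sum_congr rfl fun v hv => ?_
          rw [Nat.div_eq_of_lt ((Finset.mem_range.1 hv).trans_le h), hb]
        rw [← h₁]
        refine (hcost T hT hTk).trans (mul_le_mul_of_nonneg_right ?_
          (costOn_nonneg hE.isDist hE.nonneg _ _))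
        have : (l : ℝ) ≤ L := by exact_mod_cast hl
        linarith
  · simp only [pow_zero, one_mul, ne_eq, OfNat.zero_ne_ofNat, not_false_eq_true,
      Function.update_of_ne, OfNat.one_ne_ofNat, Function.update_self, h0, h1, true_and,
      Nat.sub_zero, and_true]
    refine ⟨⟨fun q hq => ⟨q * k, ?_⟩, fun q => ?_⟩, fun T hT hTk => ?_⟩
    · rw [mem_block hk]
      exact ⟨Nat.mul_div_cancel _ hk, hq, hf _⟩
    · refine (Finset.card_filter_le _ _).trans ?_
      rw [Nat.card_Ico]
      omega
    · rw [Nat.cast_zero, mul_zero, zero_mul]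
      refine Finset.sum_nonpos fun v hv => ?_
      have : minDist d v (block n (s.warr 1) k (v / k)) ≤ d v v :=
        minDist_le ((mem_block hk).2 ⟨rfl, Finset.mem_range.1 hv, hf v⟩)
      rw [hE.isDist.self] at this
      exact mul_nonpos_of_nonneg_of_nonpos (hE.nonneg v) this
  · rintro t s' ⟨ht, h⟩
    refine ⟨?_, h⟩
    have h₁ : 6100 * (L + 1) * (n * k) = L * (6100 * (n * k)) + 6100 * (n * k) := by ring
    have h₂ : L * (6080 * (n * k)) ≤ L * (6100 * (n * k)) :=
      Nat.mul_le_mul_left _ (Nat.mul_le_mul_right _ (by norm_num))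
    have h₃ : 1 ≤ n * k := Nat.mul_pos (by omega) hk
    omega

end

/-! ### Greedy choice of centers -/

/-- Compute the value of the ball of radius `e` around the point listed at the position in word
variable `20`. -/
def computeValue (e : RExp) : Prog :=
  .seq (.setR 11 (.lit 0)) (.seq (.setW 23 (.lit 0)) (forTo 23 (.var 0)
    (.seq (.setR 12 (.sub e (.dist (.get 2 (.var 20)) (.var 23))))
      (.ite (.realLe (.lit 0) (.var 12))
        (.setR 11 (.add (.var 11) (.mul (.weight (.var 23)) (.var 12)))) .skip))))

/-- Find the value of the ball of radius `e`, which is the `l`-th radius of the table, around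
the point listed at the position in word variable `20`. -/
def lookupValue (l : WExp) (e : RExp) : Prog :=
  .ite (.wordLe (.lit 1) (.var 9)) (.setR 11 (.get 1 (.add (.mul (.var 20) (.var 0)) l)))
    (computeValue e)

/-- Compute a table of values for the radii `rmax / 4 ^ l`, as long as they are not negligible
and `l < n`. Word variable `9` tells whether the table contains all the radii. -/
def fillTable : Prog :=
  .seq (.setW 8 (.lit 0)) (.seq (.setR 2 (.var 0)) (.seq
    (.while (.and (.realLe (.var 1) (.mul (.lit 128) (.var 2))) (.wordLt (.var 8) (.var 0)))
      (.seq (.setW 20 (.lit 0)) (.seq (forTo 20 (.var 5) (.seq (computeValue (.var 2))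
          (.putR 1 (.add (.mul (.var 20) (.var 0)) (.var 8)) (.var 11))))
        (.seq (.setR 2 (.div (.var 2) (.lit 4))) (.setW 8 (.add (.var 8) (.lit 1)))))))
    (.ite (.realLe (.var 1) (.mul (.lit 128) (.var 2))) (.setW 9 (.lit 0)) (.setW 9 (.lit 1)))))

/-- The distance between the points listed at the positions in word variables `6` and `7`. -/
def pairDist : RExp := .dist (.get 2 (.var 6)) (.get 2 (.var 7))

/-- A loop over all pairs of positions of the list. -/
def forPairs (p : Prog) : Prog :=
  .seq (.setW 6 (.lit 0)) (forTo 6 (.var 5) (.seq (.setW 7 (.lit 0)) (forTo 7 (.var 5) p)))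

/-- Put the maximum distance and the minimum nonzero distance between listed points in real
variables `0` and `1`. -/
def findScale : Prog :=
  .seq (.setR 0 (.lit 0)) (.seq
    (forPairs (.ite (.realLe (.var 0) pairDist) (.setR 0 pairDist) .skip))
    (.seq (.ite (.realLe (.var 0) (.lit 0)) (.setR 0 (.lit 1)) .skip)
    (.seq (.setR 1 (.var 0)) (forPairs (.ite
      (.and (.realLt (.lit 0) pairDist) (.realLe pairDist (.var 1))) (.setR 1 pairDist) .skip)))))

/-- The numbers `rmax` and `rmin` bound the nonzero distances in `X`, tightly unless they
are equal. -/
structure IsScale (d : ℕ → ℕ → ℝ) (X : Finset ℕ) (rmax rmin : ℝ) : Prop where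
  pos : 0 < rmin
  le : rmin ≤ rmax
  dist_le : ∀ x ∈ X, ∀ y ∈ X, d x y ≤ rmax
  le_dist : ∀ x ∈ X, ∀ y ∈ X, 0 < d x y → rmin ≤ d x y
  tight : rmin = rmax ∨ (∃ x ∈ X, ∃ y ∈ X, rmax = d x y) ∧ ∃ x ∈ X, ∃ y ∈ X, rmin = d x y

/-- A table of values has been computed, or the number `L` of relevant radii exceeds `n`. -/
structure HasTable (n : ℕ) (d : ℕ → ℕ → ℝ) (w : ℕ → ℝ) (X : Finset ℕ) (rmax rmin : ℝ) (L : ℕ)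
    (s : State) : Prop where
  n_eq : s.wvar 0 = n
  card_eq : s.wvar 5 = X.card
  lists : Lists (s.warr 2) X.card X
  rmin_eq : s.rvar 1 = rmin
  table : (s.wvar 9 = 1 ∧ ∀ l, rmin ≤ 128 * (rmax / 4 ^ l) → l < n ∧ ∀ a < X.card,
    s.rarr 1 (a * n + l) = ballValue d w (Finset.range n) (s.warr 2 a) (rmax / 4 ^ l)) ∨
    (s.wvar 9 = 0 ∧ n < L)

section

variable {E : Env} {n k : ℕ} {d : ℕ → ℕ → ℝ} {w : ℕ → ℝ} {s : State} {X : Finset ℕ}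

/-- The invariant is indexed by the set of pairs already visited. By `hI` it ignores word variables,
so changes of the loop counters preserve it. -/
theorem run_forPairs (hE : Instance E n k d w) {r : ℕ} (hr : r ≤ n) {p : Prog} {c : ℕ}
    (hp5 : 5 ∉ p.wvars) (hp6 : 6 ∉ p.wvars) (hp7 : 7 ∉ p.wvars) (I : (ℕ → ℕ → Prop) → State → Prop)
    (hI : ∀ D s s', s'.rvar = s.rvar → s'.warr = s.warr → s'.rarr = s.rarr → I D s → I D s')
    (hp : ∀ D s, s.wvar 6 < r → s.wvar 7 < r → I D s → Run E p s fun t s' => t ≤ c ∧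
      I (fun i j => D i j ∨ (i = s.wvar 6 ∧ j = s.wvar 7)) s')
    (h5 : s.wvar 5 = r) (hs : I (fun _ _ => False) s) :
    Run E (forPairs p) s fun t s' => t ≤ r * (r * (c + 9) + 30) + 10 ∧
      I (fun i j => i < r ∧ j < r) s' := by
  have hrM : r < E.modulus := hE.lt_modulus (by omega)
  simp only [forPairs, run_seq, run_setW, WExp.eval, Nat.zero_mod, WExp.time]
  refine (run_forTo_const hrM (fun i s' => s'.wvar 5 = r ∧ I (fun i' j' => i' < i ∧ j' < r) s')
    (r * (c + 9) + 10) ?_ ?_ (Nat.zero_le r) ?_ ⟨?_, ?_⟩).mono ?_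
  · rintro i - s' ⟨h, -⟩
    exact h
  · rintro i hi s' hx ⟨h5', hI'⟩
    rw [run_seq, run_setW]
    simp only [WExp.eval, Nat.zero_mod, WExp.time]
    refine (run_forTo_const hrM (fun j s'' => s''.wvar 5 = r ∧ s''.wvar 6 = i ∧
      I (fun i' j' => (i' < i ∧ j' < r) ∨ (i' = i ∧ j' < j)) s'') c ?_ ?_ (Nat.zero_le r) ?_
      ⟨?_, ?_, ?_⟩).mono ?_
    · rintro j - s'' ⟨h, -⟩
      exact h
    · rintro j hj s'' hx'' ⟨h5'', h6'', hI''⟩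
      refine (hp _ s'' (by omega) (by omega) hI'').frame.mono ?_
      rintro t s₃ ⟨⟨ht, hI₃⟩, hf⟩
      refine ⟨ht, (hf.wvar 7 hp7).trans hx'', ?_, ?_, ?_⟩
      · simpa [hf.wvar 5 hp5] using h5''
      · simpa [hf.wvar 6 hp6] using h6''
      · rw [h6'', hx''] at hI₃
        refine hI _ s₃ _ rfl rfl rfl ?_
        convert hI₃ using 3 with i' j'
        omega
    · simp
    · simpa using h5'
    · simpa using hx
    · refine hI _ s' _ rfl rfl rfl ?_
      simpa using hI'
    · rintro t s₃ ⟨ht, -, h5₃, h6₃, hI₃⟩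
      refine ⟨?_, h6₃, by simpa using h5₃, hI _ s₃ _ rfl rfl rfl ?_⟩
      · simp only [WExp.time, Nat.sub_zero, Nat.reduceAdd] at ht
        omega
      · convert hI₃ using 3 with i' j'
        omega
  · simp
  · simpa using h5
  · refine hI _ s _ rfl rfl rfl ?_
    simpa using hs
  · rintro t s' ⟨ht, -, -, h⟩
    refine ⟨?_, h⟩
    have h₁ : r * (r * (c + 9) + 10 + ((WExp.var 5).time + 8)) ≤ r * (r * (c + 9) + 30) :=
      Nat.mul_le_mul_left _ (by simp only [WExp.time]; omega)
    simp only [WExp.time, Nat.sub_zero] at ht h₁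
    omega

theorem run_findScale (hE : Instance E n k d w) (hX : Lists (s.warr 2) X.card X)
    (hXn : ∀ x ∈ X, x < n) (h5 : s.wvar 5 = X.card) :
    Run E findScale s fun t s' => t ≤ 200 * (X.card * X.card) + 200 ∧
      IsScale d X (s'.rvar 0) (s'.rvar 1) := by
  have hr : X.card ≤ n := by
    simpa using Finset.card_le_card (show X ⊆ Finset.range n from
      fun x hx => Finset.mem_range.2 (hXn x hx))
  have hd : ∀ s' : State, s'.warr 2 = s.warr 2 → s'.wvar 6 < X.card → s'.wvar 7 < X.card →
      pairDist.eval E s' = d (s.warr 2 (s'.wvar 6)) (s.warr 2 (s'.wvar 7)) := by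
    intro s' h h6 h7
    simp only [pairDist, RExp.eval, WExp.eval, h]
    exact hE.dist _ (hXn _ (hX.mem h6)) _ (hXn _ (hX.mem h7))
  rw [findScale, run_seq, run_setR]
  refine Run.seq (run_forPairs hE hr (c := 20) ?_ ?_ ?_
    (I := fun D s' => s'.warr 2 = s.warr 2 ∧
      (∀ i < X.card, ∀ j < X.card, D i j → d (s.warr 2 i) (s.warr 2 j) ≤ s'.rvar 0) ∧
      0 ≤ s'.rvar 0 ∧ (s'.rvar 0 = 0 ∨ ∃ x ∈ X, ∃ y ∈ X, s'.rvar 0 = d x y)) ?_ ?_ (by exact h5) ?_).frame ?_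
  · decide
  · decide
  · decide
  · rintro D s₁ s₂ e1 e2 - h
    rwa [e1, e2]
  · rintro D s' h6 h7 ⟨hw, hD, h0, hor⟩
    simp only [run_ite, run_setR, run_skip, Test.eval, hd s' hw h6 h7]
    simp only [RExp.eval, Function.update_self, not_le]
    refine ⟨fun h => ⟨by simp [Test.time, RExp.time, WExp.time, pairDist], hw, ?_,
      hE.isDist.nonneg _ _, Or.inr ⟨_, hX.mem h6, _, hX.mem h7, rfl⟩⟩,
      fun h => ⟨by simp [Test.time, RExp.time, WExp.time, pairDist], hw, ?_, h0, hor⟩⟩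
    · rintro i hi j hj (h' | ⟨rfl, rfl⟩)
      · exact (hD i hi j hj h').trans h
      · exact le_rfl
    · rintro i hi j hj (h' | ⟨rfl, rfl⟩)
      · exact hD i hi j hj h'
      · exact h.le
  · simp [RExp.eval]
  rintro t₁ s₁ ⟨⟨ht₁, hw₁, hD₁, h0, hor⟩, hf₁⟩
  have h5₁ : s₁.wvar 5 = X.card := (hf₁.wvar 5 (by decide)).trans h5
  have hmax : ∀ x ∈ X, ∀ y ∈ X, d x y ≤ s₁.rvar 0 := by
    intro x hx y hy
    obtain ⟨i, hi, rfl⟩ := hX.exists_eq hx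
    obtain ⟨j, hj, rfl⟩ := hX.exists_eq hy
    exact hD₁ i hi j hj ⟨hi, hj⟩
  -- If all listed distances vanish, the maximum is replaced by 1 to keep the scale positive. The
  -- minimum then stays equal to it, which is the degenerate case of `IsScale`.
  have hset : Run E (.ite (.realLe (.var 0) (.lit 0)) (.setR 0 (.lit 1)) .skip) s₁
      fun t s' => t ≤ 10 ∧ s'.warr 2 = s.warr 2 ∧ s'.wvar 5 = X.card ∧ 0 < s'.rvar 0 ∧
        (∀ x ∈ X, ∀ y ∈ X, d x y ≤ s'.rvar 0) ∧
        ((∀ x ∈ X, ∀ y ∈ X, d x y ≤ 0) ∨ ∃ x ∈ X, ∃ y ∈ X, s'.rvar 0 = d x y) := by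
    simp only [run_ite, run_setR, run_skip, Test.eval, RExp.eval, Test.time, RExp.time,
      Nat.cast_zero, Nat.cast_one, Function.update_self, not_le]
    refine ⟨fun h => ⟨by omega, hw₁, h5₁, one_pos, fun x hx y hy => ?_, Or.inl fun x hx y hy => ?_⟩,
      fun h => ⟨by omega, hw₁, h5₁, h, hmax, Or.inr (hor.resolve_left h.ne')⟩⟩
    · linarith [hmax x hx y hy]
    · exact (hmax x hx y hy).trans h
  refine Run.seq hset ?_
  rintro t₂ s₂ ⟨ht₂, hw₂, h5₂, hpos, hmax₂, hor₂⟩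
  rw [run_seq, run_setR]
  refine (run_forPairs hE hr (c := 30) ?_ ?_ ?_
    (I := fun D s' => s'.warr 2 = s.warr 2 ∧ s'.rvar 0 = s₂.rvar 0 ∧
      (∀ i < X.card, ∀ j < X.card, D i j → 0 < d (s.warr 2 i) (s.warr 2 j) →
        s'.rvar 1 ≤ d (s.warr 2 i) (s.warr 2 j)) ∧
      0 < s'.rvar 1 ∧ s'.rvar 1 ≤ s₂.rvar 0 ∧
      (s'.rvar 1 = s₂.rvar 0 ∨ ∃ x ∈ X, ∃ y ∈ X, s'.rvar 1 = d x y)) ?_ ?_ (by exact h5₂) ?_).mono ?_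
  · decide
  · decide
  · decide
  · rintro D s₁ s₂ e1 e2 - h
    rwa [e1, e2]
  · rintro D s' h6 h7 ⟨hw, e0, hD, h0, hle, hor⟩
    simp only [run_ite, run_setR, run_skip, Test.eval, hd s' hw h6 h7]
    simp only [RExp.eval, Function.update_self, Nat.cast_zero, not_le, ne_eq, zero_ne_one,
      not_false_eq_true, Function.update_of_ne]
    refine ⟨fun h => ⟨by simp [Test.time, RExp.time, WExp.time, pairDist], hw, e0, ?_, h.1,
      h.2.trans hle, Or.inr ⟨_, hX.mem h6, _, hX.mem h7, rfl⟩⟩,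
      fun h => ⟨by simp [Test.time, RExp.time, WExp.time, pairDist], hw, e0, ?_, h0, hle, hor⟩⟩
    · rintro i hi j hj (h' | ⟨rfl, rfl⟩) hp
      · exact h.2.trans (hD i hi j hj h' hp)
      · exact le_rfl
    · rintro i hi j hj (h' | ⟨rfl, rfl⟩) hp
      · exact hD i hi j hj h' hp
      · exact (not_le.1 fun h' => h ⟨hp, h'⟩).le
  · simp [RExp.eval, hw₂, hpos]
  rintro t₃ s₃ ⟨ht₃, hw₃, e0, hD₃, hp₃, hle₃, hor₃⟩
  refine ⟨?_, hp₃, by rwa [e0], by rwa [e0], fun x hx y hy hxy => ?_, ?_⟩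
  · simp only [RExp.time]
    have : X.card ≤ X.card * X.card := Nat.le_mul_self _
    have e1 : X.card * (X.card * (20 + 9) + 30) = 29 * (X.card * X.card) + 30 * X.card := by ring
    have e2 : X.card * (X.card * (30 + 9) + 30) = 39 * (X.card * X.card) + 30 * X.card := by ring
    omega
  · obtain ⟨i, hi, rfl⟩ := hX.exists_eq hx
    obtain ⟨j, hj, rfl⟩ := hX.exists_eq hy
    exact hD₃ i hi j hj ⟨hi, hj⟩ hxy
  · rw [e0]
    rcases hor₃ with h | ⟨x, hx, y, hy, h⟩
    · exact Or.inl h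
    · rcases hor₂ with h' | h'
      · have := h' x hx y hy
        linarith
      · exact Or.inr ⟨h', x, hx, y, hy, h⟩

theorem run_computeValue (hE : Instance E n k d w) (h0 : s.wvar 0 = n) {x : ℕ}
    (hx : s.warr 2 (s.wvar 20) = x) (hxn : x < n) {e : RExp} {r : ℝ}
    (he : ∀ s', Same s s' → s'.wvar 20 = s.wvar 20 → e.eval E s' = r) :
    Run E (computeValue e) s fun t s' => t ≤ n * (e.time + 40) + 20 ∧ Same s s' ∧
      s'.wvar 20 = s.wvar 20 ∧ s'.wvar 21 = s.wvar 21 ∧ s'.wvar 22 = s.wvar 22 ∧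
      s'.rvar 10 = s.rvar 10 ∧ s'.rvar 11 = ballValue d w (Finset.range n) x r := by
  simp only [computeValue, run_seq, run_setW, run_setR, WExp.eval, RExp.eval, Nat.zero_mod,
    WExp.time, RExp.time, Nat.cast_zero]
  refine (run_forTo_const (hE.lt_modulus (by omega : n < _)) (fun i s' => Same s s' ∧
    s'.wvar 20 = s.wvar 20 ∧ s'.wvar 21 = s.wvar 21 ∧ s'.wvar 22 = s.wvar 22 ∧
    s'.rvar 10 = s.rvar 10 ∧ s'.rvar 11 = ballValue d w (Finset.range i) x r)
    (e.time + 25) ?_ ?_ (Nat.zero_le n) ?_ ?_).mono ?_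
  · rintro i - s' ⟨h, -⟩
    exact (h.wvar 0 (by decide)).trans h0
  · rintro i hi s' hi' ⟨hS, h20, h21, h22, h10, h11⟩
    have hd : E.dist (s'.warr 2 (s.wvar 20)) i = d x i := by
      rw [hS.warr, hx, hE.dist x hxn i hi]
    simp only [run_seq, run_setR, run_ite, run_skip, RExp.eval, WExp.eval, Test.eval, hd,
      he s' hS h20, Function.update_self, Nat.cast_zero, ne_eq, Nat.reduceEqDiff,
      not_false_eq_true, Function.update_of_ne, hi', h11, hE.weight i hi, h20, h21, h22, h10,
      Test.time, RExp.time, WExp.time, not_le, true_and, ballValue,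
      Finset.sum_range_succ]
    refine ⟨fun h => ⟨by omega, ?_, ?_⟩, fun h => ⟨by omega, ?_, ?_⟩⟩
    · exact ((hS.setRvar (by decide) _).setRvar (by decide) _).setWvar (by decide) _
    · rw [max_eq_left h]
    · exact (hS.setRvar (by decide) _).setWvar (by decide) _
    · rw [max_eq_right h.le, mul_zero, add_zero]
  · simp
  · simp only [ne_eq, Nat.reduceEqDiff, not_false_eq_true, Function.update_of_ne,
      Function.update_self, true_and]
    refine ⟨((Same.refl s).setRvar (by decide) _).setWvar (by decide) _, ?_⟩
    simp [ballValue]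
  · rintro t s' ⟨ht, -, h⟩
    refine ⟨?_, h⟩
    have : n * (e.time + 25 + ((WExp.var 0).time + 8)) ≤ n * (e.time + 40) :=
      Nat.mul_le_mul_left _ (by simp only [WExp.time]; omega)
    simp only [WExp.time, Nat.sub_zero] at ht this
    omega

/-- A table entry is read in constant time. Without a complete table one has `n < L`, so even the
direct computation in time `O(n)` is within `O(L)`. -/
theorem run_lookupValue (hE : Instance E n k d w) {rmax rmin : ℝ} {L : ℕ} (hXn : ∀ x ∈ X, x < n)
    (hs : HasTable n d w X rmax rmin L s) (hL : 1 ≤ L) {a : ℕ} (ha : s.wvar 20 = a)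
    (ha' : a < X.card) {l : ℕ} (hl : rmin ≤ 128 * (rmax / 4 ^ l)) {f : WExp}
    (hf : s.wvar 9 = 1 → f.eval E s = l) (hft : f.time ≤ 10) {e : RExp} (het : e.time ≤ 10)
    (he : ∀ s', Same s s' → s'.wvar 20 = s.wvar 20 → e.eval E s' = rmax / 4 ^ l) :
    Run E (lookupValue f e) s fun t s' => t ≤ 100 * L ∧ Same s s' ∧
      s'.wvar 20 = s.wvar 20 ∧ s'.wvar 21 = s.wvar 21 ∧ s'.wvar 22 = s.wvar 22 ∧
      s'.rvar 10 = s.rvar 10 ∧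
      s'.rvar 11 = ballValue d w (Finset.range n) (s.warr 2 a) (rmax / 4 ^ l) := by
  have hXc : X.card ≤ n := by
    simpa using Finset.card_le_card (show X ⊆ Finset.range n from
      fun x hx => Finset.mem_range.2 (hXn x hx))
  have e1 : 1 % E.modulus = 1 := hE.mod_eq (by omega)
  rw [lookupValue, run_ite]
  simp only [Test.eval, WExp.eval, e1, Test.time, WExp.time]
  constructor
  · intro h
    have h9 : s.wvar 9 = 1 := by
      rcases hs.table with h' | h'
      · exact h'.1
      · omega
    obtain ⟨-, htab⟩ := hs.table.resolve_right fun h' => by omega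
    obtain ⟨hln, htab⟩ := htab l hl
    have hM := hE.modulus
    have h₂ : a * n ≤ n * n := Nat.mul_le_mul_right _ (by omega)
    have m1 : a * n % E.modulus = a * n := Nat.mod_eq_of_lt (by nlinarith)
    have m2 : (a * n + l) % E.modulus = a * n + l := Nat.mod_eq_of_lt (by nlinarith)
    rw [run_setR]
    simp only [RExp.eval, WExp.eval, ha, hs.n_eq, hf h9, m1, m2, Function.update_self,
      RExp.time, WExp.time, htab a ha', ne_eq, Nat.reduceEqDiff, not_false_eq_true,
      Function.update_of_ne, and_true]
    exact ⟨by omega, (Same.refl s).setRvar (by decide) _⟩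
  · intro h
    have hnL : n < L := by
      rcases hs.table with h' | h'
      · omega
      · exact h'.2
    refine (run_computeValue hE hs.n_eq rfl (hXn _ (hs.lists.mem (ha.symm ▸ ha'))) he).mono ?_
    rintro t s' ⟨ht, hS, h20, h21, h22, h10, h11⟩
    rw [ha] at h11
    refine ⟨?_, hS, h20, h21, h22, h10, h11⟩
    have : n * (e.time + 40) ≤ n * 50 := Nat.mul_le_mul_left _ (by omega)
    omega

/-- By `hL` only levels below `L` are relevant, so the loop makes at most `L` rounds. If it stops at
level `n` while the radius there is still relevant, then `n < L`. -/
theorem run_fillTable (hE : Instance E n k d w) (hX : Lists (s.warr 2) X.card X)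
    (hXn : ∀ x ∈ X, x < n) (h0 : s.wvar 0 = n) (h5 : s.wvar 5 = X.card)
    (hne : X.Nonempty) {rmax rmin : ℝ} (hmax : s.rvar 0 = rmax) (hmin : s.rvar 1 = rmin)
    (hpos : 0 < rmax) {L : ℕ} (hL : 128 * (rmax / 4 ^ L) < rmin) :
    Run E fillTable s fun t s' => t ≤ 200 * (L + 1) * (n * X.card) ∧
      HasTable n d w X rmax rmin L s' := by
  have hXc : X.card ≤ n := by
    simpa using Finset.card_le_card (show X ⊆ Finset.range n from
      fun x hx => Finset.mem_range.2 (hXn x hx))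
  have hXp : 0 < X.card := Finset.card_pos.2 hne
  have hnX : n ≤ n * X.card := Nat.le_mul_of_pos_right _ hXp
  have hXn' : X.card ≤ n * X.card := Nat.le_mul_of_pos_left _ (by omega)
  have e1 : 1 % E.modulus = 1 := hE.mod_eq (by omega)
  have hmono : ∀ {i j : ℕ}, i ≤ j → rmax / 4 ^ j ≤ rmax / 4 ^ i := fun h =>
    div_le_div_of_nonneg_left hpos.le (by positivity) (pow_le_pow_right₀ (by norm_num) h)
  have hlt : ∀ {l : ℕ}, rmin ≤ 128 * (rmax / 4 ^ l) → l < L := by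
    intro l hl
    by_contra h
    have := hmono (not_lt.1 h)
    linarith
  rw [fillTable, run_seq, run_setW, run_seq, run_setR]
  simp only [WExp.eval, RExp.eval, Nat.zero_mod, hmax]
  refine Run.seq (Run.while (fun T s' => ∃ l ≤ n, s'.wvar 8 = l ∧ s'.wvar 0 = n ∧
    s'.wvar 5 = X.card ∧ s'.warr 2 = s.warr 2 ∧ s'.rvar 1 = rmin ∧ s'.rvar 2 = rmax / 4 ^ l ∧
    (∀ l' < l, rmin ≤ 128 * (rmax / 4 ^ l')) ∧
    (∀ l' < l, ∀ a < X.card, s'.rarr 1 (a * n + l') =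
      ballValue d w (Finset.range n) (s.warr 2 a) (rmax / 4 ^ l')) ∧
    T = (L - l) * (150 * (n * X.card)) + 20)
    (Q := fun s' => ∃ l ≤ n, s'.wvar 0 = n ∧ s'.wvar 5 = X.card ∧ s'.warr 2 = s.warr 2 ∧
      s'.rvar 1 = rmin ∧ s'.rvar 2 = rmax / 4 ^ l ∧
      (rmin ≤ 128 * (rmax / 4 ^ l) → l = n) ∧ (∀ l' < l, ∀ a < X.card, s'.rarr 1 (a * n + l') =
        ballValue d w (Finset.range n) (s.warr 2 a) (rmax / 4 ^ l'))) ?_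
    (L * (150 * (n * X.card)) + 20) _ ⟨0, Nat.zero_le n, ?_⟩) ?_
  · rintro _ s' ⟨l, hln, i8, i0, i5, iw, i1, i2', hrel, htab, rfl⟩
    simp only [Test.eval, WExp.eval, RExp.eval, i8, i0, i1, i2', not_le, Nat.cast_ofNat,
      Test.time, RExp.time, WExp.time]
    by_cases hc : rmin ≤ 128 * (rmax / 4 ^ l) ∧ l < n
    · left
      refine ⟨hc, ?_⟩
      have hlL := hlt hc.1
      rw [run_seq, run_setW, run_seq]
      simp only [WExp.eval, Nat.zero_mod, WExp.time]
      refine (run_forTo_const (hE.lt_modulus (by omega : X.card < _)) (fun a s'' =>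
        s''.wvar 8 = l ∧ s''.wvar 0 = n ∧ s''.wvar 5 = X.card ∧ s''.warr 2 = s.warr 2 ∧
        s''.rvar 1 = rmin ∧ s''.rvar 2 = rmax / 4 ^ l ∧
        (∀ l' < l, ∀ a < X.card, s''.rarr 1 (a * n + l') =
          ballValue d w (Finset.range n) (s.warr 2 a) (rmax / 4 ^ l')) ∧
        ∀ a' < a, s''.rarr 1 (a' * n + l) =
          ballValue d w (Finset.range n) (s.warr 2 a') (rmax / 4 ^ l))
        (n * 41 + 30) ?_ ?_ (Nat.zero_le _) ?_ ?_).mono ?_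
      · rintro a - s'' ⟨-, -, h, -⟩
        exact h
      · rintro a ha s'' hx ⟨j8, j0, j5, jw, j1, j2, hold, hnew⟩
        refine Run.seq (run_computeValue hE j0 rfl (x := s''.warr 2 (s''.wvar 20))
          (hXn _ (by rw [jw, hx]; exact hX.mem ha)) (e := .var 2) (r := rmax / 4 ^ l) ?_) ?_
        · intro s₃ hS _
          rw [RExp.eval, hS.rvar 2 (by decide), j2]
        rintro t s₃ ⟨ht, hS, h20, -, -, -, h11⟩
        have hM := hE.modulus
        have h₂ : a * n ≤ n * n := Nat.mul_le_mul_right _ (by omega)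
        have m1 : a * n % E.modulus = a * n := Nat.mod_eq_of_lt (by nlinarith)
        have m2 : (a * n + l) % E.modulus = a * n + l := Nat.mod_eq_of_lt (by nlinarith)
        -- The row length is `n` and levels are below `n`, so distinct pairs have distinct
        -- addresses.
        have hne : ∀ a' l', l' < n → (a' ≠ a ∨ l' ≠ l) → a' * n + l' ≠ a * n + l := by
          intro a' l' hl' h e
          have h2 := congrArg (· % n) e
          simp only [Nat.mul_add_mod', Nat.mod_eq_of_lt hl', Nat.mod_eq_of_lt hc.2] at h2
          rw [h2] at e
          have : a' * n = a * n := by omega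
          have := Nat.eq_of_mul_eq_mul_right (by omega) this
          tauto
        rw [run_putR]
        simp only [WExp.eval, RExp.eval, h20, hx, hS.wvar 0 (by decide), j0,
          hS.wvar 8 (by decide), j8, m1, m2, h11, jw, WExp.time, RExp.time,
          Function.update_self, ne_eq, Nat.reduceEqDiff, not_false_eq_true, Function.update_of_ne,
          hS.wvar 5 (by decide), j5, hS.rvar 1 (by decide), j1, hS.rvar 2 (by decide), j2,
          hS.warr, hS.rarr, true_and, OfNat.zero_ne_ofNat]
        refine ⟨?_, fun l' hl' a' ha' => ?_, fun a' ha' => ?_⟩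
        · simp only [RExp.time] at ht
          omega
        · rw [Function.update_of_ne (hne a' l' (by omega) (Or.inr (by omega)))]
          exact hold l' hl' a' ha'
        · rcases Nat.lt_succ_iff_lt_or_eq.1 ha' with h | rfl
          · rw [Function.update_of_ne (hne a' l hc.2 (Or.inl (by omega)))]
            exact hnew a' h
          · rw [Function.update_self]
      · simp
      · simp only [ne_eq, Nat.reduceEqDiff, not_false_eq_true, Function.update_of_ne,
          OfNat.zero_ne_ofNat, i8, i0, i5, iw, i1, i2', true_and]
        exact ⟨htab, fun a' h => absurd h (Nat.not_lt_zero _)⟩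
      · rintro t s'' ⟨ht, -, j8, j0, j5, jw, j1, j2, hold, hnew⟩
        have m1 : (l + 1) % E.modulus = l + 1 := hE.mod_eq (by omega)
        simp only [run_seq, run_setW, run_setR, WExp.eval, RExp.eval, j8, j2, e1, m1, WExp.time,
          RExp.time, Nat.cast_ofNat]
        refine ⟨_, ⟨l + 1, hc.2, ?_, ?_, ?_, ?_, ?_, ?_, fun l' hl' => ?_, fun l' hl' => ?_, rfl⟩,
          ?_⟩
        · simp
        · simpa using j0
        · simpa using j5
        · exact jw
        · simpa using j1
        · simp [pow_succ, div_div]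
        · rcases Nat.lt_succ_iff_lt_or_eq.1 hl' with h | rfl
          · exact hrel l' h
          · exact hc.1
        · rcases Nat.lt_succ_iff_lt_or_eq.1 hl' with h | rfl
          · exact hold l' h
          · exact hnew
        · obtain ⟨q, hq⟩ : ∃ q, L = l + 1 + q := ⟨L - (l + 1), by omega⟩
          have e3 : L - (l + 1) = q := by omega
          have e4 : L - l = q + 1 := by omega
          have e5 : X.card * (n * 41 + 30 + ((WExp.var 5).time + 8)) =
            41 * (n * X.card) + 39 * X.card := by simp only [WExp.time]; ring
          rw [Nat.sub_zero, e5] at ht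
          rw [e3, e4, Nat.succ_mul q]
          simp only [WExp.time] at ht
          omega
    · right
      refine ⟨hc, by omega, l, hln, trivial, i5, iw, trivial, rfl, fun h => ?_, htab⟩
      by_contra h'
      exact hc ⟨h, by omega⟩
  · simp [h0, h5, hmin]
  · rintro t₁ s₁ ⟨ht₁, l, hln, i0, i5, iw, i1, i2', hl, htab⟩
    simp only [run_ite, run_setW, Test.eval, RExp.eval, WExp.eval, i1, i2', Nat.cast_ofNat, e1,
      Nat.zero_mod, Test.time, RExp.time, WExp.time]
    have ht : 200 * (L + 1) * (n * X.card) = 150 * L * (n * X.card) + 50 * (L * (n * X.card)) +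
      200 * (n * X.card) := by ring
    have ht' : L * (150 * (n * X.card)) = 150 * L * (n * X.card) := by ring
    rw [ht'] at ht₁
    constructor
    · intro h
      refine ⟨by omega, by simpa using i0, by simpa using i5, by simpa [iw] using hX,
        by simpa using i1, Or.inr ⟨by simp, hl h ▸ hlt h⟩⟩
    · intro h
      refine ⟨by omega, by simpa using i0, by simpa using i5, by simpa [iw] using hX,
        by simpa using i1, Or.inl ⟨by simp, fun l' hl' => ?_⟩⟩
      have hll : l' < l := by
        by_contra h'
        have := hmono (not_lt.1 h')
        linarith
      exact ⟨by omega, by simpa [iw] using htab l' hll⟩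

end

/-! ### One round of the greedy choice: head, descent and new radii -/

/-- Find the listed point whose ball of current radius, if positive, has the greatest value. -/
def pickHead : Prog :=
  argmin (.var 5) (.realLt (.lit 0) (.get 2 (.var 20)))
    (lookupValue (.get 6 (.var 20)) (.get 2 (.var 20))) (.sub (.lit 0) (.var 11))

/-- Move to the child of greatest value until the ball contains only one listed point. -/
def descend : Prog :=
  .while (.realLe (.var 1) (.mul (.lit 3) (.var 2))) (.seq (.setR 2 (.div (.var 2) (.lit 4)))
    (.seq (.setW 8 (.add (.var 8) (.lit 1))) (.seq (argmin (.var 5)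
      (.realLe (.dist (.get 2 (.var 10)) (.get 2 (.var 20))) (.mul (.lit 12) (.var 2)))
      (lookupValue (.var 8) (.var 2)) (.sub (.lit 0) (.var 11))) (.setW 10 (.var 21)))))

/-- Decrease the radius of the point listed at the position in word variable `6`, in view of
the new center, listed at the position in word variable `10`. -/
def shrink : Prog :=
  .seq (.setR 3 (.dist (.get 2 (.var 10)) (.get 2 (.var 6))))
    (.ite (.realLe (.var 3) (.lit 0)) (.putR 2 (.var 6) (.lit 0))
      (.while (.realLt (.var 3) (.mul (.lit 32) (.get 2 (.var 6))))
        (.seq (.putR 2 (.var 6) (.div (.get 2 (.var 6)) (.lit 4)))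
          (.putW 6 (.var 6) (.add (.get 6 (.var 6)) (.lit 1))))))

/-- All radii are `0` or relevant table radii, with indices in word array `6`. -/
def HasRadius (rmax rmin : ℝ) (s : State) (a : ℕ) : Prop :=
  s.rarr 2 a = 0 ∨ ∃ l, rmin ≤ 128 * (rmax / 4 ^ l) ∧ s.rarr 2 a = rmax / 4 ^ l ∧
    (s.wvar 9 = 1 → s.warr 6 a = l)

/-- The radius `ρ` of a point at distance `δ` from a new center is changed to `ρ'`. -/
structure Shrunk (δ ρ ρ' : ℝ) : Prop where
  le : ρ' ≤ ρ
  nonneg : 0 ≤ ρ'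
  mul_le : 32 * ρ' ≤ δ
  cover : ρ' = ρ ∨ δ ≤ 128 * ρ'
  eq_zero : ρ' = 0 → ρ = 0 ∨ δ ≤ 0

section

variable {E : Env} {n k : ℕ} {d : ℕ → ℕ → ℝ} {w : ℕ → ℝ} {s : State} {X : Finset ℕ}
  {rmax rmin : ℝ} {L : ℕ}

theorem HasTable.congr (h : HasTable n d w X rmax rmin L s) {s' : State}
    (h0 : s'.wvar 0 = s.wvar 0) (h5 : s'.wvar 5 = s.wvar 5) (h9 : s'.wvar 9 = s.wvar 9)
    (hw : s'.warr 2 = s.warr 2) (h1 : s'.rvar 1 = s.rvar 1) (hr : s'.rarr 1 = s.rarr 1) :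
    HasTable n d w X rmax rmin L s' :=
  ⟨h0.trans h.n_eq, h5.trans h.card_eq, hw ▸ h.lists, h1.trans h.rmin_eq, by
    rw [h9, hr, hw]
    exact h.table⟩

theorem HasTable.same (h : HasTable n d w X rmax rmin L s) {s' : State} (hS : Same s s') :
    HasTable n d w X rmax rmin L s' :=
  h.congr (hS.wvar 0 (by decide)) (hS.wvar 5 (by decide)) (hS.wvar 9 (by decide))
    (by rw [hS.warr]) (hS.rvar 1 (by decide)) (by rw [hS.rarr])

theorem card_le_of_lt {m : ℕ} (h : ∀ x ∈ X, x < m) : X.card ≤ m := by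
  simpa using Finset.card_le_card (show X ⊆ Finset.range m from
    fun x hx => Finset.mem_range.2 (h x hx))

theorem run_pickHead (hE : Instance E n k d w) (hXn : ∀ x ∈ X, x < n)
    (hs : HasTable n d w X rmax rmin L s) (hL : 1 ≤ L)
    (hrad : ∀ a < X.card, HasRadius rmax rmin s a) (hex : ∃ a < X.card, 0 < s.rarr 2 a) :
    Run E pickHead s fun t s' => t ≤ 200 * (X.card * L) ∧ Same s s' ∧ s'.wvar 21 < X.card ∧
      0 < s.rarr 2 (s'.wvar 21) ∧ ∀ a < X.card, 0 < s.rarr 2 a →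
        ballValue d w (Finset.range n) (s.warr 2 a) (s.rarr 2 a) ≤
          ballValue d w (Finset.range n) (s.warr 2 (s'.wvar 21)) (s.rarr 2 (s'.wvar 21)) := by
  have hXc := card_le_of_lt hXn
  refine (run_argmin (hE.lt_modulus (by omega)) (hE.lt_modulus (show X.card < _ by omega))
    (B := fun a => 0 < s.rarr 2 a)
    -- The greatest value is found as the least negative.
    (F := fun a => - ballValue d w (Finset.range n) (s.warr 2 a) (s.rarr 2 a))
    (c := 100 * L) ?_ ?_ ?_).mono ?_
  · intro s' hS
    exact (hS.wvar 5 (by decide)).trans hs.card_eq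
  · intro a ha s' hS hx
    simp [Test.eval, RExp.eval, WExp.eval, hS.rarr, hx]
  · intro a ha hpos s' hS hx
    obtain ⟨l, hl, hρ, h9⟩ := (hrad a ha).resolve_left hpos.ne'
    refine (run_lookupValue hE hXn (hs.same hS) hL hx ha hl (f := .get 6 (.var 20)) ?_
      (by simp [WExp.time]) (e := .get 2 (.var 20)) (by simp [WExp.time, RExp.time]) ?_).mono ?_
    · intro h
      rw [hS.wvar 9 (by decide)] at h
      rw [WExp.eval, WExp.eval, hx, hS.warr, h9 h]
    · intro s'' hS' h20
      rw [RExp.eval, WExp.eval, h20, hx, hS'.rarr, hS.rarr, hρ]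
    · rintro t s'' ⟨ht, hS', h20, h21, h22, h10, h11⟩
      refine ⟨ht, hS', h20.trans hx, h21, h22, h10, ?_⟩
      rw [RExp.eval, RExp.eval, RExp.eval, h11, hS.warr, hρ]
      simp
  · rintro t s' ⟨ht, hS, h⟩
    obtain ⟨h₁, h₂, h₃⟩ := h hex
    refine ⟨?_, hS, h₁, h₂, fun a ha hpos => neg_le_neg_iff.1 (h₃ a ha hpos)⟩
    obtain ⟨a, ha, -⟩ := hex
    have e1 : X.card * (100 * L + 42) = 100 * (X.card * L) + 42 * X.card := by ring
    have e2 : X.card ≤ X.card * L := Nat.le_mul_of_pos_right _ hL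
    simp only [Test.time, RExp.time, WExp.time] at ht
    ring_nf at ht e1 e2 ⊢
    omega

/-- The loop runs while `rmin ≤ 3 r`, so the next radius `r / 4` satisfies `rmin ≤ 12 (r / 4)` and
is still relevant. When it stops, a ball of radius `3 r < rmin` contains just one point of `X`. The
test on children compares with 12 times the new radius, that is, 3 times the old one. -/
theorem run_descend (hE : Instance E n k d w) (hXn : ∀ x ∈ X, x < n)
    (hinj : ∀ x ∈ X, ∀ y ∈ X, d x y < rmin → x = y)
    (hs : HasTable n d w X rmax rmin L s) (hpos : 0 < rmax)
    (hL : ∀ l, rmin ≤ 128 * (rmax / 4 ^ l) → l < L) {l₀ : ℕ}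
    (hl₀ : rmin ≤ 128 * (rmax / 4 ^ l₀)) (h10 : s.wvar 10 < X.card)
    (h2 : s.rvar 2 = rmax / 4 ^ l₀) (h8 : s.wvar 9 = 1 → s.wvar 8 = l₀) :
    Run E descend s fun t s' => t ≤ 300 * (L * (X.card * L)) + 10 ∧
      HasTable n d w X rmax rmin L s' ∧ s'.wvar 10 < X.card ∧ ∃ c J,
      IsChain d w (Finset.range n) X c (rmax / 4 ^ l₀) J ∧ c 0 = s.warr 2 (s.wvar 10) ∧
      c J = s.warr 2 (s'.wvar 10) := by
  have hXc := card_le_of_lt hXn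
  have hL1 : 1 ≤ L := by
    have := hL l₀ hl₀
    omega
  have hdiv : ∀ j, rmax / 4 ^ l₀ / 4 ^ j = rmax / 4 ^ (l₀ + j) := fun j => by
    rw [pow_add, div_div]
  refine (Run.while (fun T s' => ∃ J c, HasTable n d w X rmax rmin L s' ∧ s'.wvar 10 < X.card ∧
    s'.warr 2 = s.warr 2 ∧ s'.rvar 2 = rmax / 4 ^ (l₀ + J) ∧
    rmin ≤ 128 * (rmax / 4 ^ (l₀ + J)) ∧ (s'.wvar 9 = 1 → s'.wvar 8 = l₀ + J) ∧
    c 0 = s.warr 2 (s.wvar 10) ∧ c J = s.warr 2 (s'.wvar 10) ∧ (∀ j ≤ J, c j ∈ X) ∧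
    (∀ j < J, d (c j) (c (j + 1)) ≤ 3 * (rmax / 4 ^ (l₀ + j)) ∧
      ∀ y ∈ X, d (c j) y ≤ 3 * (rmax / 4 ^ (l₀ + j)) →
        ballValue d w (Finset.range n) y (rmax / 4 ^ (l₀ + (j + 1))) ≤
          ballValue d w (Finset.range n) (c (j + 1)) (rmax / 4 ^ (l₀ + (j + 1)))) ∧
    T = (L - (l₀ + J)) * (300 * (X.card * L)) + 10)
    (Q := fun s' => HasTable n d w X rmax rmin L s' ∧ s'.wvar 10 < X.card ∧ ∃ c J,
      IsChain d w (Finset.range n) X c (rmax / 4 ^ l₀) J ∧ c 0 = s.warr 2 (s.wvar 10) ∧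
      c J = s.warr 2 (s'.wvar 10)) ?_ _ s ⟨0, fun _ => s.warr 2 (s.wvar 10), hs, h10, rfl, h2, hl₀,
        h8, rfl, rfl, fun _ _ => hs.lists.mem h10, fun j hj => absurd hj (Nat.not_lt_zero j),
        rfl⟩).mono ?_
  · rintro _ s' ⟨J, c, hT, i10, iw, i2, hrel, i8, hc0, hcJ, hmem, hch, rfl⟩
    have hr : 0 < rmax / 4 ^ (l₀ + J) := by positivity
    have hlt := hL _ hrel
    have hquar : rmax / 4 ^ (l₀ + (J + 1)) = rmax / 4 ^ (l₀ + J) / 4 := by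
      rw [← add_assoc, pow_succ, div_div]
    simp only [Test.eval, RExp.eval, hT.rmin_eq, i2, Nat.cast_ofNat, not_le, Test.time, RExp.time]
    rcases le_or_gt rmin (3 * (rmax / 4 ^ (l₀ + J))) with h | h
    · left
      refine ⟨h, ?_⟩
      have hrel' : rmin ≤ 128 * (rmax / 4 ^ (l₀ + (J + 1))) := by
        rw [hquar]
        linarith
      simp only [run_seq, run_setR, run_setW, WExp.eval, RExp.eval, i2, Nat.cast_ofNat, ← hquar,
        WExp.time, RExp.time]
      set s₁ : State := { s' with
        rvar := Function.update s'.rvar 2 (rmax / 4 ^ (l₀ + (J + 1)))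
        wvar := Function.update s'.wvar 8 ((s'.wvar 8 + 1 % E.modulus) % E.modulus) } with hs₁
      have j10 : s₁.wvar 10 = s'.wvar 10 := by simp [hs₁]
      have j2 : s₁.rvar 2 = rmax / 4 ^ (l₀ + (J + 1)) := by simp [hs₁]
      have jw : s₁.warr 2 = s.warr 2 := iw
      -- The level counter matters only if the table is complete, and then levels are below `n`.
      -- Otherwise it may wrap around harmlessly.
      have j8 : s₁.wvar 9 = 1 → s₁.wvar 8 = l₀ + (J + 1) := by
        intro h9
        have h9' : s'.wvar 9 = 1 := by simpa [hs₁] using h9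
        have hn : l₀ + (J + 1) < n := by
          rcases hT.table with ⟨-, ht⟩ | ⟨ht, -⟩
          · exact (ht _ hrel').1
          · omega
        have e1 : 1 % E.modulus = 1 := hE.mod_eq (by omega)
        have e2 : (l₀ + (J + 1)) % E.modulus = l₀ + (J + 1) := hE.mod_eq (by omega)
        simp [hs₁, i8 h9', e1, e2, add_assoc]
      have hT₁ : HasTable n d w X rmax rmin L s₁ :=
        hT.congr (by simp [hs₁]) (by simp [hs₁]) (by simp [hs₁]) rfl (by simp [hs₁]) rfl
      have hcJ' : c J < n := hXn _ (hmem J le_rfl)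
      refine (run_argmin (s := s₁) (hE.lt_modulus (by omega))
        (hE.lt_modulus (show X.card < _ by omega))
        (B := fun a => d (c J) (s.warr 2 a) ≤ 12 * (rmax / 4 ^ (l₀ + (J + 1))))
        (F := fun a => - ballValue d w (Finset.range n) (s.warr 2 a) (rmax / 4 ^ (l₀ + (J + 1))))
        (c := 100 * L) ?_ ?_ ?_).frame.mono ?_
      · intro s'' hS
        exact (hS.wvar 5 (by decide)).trans hT₁.card_eq
      · intro a ha s'' hS hx
        have ha' : s.warr 2 a < n := hXn _ (hs.lists.mem ha)
        simp only [Test.eval, RExp.eval, WExp.eval, hS.warr, hS.rvar 2 (by decide), hx,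
          hS.wvar 10 (by decide), j10, j2, jw, Nat.cast_ofNat, ← hcJ, hE.dist _ hcJ' _ ha']
      · intro a ha hB s'' hS hx
        refine (run_lookupValue hE hXn (hT₁.same hS) hL1 hx ha hrel' (f := .var 8) ?_
          (by simp [WExp.time]) (e := .var 2) (by simp [RExp.time]) ?_).mono ?_
        · intro h9
          rw [hS.wvar 9 (by decide)] at h9
          rw [WExp.eval, hS.wvar 8 (by decide), j8 h9]
        · intro s₃ hS' h20
          rw [RExp.eval, hS'.rvar 2 (by decide), hS.rvar 2 (by decide), j2]
        · rintro t s₃ ⟨ht, hS', k20, k21, k22, k10, k11⟩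
          refine ⟨ht, hS', k20.trans hx, k21, k22, k10, ?_⟩
          rw [RExp.eval, RExp.eval, RExp.eval, k11, hS.warr, jw]
          simp
      · rintro t s₂ ⟨⟨ht, hS, hmin⟩, -⟩
        -- The current point is a possible child of itself, so the search is not void.
        obtain ⟨hlt₂, hB, hbest⟩ := hmin ⟨s'.wvar 10, i10, by
          rw [hcJ, hE.isDist.self]
          positivity⟩
        have hT₂ := hT₁.same hS
        set y := s.warr 2 (s₂.wvar 21) with hy
        refine ⟨_, ⟨J + 1, fun j => if j ≤ J then c j else y, ?_, ?_, ?_, ?_, hrel', ?_, ?_, ?_,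
          ?_, ?_, rfl⟩, ?_⟩
        · exact hT₂.congr (by simp) (by simp) (by simp) rfl rfl rfl
        · simpa using hlt₂
        · simpa [hS.warr] using jw
        · simpa [hS.rvar 2 (by decide)] using j2
        · simp only [ne_eq, Nat.reduceEqDiff, not_false_eq_true, Function.update_of_ne,
            hS.wvar 9 (by decide), hS.wvar 8 (by decide)]
          exact j8
        · simpa using hc0
        · simp [hy]
        · intro j hj
          dsimp only
          split_ifs
          · exact hmem j (by omega)
          · exact hs.lists.mem hlt₂
        · intro j hj
          rcases Nat.lt_succ_iff_lt_or_eq.1 hj with hj | rfl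
          · simp only [hj.le, if_true, show j + 1 ≤ J from hj]
            exact hch j hj
          · simp only [le_refl, if_true, show ¬ j + 1 ≤ j by omega, if_false]
            refine ⟨by rw [hquar] at hB; linarith, fun x hx hdx => ?_⟩
            obtain ⟨a, ha, rfl⟩ := hs.lists.exists_eq hx
            exact neg_le_neg_iff.1 (hbest a ha (by rw [hquar]; linarith))
        · obtain ⟨q, hq⟩ : ∃ q, L = l₀ + (J + 1) + q := by
            have := hL _ hrel'
            exact ⟨L - (l₀ + (J + 1)), by omega⟩
          have e3 : L - (l₀ + (J + 1)) = q := by omega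
          have e4 : L - (l₀ + J) = q + 1 := by omega
          have e2 : X.card ≤ X.card * L := Nat.le_mul_of_pos_right _ hL1
          rw [e3, e4, Nat.succ_mul q]
          simp only [Test.time, RExp.time, WExp.time] at ht
          have e5 : X.card * (100 * L + (1 + 1 + (1 + 1) + 1 + (1 + 1 + 1) + 1) +
            2 * (1 + 1 + 1) + 1 + 30) = 100 * (X.card * L) + 46 * X.card := by ring
          rw [e5] at ht
          omega
    · right
      refine ⟨h, by omega, hT, i10, c, J, ⟨?_, hmem, ?_, ?_, ?_⟩, hc0, hcJ⟩
      · positivity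
      · intro j hj
        rw [hdiv]
        exact (hch j hj).1
      · intro j hj
        rw [hdiv, hdiv]
        exact (hch j hj).2
      · intro y hy hdy
        rw [hdiv] at hdy
        exact (hinj _ (hmem J le_rfl) y hy (by linarith)).symm
  · rintro t s' ⟨ht, h⟩
    refine ⟨ht.trans ?_, h⟩
    have : (L - (l₀ + 0)) * (300 * (X.card * L)) ≤ L * (300 * (X.card * L)) :=
      Nat.mul_le_mul_right _ (by omega)
    have e : L * (300 * (X.card * L)) = 300 * (L * (X.card * L)) := by ring
    omega

/-- A positive radius is quartered while it exceeds `δ / 32`. If it changes at all, the previous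
value exceeded `δ / 32`, so `δ < 128 ρ'`; as `rmin ≤ δ`, the new radius is still relevant. For `δ =
0` the quartering would never end, and the radius is set to 0 instead. -/
theorem run_shrink (hE : Instance E n k d w) (hXn : ∀ x ∈ X, x < n)
    (hsep : ∀ x ∈ X, ∀ y ∈ X, 0 < d x y → rmin ≤ d x y)
    (hs : HasTable n d w X rmax rmin L s) (hpos : 0 < rmax)
    (hL : ∀ l, rmin ≤ 128 * (rmax / 4 ^ l) → l < L) {a : ℕ} (ha : s.wvar 6 = a)
    (haX : a < X.card) (h10 : s.wvar 10 < X.card) (hrad : HasRadius rmax rmin s a) :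
    Run E shrink s fun t s' => t ≤ 30 * L + 30 ∧ HasRadius rmax rmin s' a ∧
      Shrunk (d (s.warr 2 (s.wvar 10)) (s.warr 2 a)) (s.rarr 2 a) (s'.rarr 2 a) ∧
      ∀ b, b ≠ a → s'.rarr 2 b = s.rarr 2 b ∧ s'.warr 6 b = s.warr 6 b := by
  have hcX := hs.lists.mem h10
  have haX' := hs.lists.mem haX
  set δ := d (s.warr 2 (s.wvar 10)) (s.warr 2 a) with hδ
  have hδ0 : 0 ≤ δ := hE.isDist.nonneg _ _
  have hdist := hE.dist _ (hXn _ hcX) _ (hXn _ haX')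
  have hr0 : 0 ≤ s.rarr 2 a := by
    rcases hrad with h | ⟨l, -, h, -⟩ <;> rw [h]
    positivity
  simp only [shrink, run_seq, run_setR, run_ite, run_putR, Test.eval, RExp.eval, WExp.eval, ha,
    hdist, ← hδ, Function.update_self, Nat.cast_zero, not_le, Test.time, RExp.time, WExp.time]
  refine ⟨fun h => ⟨by omega, Or.inl (by simp), ?_, fun b hb => by simp [hb]⟩, fun h => ?_⟩
  · exact ⟨by simpa using hr0, le_rfl, by simpa using hδ0, Or.inr (by simpa using h),
      fun _ => Or.inr h⟩
  have hmin : rmin ≤ δ := hsep _ hcX _ haX' h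
  have key : Run E (.while (.realLt (.var 3) (.mul (.lit 32) (.get 2 (.var 6))))
        (.seq (.putR 2 (.var 6) (.div (.get 2 (.var 6)) (.lit 4)))
          (.putW 6 (.var 6) (.add (.get 6 (.var 6)) (.lit 1)))))
      { s with rvar := Function.update s.rvar 3 δ } fun t s' => t ≤ L * 25 + 10 ∧
        HasRadius rmax rmin s' a ∧ Shrunk δ (s.rarr 2 a) (s'.rarr 2 a) ∧
        ∀ b, b ≠ a → s'.rarr 2 b = s.rarr 2 b ∧ s'.warr 6 b = s.warr 6 b := by
    rcases eq_or_ne (s.rarr 2 a) 0 with hz | hz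
    · refine Run.while (fun T s' => s' = { s with rvar := Function.update s.rvar 3 δ } ∧
        T = L * 25 + 10) ?_ _ _ ⟨rfl, rfl⟩
      rintro _ _ ⟨rfl, rfl⟩
      right
      simp only [Test.eval, RExp.eval, WExp.eval, ha, hz, Function.update_self, mul_zero, not_not,
        Test.time, RExp.time, WExp.time]
      refine ⟨hδ0, by omega, Or.inl hz, ⟨le_rfl, le_rfl, by simpa using hδ0, Or.inl rfl,
        fun _ => Or.inl rfl⟩, fun b hb => ⟨trivial, trivial⟩⟩
    obtain ⟨l₀, hl₀, hρ, h9⟩ := hrad.resolve_left hz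
    refine (Run.while (Q := fun s' => HasRadius rmax rmin s' a ∧
      Shrunk δ (s.rarr 2 a) (s'.rarr 2 a) ∧
      ∀ b, b ≠ a → s'.rarr 2 b = s.rarr 2 b ∧ s'.warr 6 b = s.warr 6 b)
      (fun T s' => ∃ l, l₀ ≤ l ∧ s'.wvar 6 = a ∧ s'.wvar 9 = s.wvar 9 ∧
      s'.rvar 3 = δ ∧ rmin ≤ 128 * (rmax / 4 ^ l) ∧ s'.rarr 2 a = rmax / 4 ^ l ∧
      (s.wvar 9 = 1 → s'.warr 6 a = l) ∧ (l = l₀ ∨ δ ≤ 128 * (rmax / 4 ^ l)) ∧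
      (∀ b, b ≠ a → s'.rarr 2 b = s.rarr 2 b ∧ s'.warr 6 b = s.warr 6 b) ∧
      T = (L - l) * 25 + 10) ?_ _ { s with rvar := Function.update s.rvar 3 δ } 
      ⟨l₀, le_rfl, ha, rfl, by simp, hl₀, hρ, h9, Or.inl rfl, fun b _ => ⟨rfl, rfl⟩, rfl⟩).mono ?_
    · rintro _ s' ⟨l, hll, i6, i9, i3, hrel, iρ, i6', hcov, hb, rfl⟩
      have hlL := hL l hrel
      have hquar : rmax / 4 ^ (l + 1) = rmax / 4 ^ l / 4 := by rw [pow_succ, div_div]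
      simp only [Test.eval, RExp.eval, WExp.eval, i6, i3, iρ, Nat.cast_ofNat, not_le, not_lt,
        Test.time, RExp.time, WExp.time]
      rcases lt_or_ge δ (32 * (rmax / 4 ^ l)) with hc | hc
      · left
        refine ⟨hc, ?_⟩
        have hrel' : rmin ≤ 128 * (rmax / 4 ^ (l + 1)) := by
          rw [hquar]
          linarith
        simp only [run_seq, run_putR, run_putW, RExp.eval, WExp.eval, i6, iρ, Nat.cast_ofNat,
          RExp.time, WExp.time]
        refine ⟨_, ⟨l + 1, by omega, trivial, i9, i3, hrel', ?_, fun h => ?_, Or.inr ?_,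
          fun b hne => ?_, rfl⟩, ?_⟩
        · simp [hquar]
        · have hn : l + 1 < n := by
            rcases hs.table with ⟨-, ht⟩ | ⟨ht, -⟩
            · exact (ht _ hrel').1
            · omega
          have e1 : 1 % E.modulus = 1 := hE.mod_eq (by omega)
          have e2 : (l + 1) % E.modulus = l + 1 := hE.mod_eq (by omega)
          simp [i6' h, e1, e2]
        · rw [hquar]
          linarith
        · simpa [hne] using hb b hne
        · have := hL _ hrel'
          omega
      · right
        refine ⟨hc, by omega, Or.inr ⟨l, hrel, iρ, by rwa [i9]⟩, ⟨?_, ?_, ?_, ?_, ?_⟩, hb⟩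
        · rw [hρ]
          exact div_le_div_of_nonneg_left hpos.le (by positivity)
            (pow_le_pow_right₀ (by norm_num) hll)
        · positivity
        · exact hc
        · rcases hcov with rfl | hcov
          · exact Or.inl hρ.symm
          · exact Or.inr hcov
        · intro h0
          have : 0 < rmax / 4 ^ l := by positivity
          linarith
    · rintro t s' ⟨ht, h⟩
      exact ⟨by omega, h⟩
  refine key.mono ?_
  rintro t s' ⟨ht, h⟩
  exact ⟨by omega, h⟩

end

/-! ### Opening the centers -/

/-- Choose the next center, put it at the position in word variable `12` of word array `0`, and
decrease the radii accordingly. -/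
def chooseCenter : Prog :=
  .seq pickHead (.seq (.setW 10 (.var 21)) (.seq (.setW 8 (.get 6 (.var 10)))
    (.seq (.setR 2 (.get 2 (.var 10))) (.seq descend (.seq (.putW 0 (.var 12) (.get 2 (.var 10)))
      (.seq (.setW 6 (.lit 0)) (forTo 6 (.var 5) shrink)))))))

/-- Choose `k` centers, or all of them if there are less, among the listed points. -/
def chooseCenters : Prog :=
  .seq (.setW 6 (.lit 0)) (.seq (forTo 6 (.var 5)
      (.seq (.putR 2 (.var 6) (.var 0)) (.putW 6 (.var 6) (.lit 0))))
    (.seq (.seq (.setW 11 (.var 5)) (.ite (.wordLt (.var 1) (.var 11)) (.setW 11 (.var 1)) .skip))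
    (.seq (.setW 12 (.lit 0)) (.seq (forTo 12 (.var 11) chooseCenter) (.setW 0 (.var 11))))))

/-- The program stores radii by position and the analysis uses radii of points; a list without
repetition allows the translation. -/
theorem Lists.exists_fun {f : ℕ → ℕ} {r : ℕ} {A : Finset ℕ} (h : Lists f r A) (g : ℕ → ℝ) :
    ∃ φ : ℕ → ℝ, ∀ a < r, φ (f a) = g a := by
  classical
  refine ⟨fun x => if hx : ∃ a < r, f a = x then g hx.choose else 0, fun a ha => ?_⟩
  have hx : ∃ b < r, f b = f a := ⟨a, ha, rfl⟩
  dsimp only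
  rw [dif_pos hx, h.inj hx.choose_spec.1 ha hx.choose_spec.2]

/-- A chain ends within `4 r` of its head, whereas earlier centers are at distance at least `32 r`
from the head. -/
theorem IsGreedy.ne {d : ℕ → ℕ → ℝ} {w : ℕ → ℝ} (hd : IsDist d) {P X : Finset ℕ} {z : ℕ → ℕ}
    {rad : ℕ → ℝ} {m : ℕ} (h : IsGreedy d w P X z rad m) {i j : ℕ} (hij : i < j) (hj : j < m) :
    z i ≠ z j := by
  obtain ⟨-, c, r, J, hc, hz, -, hsep⟩ := h j hj
  intro e
  have h₁ := hsep i hij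
  have h₂ := hc.dist_le hd (Nat.zero_le J) le_rfl
  rw [← hz, ← e, pow_zero, div_one] at h₂
  have h₃ : 0 < r / 4 ^ J := div_pos hc.pos (by positivity)
  linarith [hc.pos]

/-- Since radii only decrease, old heads keep dominating all current balls. The new head is far from
the old centers because the invariant bounds its current radius by its distances to them. -/
theorem IsGreedy.succ {d : ℕ → ℕ → ℝ} {w : ℕ → ℝ} (hw : ∀ v, 0 ≤ w v) {P X : Finset ℕ}
    {z : ℕ → ℕ} {rad rad' : ℕ → ℝ} {m : ℕ} (h : IsGreedy d w P X z rad m)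
    (hle : ∀ x ∈ X, rad' x ≤ rad x) {c : ℕ → ℕ} {J : ℕ}
    (hc : IsChain d w P X c (rad (c 0)) J)
    (hbest : ∀ x ∈ X, ballValue d w P x (rad x) ≤ ballValue d w P (c 0) (rad (c 0)))
    (hnew : ∀ x ∈ X, 32 * rad' x ≤ d x (c J)) :
    IsGreedy d w P X (Function.update z m (c J)) rad' (m + 1) := by
  intro i hi
  rcases Nat.lt_succ_iff_lt_or_eq.1 hi with hi | rfl
  · obtain ⟨h₁, c', r, J', hc', hz, hval, hsep⟩ := h i hi
    rw [Function.update_of_ne hi.ne]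
    refine ⟨fun x hx => (by linarith [hle x hx, h₁ x hx]), c', r, J', hc', hz,
      fun x hx => (ballValue_mono hw P x (hle x hx)).trans (hval x hx), fun i' hi' => ?_⟩
    rw [Function.update_of_ne (by omega)]
    exact hsep i' hi'
  · rw [Function.update_self]
    refine ⟨hnew, c, rad (c 0), J, hc, rfl,
      fun x hx => (ballValue_mono hw P x (hle x hx)).trans (hbest x hx), fun i' hi' => ?_⟩
    rw [Function.update_of_ne hi'.ne]
    exact (h i' hi').1 _ (hc.mem 0 (Nat.zero_le _))

/-- The state after the choice of `m` centers. -/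
structure GreedyState (n : ℕ) (d : ℕ → ℕ → ℝ) (w : ℕ → ℝ) (X : Finset ℕ) (rmax rmin : ℝ) (L m : ℕ)
    (s : State) : Prop where
  table : HasTable n d w X rmax rmin L s
  radius : ∀ a < X.card, HasRadius rmax rmin s a
  mem : ∀ i < m, s.warr 0 i ∈ X
  greedy : ∃ rad : ℕ → ℝ, (∀ a < X.card, rad (s.warr 2 a) = s.rarr 2 a) ∧
    IsGreedy d w (Finset.range n) X (s.warr 0) rad m ∧
    (∀ x ∈ X, rad x = 0 → ∃ i < m, s.warr 0 i = x) ∧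
    ((m = 0 ∧ ∀ x ∈ X, rad x = rmax) ∨ ∀ x ∈ X, ∃ i < m, d x (s.warr 0 i) ≤ 128 * rad x)

section

variable {E : Env} {n k : ℕ} {d : ℕ → ℕ → ℝ} {w : ℕ → ℝ} {s : State} {X : Finset ℕ}
  {rmax rmin : ℝ} {L : ℕ}

theorem run_chooseCenter (hE : Instance E n k d w) (hXn : ∀ x ∈ X, x < n)
    (hinj : ∀ x ∈ X, ∀ y ∈ X, d x y = 0 → x = y) (hR : IsScale d X rmax rmin)
    (hL : ∀ l, rmin ≤ 128 * (rmax / 4 ^ l) → l < L) {m : ℕ} (hm : m < X.card)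
    (h12 : s.wvar 12 = m) (hs : GreedyState n d w X rmax rmin L m s) :
    Run E chooseCenter s fun t s' => t ≤ 800 * (L * (X.card * L)) ∧
      GreedyState n d w X rmax rmin L (m + 1) s' := by
  have hXc := card_le_of_lt hXn
  have hpos : 0 < rmax := hR.pos.trans_le hR.le
  have hL1 : 1 ≤ L := by
    have := hL 0 (by rw [pow_zero, div_one]; linarith [hR.le])
    omega
  have hinj' : ∀ x ∈ X, ∀ y ∈ X, d x y < rmin → x = y := by
    intro x hx y hy h
    refine hinj x hx y hy (le_antisymm (not_lt.1 fun h' => ?_) (hE.isDist.nonneg _ _))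
    linarith [hR.le_dist x hx y hy h']
  obtain ⟨hT, hrad, hmem, rad, hrf, hG, hzero, hcov⟩ := hs
  have hnn : ∀ a < X.card, 0 ≤ s.rarr 2 a := by
    intro a ha
    rcases hrad a ha with h | ⟨l, -, h, -⟩ <;> rw [h]
    positivity
  -- Points of radius 0 have already been opened, and fewer than `X.card` centers have been chosen.
  have hex : ∃ a < X.card, 0 < s.rarr 2 a := by
    by_contra h
    push Not at h
    have hsub : X ⊆ (Finset.range m).image (s.warr 0) := by
      intro x hx
      obtain ⟨a, ha, rfl⟩ := hT.lists.exists_eq hx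
      obtain ⟨i, hi, e⟩ := hzero _ hx ((hrf a ha).trans (le_antisymm (h a ha) (hnn a ha)))
      exact Finset.mem_image.2 ⟨i, Finset.mem_range.2 hi, e⟩
    have := (Finset.card_le_card hsub).trans Finset.card_image_le
    rw [Finset.card_range] at this
    omega
  refine Run.seq (run_pickHead hE hXn hT hL1 hrad hex) ?_
  rintro t₁ s₁ ⟨ht₁, hS₁, h21, hcpos, hbest⟩
  set a₀ := s₁.wvar 21 with ha₀
  obtain ⟨l₀, hl₀, hρ₀, h9⟩ := (hrad a₀ h21).resolve_left hcpos.ne'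
  simp only [run_seq, run_setW, run_setR, WExp.eval, RExp.eval, Function.update_self, hS₁.warr,
    hS₁.rarr, ← ha₀, WExp.time, RExp.time]
  refine (run_descend hE hXn hinj' (L := L) (l₀ := l₀) (rmin := rmin) (rmax := rmax) ?_ hpos hL
    hl₀ ?_ ?_ ?_).frame.mono ?_
  · refine (hT.same hS₁).congr ?_ ?_ ?_ ?_ ?_ ?_ <;> simp [hS₁.warr, hS₁.rarr]
  · simpa using h21
  · simpa using hρ₀
  · simpa [hS₁.wvar 9 (by decide)] using h9
  rintro t₂ s₂ ⟨⟨ht₂, hT₂, h10, c, J, hchain, hc0, hcJ⟩, hf₂⟩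
  have ew0 : s₂.warr 0 = s.warr 0 := by
    rw [hf₂.warr 0 (by decide)]
  have ew2 : s₂.warr 2 = s.warr 2 := by
    rw [hf₂.warr 2 (by decide)]
  have ew6 : s₂.warr 6 = s.warr 6 := by
    rw [hf₂.warr 6 (by decide)]
  have er2 : s₂.rarr 2 = s.rarr 2 := by
    rw [hf₂.rarr 2 (by decide)]
  have e12 : s₂.wvar 12 = m := by
    rw [hf₂.wvar 12 (by decide)]
    simpa [hS₁.wvar 12 (by decide)] using h12
  have e9 : s₂.wvar 9 = s.wvar 9 := by
    rw [hf₂.wvar 9 (by decide)]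
    simp [hS₁.wvar 9 (by decide)]
  set b := s₂.wvar 10 with hb
  have hc0' : c 0 = s.warr 2 a₀ := by simpa using hc0
  replace hcJ : c J = s.warr 2 b := hcJ
  simp only [run_putW, WExp.eval, e12, ew2, ← hb, ← hcJ, Nat.zero_mod, WExp.time, ew0]
  refine (run_forTo_const (hE.lt_modulus (show X.card < _ by omega)) (fun a s' =>
    HasTable n d w X rmax rmin L s' ∧ s'.wvar 10 = b ∧ s'.warr 2 = s.warr 2 ∧
    s'.wvar 9 = s.wvar 9 ∧ s'.warr 0 = Function.update (s.warr 0) m (c J) ∧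
    (∀ a' < X.card, HasRadius rmax rmin s' a') ∧
    (∀ a' < a, Shrunk (d (c J) (s.warr 2 a')) (s.rarr 2 a') (s'.rarr 2 a')) ∧
    ∀ a', a ≤ a' → s'.rarr 2 a' = s.rarr 2 a')
    (30 * L + 30) ?_ ?_ (Nat.zero_le _) ?_ ?_).mono ?_
  · rintro a - s' ⟨h, -⟩
    exact h.card_eq
  · rintro a ha s' hx ⟨hT', i10, iw2, i9, iw0, hrad', hold, hge⟩
    refine (run_shrink hE hXn hR.le_dist hT' hpos hL hx ha (by rwa [i10]) (hrad' a ha)).frame.mono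
      ?_
    rintro t s'' ⟨⟨ht, hra, hsh, hoth⟩, hf⟩
    rw [i10, iw2, ← hcJ, hge a le_rfl] at hsh
    refine ⟨ht, (hf.wvar 6 (by decide)).trans hx, ?_, ?_, ?_, ?_, ?_, ?_, ?_, ?_⟩
    · refine hT'.congr ?_ ?_ ?_ ?_ ?_ ?_ <;>
        simp [hf.wvar 0 (by decide), hf.wvar 5 (by decide), hf.wvar 9 (by decide),
          hf.warr 2 (by decide), hf.rvar 1 (by decide), hf.rarr 1 (by decide)]
    · simpa [hf.wvar 10 (by decide)] using i10
    · simpa [hf.warr 2 (by decide)] using iw2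
    · simpa [hf.wvar 9 (by decide)] using i9
    · simpa [hf.warr 0 (by decide)] using iw0
    · intro a' ha'
      rcases eq_or_ne a' a with rfl | hne
      · simpa [HasRadius] using hra
      · have := hrad' a' ha'
        rw [HasRadius] at this ⊢
        simpa [(hoth a' hne).1, (hoth a' hne).2, hf.wvar 9 (by decide)] using this
    · intro a' ha'
      rcases Nat.lt_succ_iff_lt_or_eq.1 ha' with h | rfl
      · dsimp only
        rw [(hoth a' h.ne).1]
        exact hold a' h
      · exact hsh
    · intro a' ha'
      dsimp only
      rw [(hoth a' (by omega)).1]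
      exact hge a' (by omega)
  · simp
  · refine ⟨?_, ?_, ?_, ?_, ?_, ?_, fun a' h => absurd h (Nat.not_lt_zero _), fun a' _ => ?_⟩
    · refine hT₂.congr ?_ ?_ ?_ ?_ ?_ ?_ <;> simp
    · simp [hb]
    · simpa using ew2
    · simpa using e9
    · simp
    · intro a' ha'
      have := hrad a' ha'
      rw [HasRadius] at this ⊢
      simpa [er2, ew6, e9] using this
    · rw [er2]
  rintro t₃ s₃ ⟨ht₃, -, hT₃, -, ew2', -, ew0', hrad₃, hsh, -⟩
  have htime : X.card * (30 * L + 30 + 9) ≤ 69 * (X.card * L) := by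
    have : X.card ≤ X.card * L := Nat.le_mul_of_pos_right _ hL1
    have e : X.card * (30 * L + 30 + 9) = 30 * (X.card * L) + 39 * X.card := by ring
    omega
  have h1 : 1 ≤ X.card * L := Nat.mul_pos (by omega) hL1
  have h2 : X.card * L ≤ L * (X.card * L) := Nat.le_mul_of_pos_left _ hL1
  refine ⟨?_, hT₃, hrad₃, ?_, ?_⟩
  · simp only [WExp.time, Nat.sub_zero, Nat.reduceAdd] at ht₃
    have e : X.card * (30 * L + 30 + (1 + 8)) = X.card * (30 * L + 30 + 9) := rfl
    omega
  · intro i hi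
    rw [ew0']
    rcases Nat.lt_succ_iff_lt_or_eq.1 hi with hi | rfl
    · rw [Function.update_of_ne hi.ne]
      exact hmem i hi
    · rw [Function.update_self]
      exact hchain.mem J le_rfl
  · obtain ⟨rad', hrf'⟩ := hT.lists.exists_fun (s₃.rarr 2)
    have hsh' : ∀ x ∈ X, Shrunk (d x (c J)) (rad x) (rad' x) := by
      intro x hx
      obtain ⟨a, ha, rfl⟩ := hT.lists.exists_eq hx
      rw [hrf a ha, hrf' a ha, hE.isDist.symm]
      exact hsh a ha
    have hr0 : rad (c 0) = rmax / 4 ^ l₀ := by rw [hc0', hrf a₀ h21, hρ₀]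
    rw [ew0', ew2']
    refine ⟨rad', hrf', hG.succ hE.nonneg (fun x hx => (hsh' x hx).le) (hr0 ▸ hchain) ?_
      fun x hx => (hsh' x hx).mul_le, fun x hx h0 => ?_, Or.inr fun x hx => ?_⟩
    · intro x hx
      obtain ⟨a, ha, rfl⟩ := hT.lists.exists_eq hx
      rcases (hnn a ha).lt_or_eq with h | h
      · rw [hc0', hrf a₀ h21, hrf a ha]
        exact hbest a ha h
      -- Points of radius 0 did not take part in the search, but their balls have value 0.
      · rw [hrf a ha, ← h, ballValue_of_nonpos hE.isDist _ _ le_rfl]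
        exact ballValue_nonneg hE.nonneg _ _ _
    · rcases (hsh' x hx).eq_zero h0 with h | h
      · obtain ⟨i, hi, e⟩ := hzero x hx h
        exact ⟨i, by omega, by rwa [Function.update_of_ne hi.ne]⟩
      · refine ⟨m, by omega, ?_⟩
        rw [Function.update_self]
        exact (hinj x hx _ (hchain.mem J le_rfl) (le_antisymm h (hE.isDist.nonneg _ _))).symm
    · rcases (hsh' x hx).cover with h | h
      -- An unchanged radius keeps its old witness. Before the first center all radii equal `rmax`,
      -- which bounds the distance to any new center.
      · rcases hcov with ⟨-, hcov⟩ | hcov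
        · refine ⟨m, by omega, ?_⟩
          rw [Function.update_self, h, hcov x hx]
          linarith [hR.dist_le x hx _ (hchain.mem J le_rfl)]
        · obtain ⟨i, hi, hle⟩ := hcov x hx
          exact ⟨i, by omega, by rwa [Function.update_of_ne hi.ne, h]⟩
      · exact ⟨m, by omega, by rwa [Function.update_self]⟩

theorem run_chooseCenters (hE : Instance E n k d w) (hXn : ∀ x ∈ X, x < n) (hXne : X.Nonempty)
    (hinj : ∀ x ∈ X, ∀ y ∈ X, d x y = 0 → x = y) (hR : IsScale d X rmax rmin)
    (hL : ∀ l, rmin ≤ 128 * (rmax / 4 ^ l) → l < L) (h0 : s.rvar 0 = rmax) (h1 : s.wvar 1 = k)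
    (hs : HasTable n d w X rmax rmin L s) :
    Run E chooseCenters s fun t s' => t ≤ 900 * (L * L * (n * k)) ∧ ∃ Z ⊆ X, Z.Nonempty ∧
      Z.card ≤ k ∧ Lists (s'.warr 0) (s'.wvar 0) Z ∧
      ∀ T ⊆ X, T.Nonempty → T.card ≤ k →
        costOn d w (Finset.range n) Z ≤ 257 * costOn d w (Finset.range n) T := by
  have hXc := card_le_of_lt hXn
  have hXp : 0 < X.card := Finset.card_pos.2 hXne
  have hk := hE.one_le
  have hkn := hE.le
  have hL0 : rmin ≤ 128 * (rmax / 4 ^ 0) := by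
    rw [pow_zero, div_one]
    linarith [hR.le, hR.pos]
  have hL1 : 1 ≤ L := by
    have := hL 0 hL0
    omega
  rw [chooseCenters, run_seq, run_setW]
  refine Run.seq (run_forTo_const (hE.lt_modulus (show X.card < _ by omega)) (fun a s' =>
    HasTable n d w X rmax rmin L s' ∧ s'.rvar 0 = rmax ∧ s'.wvar 1 = k ∧
    ∀ a' < a, s'.rarr 2 a' = rmax ∧ s'.warr 6 a' = 0) 10 ?_ ?_ (Nat.zero_le _) ?_ ?_) ?_
  · rintro a - s' ⟨h, -⟩
    exact h.card_eq
  · rintro a ha s' hx ⟨hT, i0, i1, hold⟩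
    simp only [run_seq, run_putR, run_putW, WExp.eval, RExp.eval, hx, i0, Nat.zero_mod,
      WExp.time, RExp.time]
    refine ⟨by omega, trivial, ?_, trivial, ?_, fun a' ha' => ?_⟩
    · refine hT.congr ?_ ?_ ?_ ?_ ?_ ?_ <;> simp
    · simpa using i1
    · rcases eq_or_ne a' a with rfl | hne
      · simp
      · simpa [hne] using hold a' (by omega)
  · simp [WExp.eval]
  · refine ⟨?_, h0, by simpa using h1, fun a' h => absurd h (Nat.not_lt_zero _)⟩
    refine hs.congr ?_ ?_ ?_ ?_ ?_ ?_ <;> simp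
  rintro t₁ s₁ ⟨ht₁, -, hT₁, i0, i1, hinit⟩
  set K := min k X.card with hK
  have hset : Run E (.seq (.setW 11 (.var 5))
      (.ite (.wordLt (.var 1) (.var 11)) (.setW 11 (.var 1)) .skip)) s₁ fun t s' => t ≤ 10 ∧
        s' = { s₁ with wvar := Function.update s₁.wvar 11 K } := by
    simp only [run_seq, run_setW, run_ite, run_skip, Test.eval, WExp.eval, i1, hT₁.card_eq,
      Function.update_self, ne_eq, OfNat.one_ne_ofNat, not_false_eq_true, Function.update_of_ne,
      Test.time, WExp.time, not_le, not_lt, Function.update_idem]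
    refine ⟨fun h => ⟨by omega, ?_⟩, fun h => ⟨by omega, ?_⟩⟩
    · rw [hK, min_eq_left h.le]
    · rw [hK, min_eq_right h]
  refine Run.seq hset ?_
  rintro t₂ _ ⟨ht₂, rfl⟩
  simp only [run_seq, run_setW, WExp.eval, Nat.zero_mod, WExp.time]
  refine (run_forTo_const (hE.lt_modulus (show K < _ by omega)) (fun m s' => s'.wvar 11 = K ∧
    GreedyState n d w X rmax rmin L m s') (800 * (L * (X.card * L))) ?_ ?_ (Nat.zero_le _)
    ?_ ?_).mono ?_
  · rintro m - s' ⟨h, -⟩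
    exact h
  · rintro m hm s' hx ⟨h11, hG⟩
    refine (run_chooseCenter hE hXn hinj hR hL (by omega) hx hG).frame.mono ?_
    rintro t s'' ⟨⟨ht, hT, hr, hmem, hg⟩, hf⟩
    refine ⟨ht, (hf.wvar 12 (by decide)).trans hx, ?_, ?_, ?_, hmem, hg⟩
    · simpa [hf.wvar 11 (by decide)] using h11
    · refine hT.congr ?_ ?_ ?_ ?_ ?_ ?_ <;> simp
    · intro a ha
      simpa [HasRadius] using hr a ha
  · simp
  · refine ⟨by simp, ?_, fun a ha => Or.inr ⟨0, hL0, ?_, fun _ => ?_⟩,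
      fun i h => absurd h (Nat.not_lt_zero _), fun _ => rmax, fun a ha => (hinit a ha).1.symm,
      fun i h => absurd h (Nat.not_lt_zero _), fun x _ h => ?_, Or.inl ⟨rfl, fun _ _ => rfl⟩⟩
    · refine hT₁.congr ?_ ?_ ?_ ?_ ?_ ?_ <;> simp
    · simpa using (hinit a ha).1
    · simpa using (hinit a ha).2
    · linarith [hR.le, hR.pos]
  rintro t₃ s₃ ⟨ht₃, -, h11, hT₃, -, hmem, rad, -, hG, -, hcov⟩
  have hcov' := hcov.resolve_left fun h => by omega
  refine ⟨?_, (Finset.range K).image (s₃.warr 0),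
    Finset.image_subset_iff.2 fun i hi => hmem i (Finset.mem_range.1 hi),
    Finset.Nonempty.image ⟨0, Finset.mem_range.2 (by omega)⟩ _, ?_, ⟨?_, ?_⟩,
    fun T hTX hT hTk => ?_⟩
  · have e1 : K * (800 * (L * (X.card * L))) = 800 * (L * L * (X.card * K)) := by ring
    have e2 : L * L * (X.card * K) ≤ L * L * (n * k) :=
      Nat.mul_le_mul_left _ (Nat.mul_le_mul hXc (by omega))
    have e3 : 1 ≤ L * L := Nat.mul_pos hL1 hL1
    have e4 : n * k ≤ L * L * (n * k) := Nat.le_mul_of_pos_left _ e3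
    have e5 : n ≤ n * k := Nat.le_mul_of_pos_right _ hk
    simp only [WExp.time, Nat.sub_zero, mul_add, e1] at ht₁ ht₃ ⊢
    omega
  · refine Finset.card_image_le.trans ?_
    rw [Finset.card_range]
    omega
  · simp [h11]
  · simp only [h11, Function.update_self]
    rw [Finset.card_image_of_injOn, Finset.card_range]
    intro i hi j hj e
    by_contra hne
    simp only [Finset.coe_range, Set.mem_Iio] at hi hj
    rcases lt_or_gt_of_ne hne with h | h
    · exact hG.ne hE.isDist h hj e
    · exact hG.ne hE.isDist h hi e.symm
  -- The number of centers is `min k X.card`, hence at least the size of any admissible `T ⊆ X`.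
  · exact hG.costOn_le hE.isDist hE.nonneg hTX hT (le_min hTk (Finset.card_le_card hTX)) hcov'

end

/-! ### The complete algorithm -/

/-- The algorithm: delete points until at most `2 * k` candidates are left, and choose `k` centers
among them greedily. -/
def kMedian : Prog :=
  .seq reduceAll (.seq (.seq (.setW 3 (.lit 0)) (.seq (.setW 4 (.var 0)) gather))
    (.seq findScale (.seq fillTable chooseCenters)))

section

variable {E : Env} {n k : ℕ} {d : ℕ → ℕ → ℝ} {w : ℕ → ℝ} {s : State} {X : Finset ℕ}

/-- Bounds the number of levels by a ratio of two actual distances, or by an absolute constant when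
the scale is degenerate, as then its values need not be distances. -/
theorem IsScale.spread {rmax rmin : ℝ} (h : IsScale d X rmax rmin) (hXn : ∀ x ∈ X, x < n) {M : ℕ}
    (hM : rmin ≤ 128 * (rmax / 4 ^ M)) : (4 : ℝ) ^ M ≤ 128 ∨ ∃ x < n, ∃ y < n, ∃ x' < n, ∃ y' < n,
      0 < d x' y' ∧ 4 ^ M * d x' y' ≤ 128 * d x y := by
  have hp : (0 : ℝ) < 4 ^ M := by positivity
  have key : 4 ^ M * rmin ≤ 128 * rmax := by
    calc 4 ^ M * rmin ≤ 4 ^ M * (128 * (rmax / 4 ^ M)) := mul_le_mul_of_nonneg_left hM hp.le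
      _ = 128 * rmax := by field_simp
  have hpos := h.pos
  rcases h.tight with e | ⟨⟨x, hx, y, hy, rfl⟩, x', hx', y', hy', rfl⟩
  · left
    rw [← e] at key
    exact le_of_mul_le_mul_right key hpos
  · exact Or.inr ⟨x, hXn x hx, y, hXn y hy, x', hXn x' hx', y', hXn y' hy', hpos, key⟩

theorem run_kMedian (hE : Instance E n k d w) (h0 : s.wvar 0 = n) (h1 : s.wvar 1 = k)
    (hf : ∀ i, s.warr 1 i = 0) (hinj : ∀ i < n, ∀ j < n, d i j = 0 → i = j) {L : ℕ}
    (hL : n ≤ 2 ^ L * k) :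
    Run E kMedian s fun t s' =>
      (∃ Z ⊆ Finset.range n, Z.Nonempty ∧ Z.card ≤ k ∧ Lists (s'.warr 0) (s'.wvar 0) Z ∧
        ∀ T : Finset ℕ, T.Nonempty → T.card ≤ k → costOn d w (Finset.range n) Z ≤
          257 * (2 + 8 * L) * costOn d w (Finset.range n) T) ∧
      ∃ M : ℕ, t ≤ 7000 * (L + 1) * (n * k) + 1700 * (M + 1) ^ 2 * (n * k) ∧
        ((4 : ℝ) ^ M ≤ 128 ∨ ∃ x < n, ∃ y < n, ∃ x' < n, ∃ y' < n,
          0 < d x' y' ∧ 4 ^ M * d x' y' ≤ 128 * d x y) := by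
  have hk := hE.one_le
  have hkn := hE.le
  refine Run.seq (run_reduceAll hE h0 h1 hf hL).frame ?_
  rintro t₁ s₁ ⟨⟨ht₁, hne, hcard, hcost⟩, hf₁⟩
  set X := alive (s₁.warr 1) 0 n with hX
  have hXn : ∀ x ∈ X, x < n := by
    intro x hx
    simp only [hX, alive, Finset.mem_filter, Finset.mem_Ico] at hx
    exact hx.1.2
  have e0 : s₁.wvar 0 = n := (hf₁.wvar 0 (by decide)).trans h0
  have e1 : s₁.wvar 1 = k := (hf₁.wvar 1 (by decide)).trans h1
  have hgather : Run E (.seq (.setW 3 (.lit 0)) (.seq (.setW 4 (.var 0)) gather)) s₁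
      fun t s' => t ≤ 30 * n + 34 ∧ Lists (s'.warr 2) (s'.wvar 5) X := by
    simp only [run_seq, run_setW, WExp.eval, WExp.time, Nat.zero_mod]
    refine (run_gather hE (a := 0) (b := n) ?_ ?_ (Nat.zero_le _) le_rfl).mono ?_
    · simp
    · simpa using e0
    · rintro t s' ⟨ht, h⟩
      exact ⟨by omega, h⟩
  refine Run.seq hgather.frame ?_
  rintro t₂ s₂ ⟨⟨ht₂, hlist⟩, hf₂⟩
  have h5 : s₂.wvar 5 = X.card := hlist.2.symm
  rw [h5] at hlist
  replace e0 : s₂.wvar 0 = n := (hf₂.wvar 0 (by decide)).trans e0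
  replace e1 : s₂.wvar 1 = k := (hf₂.wvar 1 (by decide)).trans e1
  refine Run.seq (run_findScale hE hlist hXn h5).frame ?_
  rintro t₃ s₃ ⟨⟨ht₃, hR⟩, hf₃⟩
  replace e0 : s₃.wvar 0 = n := (hf₃.wvar 0 (by decide)).trans e0
  replace e1 : s₃.wvar 1 = k := (hf₃.wvar 1 (by decide)).trans e1
  replace h5 : s₃.wvar 5 = X.card := (hf₃.wvar 5 (by decide)).trans h5
  replace hlist : Lists (s₃.warr 2) X.card X := by
    rwa [hf₃.warr 2 (by decide)]
  have hpos : 0 < s₃.rvar 0 := hR.pos.trans_le hR.le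
  -- The last relevant level. The greedy phase is run with `M + 1` as its number of levels.
  obtain ⟨M, hM, hM'⟩ : ∃ M : ℕ, s₃.rvar 1 ≤ 128 * (s₃.rvar 0 / 4 ^ M) ∧
      128 * (s₃.rvar 0 / 4 ^ (M + 1)) < s₃.rvar 1 := by
    have hex : ∃ l : ℕ, 128 * (s₃.rvar 0 / 4 ^ l) < s₃.rvar 1 := by
      obtain ⟨l, hl⟩ := pow_unbounded_of_one_lt (128 * s₃.rvar 0 / s₃.rvar 1)
        (by norm_num : (1 : ℝ) < 4)
      refine ⟨l, ?_⟩
      rw [div_lt_iff₀ hR.pos] at hl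
      rw [← mul_div_assoc, div_lt_iff₀ (by positivity)]
      linarith
    classical
    obtain ⟨M, e⟩ : ∃ M, Nat.find hex = M + 1 := by
      refine Nat.exists_eq_succ_of_ne_zero fun h => ?_
      have := Nat.find_spec hex
      rw [h, pow_zero, div_one] at this
      linarith [hR.le, hR.pos]
    exact ⟨M, not_lt.1 (Nat.find_min hex (by omega)), e ▸ Nat.find_spec hex⟩
  refine Run.seq (run_fillTable hE hlist hXn e0 h5 hne rfl rfl hpos hM').frame ?_
  rintro t₄ s₄ ⟨⟨ht₄, hT⟩, hf₄⟩
  refine (run_chooseCenters hE hXn hne (fun x hx y hy => hinj x (hXn x hx) y (hXn y hy)) hR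
    (fun l hl => ?_) (hf₄.rvar 0 (by decide)) ((hf₄.wvar 1 (by decide)).trans e1) hT).mono ?_
  · by_contra h
    have : s₃.rvar 0 / 4 ^ l ≤ s₃.rvar 0 / 4 ^ (M + 1) :=
      div_le_div_of_nonneg_left hpos.le (by positivity)
        (pow_le_pow_right₀ (by norm_num) (not_lt.1 h))
    linarith
  rintro t₅ s₅ ⟨ht₅, Z, hZX, hZne, hZk, hZ, hopt⟩
  refine ⟨⟨Z, fun z hz => Finset.mem_range.2 (hXn z (hZX hz)), hZne, hZk, hZ, fun T hTne hTk => ?_⟩,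
    M, ?_, hR.spread hXn hM⟩
  -- The factor is `257 (2 cost(T) + cost(X))` with `cost(X) ≤ 8 L cost(T)`.
  · obtain ⟨T', hT'X, hT'ne, hT'k, hT'⟩ := exists_projection hE.isDist hE.nonneg
      (P := Finset.range n) hne hTne
    have h₁ := hopt T' hT'X hT'ne (hT'k.trans hTk)
    have h₂ := hcost T hTne hTk
    linarith
  · have hXc := card_le_of_lt hXn
    have b₁ : X.card * X.card ≤ 2 * (n * k) := by
      calc X.card * X.card ≤ n * (2 * k) := Nat.mul_le_mul hXc hcard
        _ = 2 * (n * k) := by ring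
    have b₂ : n * X.card ≤ 2 * (n * k) := by
      calc n * X.card ≤ n * (2 * k) := Nat.mul_le_mul_left _ hcard
        _ = 2 * (n * k) := by ring
    have b₃ : n ≤ n * k := Nat.le_mul_of_pos_right _ hk
    have b₄ : 200 * (M + 1 + 1) * (n * X.card) ≤ 200 * (M + 1 + 1) * (2 * (n * k)) :=
      Nat.mul_le_mul_left _ b₂
    generalize n * k = N at *
    have b₅ : M * N ≤ M * M * N := Nat.mul_le_mul_right _ (Nat.le_mul_self M)
    have c₁ : 200 * (M + 1 + 1) * (2 * N) = 400 * (M * N) + 800 * N := by ring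
    have c₂ : 900 * ((M + 1) * (M + 1) * N) = 900 * (M * M * N) + 1800 * (M * N) + 900 * N := by
      ring
    have c₃ : 1700 * (M + 1) ^ 2 * N = 1700 * (M * M * N) + 3400 * (M * N) + 1700 * N := by ring
    have c₄ : 7000 * (L + 1) * N = 7000 * (L * N) + 7000 * N := by ring
    have c₅ : 6100 * (L + 1) * N = 6100 * (L * N) + 6100 * N := by ring
    omega

end

/-! ### From metric spaces to numbered points -/

section

variable {V : Type*} {n : ℕ}

theorem card_image_numbering (e : V ≃ Fin n) (S : Finset V) :
    (S.image fun y => (e y : ℕ)).card = S.card :=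
  Finset.card_image_of_injective _ (Fin.val_injective.comp e.injective)

theorem exists_image_numbering (e : V ≃ Fin n) {Z : Finset ℕ} (hZ : Z ⊆ Finset.range n) :
    ∃ S : Finset V, S.image (fun y => (e y : ℕ)) = Z := by
  classical
  refine ⟨(Finset.univ.filter fun i : Fin n => (i : ℕ) ∈ Z).image e.symm, ?_⟩
  ext z
  simp only [Finset.mem_image, Finset.mem_filter, Finset.mem_univ, true_and]
  constructor
  · rintro ⟨-, ⟨i, hi, rfl⟩, rfl⟩
    simpa using hi
  · intro hz
    exact ⟨_, ⟨⟨z, Finset.mem_range.1 (hZ hz)⟩, hz, rfl⟩, by simp⟩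

variable [MetricSpace V]

/-- The distances between points given by their numbers; numbers that are too large refer to the
first point. -/
noncomputable def numberedDist (hn : 0 < n) (e : V ≃ Fin n) (i j : ℕ) : ℝ :=
  Dist.dist (e.symm (if hi : i < n then ⟨i, hi⟩ else ⟨0, hn⟩))
    (e.symm (if hj : j < n then ⟨j, hj⟩ else ⟨0, hn⟩))

theorem numberedDist_of_lt (hn : 0 < n) (e : V ≃ Fin n) {i j : ℕ} (hi : i < n) (hj : j < n) :
    numberedDist hn e i j = Dist.dist (e.symm ⟨i, hi⟩) (e.symm ⟨j, hj⟩) := by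
  rw [numberedDist, dif_pos hi, dif_pos hj]

theorem numberedDist_apply (hn : 0 < n) (e : V ≃ Fin n) (x y : V) :
    numberedDist hn e (e x) (e y) = Dist.dist x y := by
  rw [numberedDist_of_lt hn e (e x).2 (e y).2]
  simp

theorem isDist_numberedDist (hn : 0 < n) (e : V ≃ Fin n) : IsDist (numberedDist hn e) where
  self _ := dist_self _
  symm _ _ := dist_comm _ _
  tri _ _ _ := dist_triangle _ _ _

theorem instance_env {k : ℕ} (hk : 1 ≤ k) (hkn : k ≤ n) (hn : 0 < n) (e : V ≃ Fin n)
    (w : V → ℝ≥0) : Instance (env 9 e w) n k (numberedDist hn e) (env 9 e w).weight where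
  one_le := hk
  le := hkn
  modulus := by
    have h : n + 1 ≤ 2 ^ n.size := n.lt_size_self
    -- Nine times the word length of `n` suffices: two parts dominate `(n + 1) ^ 2` and seven
    -- dominate `128 = 2 ^ 7`, as `n` has at least one bit.
    have h₂ : 2 ^ 7 ≤ (2 ^ n.size) ^ 7 := Nat.pow_le_pow_left (by omega) 7
    calc 128 * (n + 1) ^ 2 ≤ (2 ^ n.size) ^ 7 * (2 ^ n.size) ^ 2 :=
          Nat.mul_le_mul (by simpa using h₂) (Nat.pow_le_pow_left h 2)
      _ = 2 ^ (9 * n.size) := by rw [← pow_add, ← pow_mul, mul_comm]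
  dist i hi j hj := by
    rw [numberedDist_of_lt hn e hi hj]
    exact dif_pos ⟨hi, hj⟩
  weight _ _ := rfl
  isDist := isDist_numberedDist hn e
  nonneg i := by
    simp only [env]
    split_ifs
    exacts [NNReal.coe_nonneg _, le_rfl]

theorem minDist_image (hn : 0 < n) (e : V ≃ Fin n) {S : Finset V} (hS : S.Nonempty) (x : V) :
    minDist (numberedDist hn e) (e x) (S.image fun y => (e y : ℕ)) =
      Metric.infDist x (S : Set V) := by
  refine le_antisymm ((Metric.le_infDist (by simpa using hS)).2 fun y hy => ?_) ?_
  · rw [← numberedDist_apply hn e x y]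
    exact minDist_le (Finset.mem_image_of_mem _ hy)
  · obtain ⟨i, hi, h⟩ := exists_minDist_eq (d := numberedDist hn e)
      (hS.image fun y => (e y : ℕ)) (e x)
    obtain ⟨y, hy, rfl⟩ := Finset.mem_image.1 hi
    rw [h, numberedDist_apply]
    exact Metric.infDist_le_dist_of_mem hy

theorem cost_eq_costOn [Fintype V] (hn : 0 < n) (e : V ≃ Fin n) (b : ℕ) (w : V → ℝ≥0)
    {S : Finset V} (hS : S.Nonempty) :
    cost w S = costOn (numberedDist hn e) (env b e w).weight (Finset.range n)
      (S.image fun y => (e y : ℕ)) := by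
  rw [costOn, Finset.sum_range, ← e.sum_comp, cost]
  refine Finset.sum_congr rfl fun x _ => ?_
  rw [minDist_image hn e hS]
  simp [env]

theorem le_opt [Fintype V] {w : V → ℝ≥0} {k : ℕ} (hk : k ≤ Fintype.card V) {c C : ℝ} (hC : 0 < C)
    (h : ∀ T : Finset V, T.card = k → c ≤ C * cost w T) : c ≤ C * opt w k := by
  obtain ⟨T, -, hT⟩ := Finset.exists_subset_card_eq (s := (Finset.univ : Finset V)) hk
  have : Nonempty {T : Finset V // T.card = k} := ⟨⟨T, hT⟩⟩
  rw [← div_le_iff₀' hC]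
  exact le_ciInf fun T => (div_le_iff₀' hC).2 (h T.1 T.2)

theorem opt_nonneg [Fintype V] (w : V → ℝ≥0) (k : ℕ) : 0 ≤ opt w k :=
  Real.iInf_nonneg fun _ => Finset.sum_nonneg fun _ _ =>
    mul_nonneg (NNReal.coe_nonneg _) Metric.infDist_nonneg

theorem dist_div_dist_le_aspectRatio [Finite V] {x y x' y' : V} (h : x' ≠ y') :
    Dist.dist x y / Dist.dist x' y' ≤ aspectRatio V := by
  have hfin : (Set.univ : Set V).Finite := Set.finite_univ
  have hpos : 0 < Set.infsep (Set.univ : Set V) := by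
    rw [hfin.infsep_pos_iff_nontrivial]
    exact ⟨x', trivial, y', trivial, h⟩
  exact div_le_div₀ Metric.diam_nonneg (Metric.dist_le_diam_of_mem hfin.isBounded trivial trivial)
    hpos (Set.infsep_le_dist_of_mem (Set.mem_univ _) (Set.mem_univ _) h)

theorem log_aspectRatio_nonneg [Finite V] : 0 ≤ Real.log (aspectRatio V) := by
  cases subsingleton_or_nontrivial V with
  | inl h => simp [aspectRatio, Metric.diam_subsingleton Set.subsingleton_of_subsingleton]
  | inr h =>
    obtain ⟨x, y, hxy⟩ := exists_pair_ne V
    have := dist_div_dist_le_aspectRatio (x := x) (y := y) hxy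
    rw [div_self (dist_ne_zero.2 hxy)] at this
    exact Real.log_nonneg this

end

/-! ### Numbers of levels as logarithms -/

theorem one_le_log_four : 1 ≤ Real.log 4 := by
  rw [Real.le_log_iff_exp_le (by norm_num)]
  linarith [Real.exp_one_lt_d9]

/-- A logarithmic number of levels for a ratio of scales at most `128 * a`. -/
theorem le_four_add_log {M : ℕ} {a : ℝ} (ha : 0 < a) (h : 4 ^ M ≤ 128 * a)
    (ha' : 0 ≤ Real.log a) : (M : ℝ) ≤ 4 + Real.log a := by
  have h₁ := Real.log_le_log (by positivity) h
  have h₂ : Real.log 128 ≤ 4 * Real.log 4 := by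
    rw [← Real.log_rpow (by norm_num)]
    exact Real.log_le_log (by norm_num) (by norm_num)
  rw [Real.log_pow, Real.log_mul (by norm_num) ha.ne'] at h₁
  have h₃ := one_le_log_four
  rcases le_total (M : ℝ) 4 with hM | hM
  · linarith
  · nlinarith

/-- The least `L` satisfies `2 ^ (L - 1) < n / k` unless it is 0, and `1 / log 2 < 2`. -/
theorem exists_le_two_pow_mul {n k : ℕ} (hk : 1 ≤ k) (hkn : k ≤ n) :
    ∃ L : ℕ, n ≤ 2 ^ L * k ∧ (L : ℝ) ≤ 1 + 2 * Real.log ((n : ℝ) / k) := by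
  have hk' : (0 : ℝ) < k := by exact_mod_cast hk
  have h0 : 0 ≤ Real.log ((n : ℝ) / k) :=
    Real.log_nonneg ((one_le_div hk').2 (by exact_mod_cast hkn))
  have hex : ∃ L, n ≤ 2 ^ L * k :=
    ⟨n, n.lt_two_pow_self.le.trans (Nat.le_mul_of_pos_right _ hk)⟩
  classical
  refine ⟨Nat.find hex, Nat.find_spec hex, ?_⟩
  rcases h : Nat.find hex with _ | L
  · push_cast
    linarith
  have h₁ : 2 ^ L * k < n := not_le.1 (Nat.find_min hex (by omega))
  have h₂ : (2 : ℝ) ^ L ≤ n / k := by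
    rw [le_div_iff₀ hk']
    exact_mod_cast h₁.le
  have h₃ := Real.log_le_log (by positivity) h₂
  rw [Real.log_pow] at h₃
  have h₄ := Real.log_two_gt_d9
  push_cast
  nlinarith

end KMedian

theorem theorem1 :
    ∃ (P : KMedian.Prog) (b : ℕ) (A B : ℝ) (c : ℕ), 1 ≤ b ∧
      ∀ (n k : ℕ), 1 ≤ k → k ≤ n →
      ∀ (V : Type*) [Fintype V] [MetricSpace V] (e : V ≃ Fin n) (w : V → ℝ≥0),
        ∃ (t : ℕ) (S : Finset V),
          KMedian.Computes P b e w k t S ∧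
          S.Nonempty ∧ S.card ≤ k ∧
          KMedian.cost w S ≤ A * (1 + Real.log ((n : ℝ) / k)) * KMedian.opt w k ∧
          (t : ℝ) ≤ B * ((n : ℝ) * k) *
            (1 + Real.log n + Real.log (KMedian.aspectRatio V)) ^ c := by
  open KMedian in
  -- With `L ≤ 1 + 2 log (n / k)` the factor `257 (2 + 8 L)` is at most `257 * 16 = 4112` times `1 +
  -- log (n / k)`. With `L + 1 ≤ 2 u` and `M + 1 ≤ 5 u` the time constant is `7000 * 2 + 1700 * 25 =
  -- 56500`, where `u ≥ 1` is the sum of 1 and the two logarithms.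
  refine ⟨kMedian, 9, 4112, 56500, 2, by norm_num, fun n k hk hkn V _ _ e w => ?_⟩
  have hn : 0 < n := by omega
  have hk' : (1 : ℝ) ≤ k := by exact_mod_cast hk
  have hn' : (1 : ℝ) ≤ n := by exact_mod_cast hn
  have hlog : 0 ≤ Real.log ((n : ℝ) / k) :=
    Real.log_nonneg ((one_le_div (by linarith)).2 (by exact_mod_cast hkn))
  have hlog' : Real.log ((n : ℝ) / k) ≤ Real.log n :=
    Real.log_le_log (by positivity) (div_le_self (by linarith) hk')
  have hasp := log_aspectRatio_nonneg (V := V)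
  obtain ⟨L, hL, hL'⟩ := exists_le_two_pow_mul hk hkn
  obtain ⟨t, s, hexec, ⟨Z, hZn, hZne, hZk, hZ, hcost⟩, M, ht, hM⟩ :=
    run_kMedian (s := initial n k) (instance_env hk hkn hn e w) rfl rfl (fun _ => rfl)
      (fun i hi j hj h => by
        rw [numberedDist_of_lt hn e hi hj, dist_eq_zero] at h
        simpa using h) hL
  obtain ⟨S, rfl⟩ := exists_image_numbering e hZn
  have hS : S.Nonempty := Finset.image_nonempty.1 hZne
  have hcard := card_image_numbering e S
  have hc := hZ.2
  refine ⟨t, S, ⟨s, hexec, by omega, ?_⟩, hS, by omega, ?_, ?_⟩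
  · rw [← hcard, hc]
    exact hZ.1
  · have hV : k ≤ Fintype.card V := by
      rw [Fintype.card_congr e, Fintype.card_fin]
      exact hkn
    have h : cost w S ≤ 257 * (2 + 8 * L) * opt w k := by
      refine le_opt hV (by positivity) fun T hT => ?_
      have hTne : T.Nonempty := Finset.card_pos.1 (by omega)
      rw [cost_eq_costOn hn e 9 w hS, cost_eq_costOn hn e 9 w hTne]
      exact hcost _ (hTne.image _) (by rw [card_image_numbering, hT])
    exact h.trans (mul_le_mul_of_nonneg_right (by linarith) (opt_nonneg w k))
  · have hM' : (M : ℝ) ≤ 4 + Real.log (aspectRatio V) := by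
      rcases hM with h | ⟨x, hx, y, hy, x', hx', y', hy', hpos, h⟩
      · have := le_four_add_log one_pos (by simpa using h) (by simp)
        rw [Real.log_one] at this
        linarith
      · rw [numberedDist_of_lt hn e hx hy, numberedDist_of_lt hn e hx' hy'] at h
        rw [numberedDist_of_lt hn e hx' hy'] at hpos
        have hr := dist_div_dist_le_aspectRatio (x := e.symm ⟨x, hx⟩) (y := e.symm ⟨y, hy⟩)
          (dist_pos.1 hpos)
        rw [← le_div_iff₀ hpos, mul_div_assoc] at h
        have h' : (4 : ℝ) ^ M ≤ 128 * aspectRatio V := by linarith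
        have : (0 : ℝ) < 4 ^ M := by positivity
        exact le_four_add_log (by linarith) h' hasp
    have ht' : (t : ℝ) ≤ (7000 * (L + 1) + 1700 * (M + 1) ^ 2) * (n * k) := by
      rw [add_mul]
      exact_mod_cast ht
    refine ht'.trans ?_
    rw [mul_right_comm]
    refine mul_le_mul_of_nonneg_right ?_ (by positivity)
    set u := 1 + Real.log n + Real.log (aspectRatio V) with hu
    have hu1 : 1 ≤ u := by linarith
    have hLu : (L : ℝ) + 1 ≤ 2 * u := by linarith
    have hMu : ((M : ℝ) + 1) ^ 2 ≤ (5 * u) ^ 2 :=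
      pow_le_pow_left₀ (by positivity) (by linarith) 2
    nlinarith
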